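/- Let $k\ge 2$ and let $(M,g)$ be a $2k$-dimensional Lorentzian manifold of Kähler–Sasaki type, with shearfree structure $(\mathscr W,[h])$, $h=g|_{\mathscr W}$. This means the following. (i) $\pi:M\to S$ is a principal $A$-bundle, $A=\mathbb R$ or $S^1$. $\mathscr W\subset TM$ is a distribution of codimension one, $h=g|_{\mathscr W}$ is semipositive with one-dimensional kernel $\ker h$, and $(\mathscr W,[h])$ is shearfree: locally $\mathscr L_{\mathrm p}\mathscr W\subset\mathscr W$ and $\mathscr L_{\mathrm p}h=fh$ for a nowhere zero $\mathrm p\in\ker h$. Moreover $(\mathscr W,[h])$ is $A$-invariant, $\ker h$ is the vertical distribution of $\pi$, and $(\mathscr W,[h])$ is twisting: $\dim\ker(d\vartheta'|_{\mathscr W})=1$ for the local defining $1$-forms $\vartheta'$ of $\mathscr W$. (ii) $\pi_*\mathscr W=\ker\theta$ for a contact form $\theta$ on $S$ with Reeb field $Z$. $(\ker\theta,J)$ is an integrable CR structure on $S$ with positive definite Levi form $h^\theta=d\theta(\cdot,J\cdot)$ and $\mathscr L_ZJ=0$ (so $S$ is a Sasaki manifold), and $[h]$ projects to the conformal class $[h^\theta]$.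 (iii) The Sasaki manifold is regular: $Z$ generates a free action of $A'=\mathbb R$ or $S^1$ which makes $\pi^S:S\to N$ a principal $A'$-bundle over a Kähler manifold $(N,J^N,g^N)$ of complex dimension $k-1$, such that $J$ projects to $J^N$ and $d\theta=(\pi^S)^*\omega^N$, where $g^N=\omega^N(\cdot,J^N\cdot)$. A *generalised electromagnetic plane wave* on an oriented open set $U\subset M$ is a harmonic $k$-form $F$ (that is, $dF=0=d({\ast}F)$) of the form $F=\vartheta\wedge\alpha$, with $\vartheta$ a null $1$-form and $\alpha$ a $(k-1)$-form such that every null vector in $\ker\vartheta$ lies in $\ker\alpha$. Its *flag structure* is the pair $(\ker F\cap\ker{\ast}F,\ \ker\vartheta)$. Then locally there exists a non-trivial generalised electromagnetic plane wave on $M$ with flag structure $(\ker h,\mathscr W)$. Explicitly, let $\vartheta=\pi^*\theta$, let $x_0\in M$, and let $(z^1,\dots,z^{k-1})$ be holomorphic coordinates of $N$ around $\pi^S(\pi(x_0))$, pulled back to $M$. Then $x_0$ has an orientable open neighbourhood $U$ such that, for the Hodge operator ${\ast}$ of each orientation of $U$, the complex form $$\mathscr F=\vartheta\wedge dz^1\wedge\dots\wedge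 dz^{k-1}$$ satisfies on $U$ $$d\mathscr F=0,\qquad {\ast}\mathscr F=\varepsilon\, i^{k-1}\mathscr F\ \text{ with a constant } \varepsilon\in\{1,-1\},\qquad d({\ast}\mathscr F)=0,$$ and the real part $F=\operatorname{Re}\mathscr F=\vartheta\wedge\operatorname{Re}(dz^1\wedge\dots\wedge dz^{k-1})$ is a nowhere vanishing generalised electromagnetic plane wave on $U$ with flag structure $(\ker h,\mathscr W)$. -/

import Mathlib

open Set
open scoped Manifold ContDiff Topology

noncomputable section

namespace KahlerSasaki

/-! ### Multilinear algebra of a single tangent space -/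

theorem append_update {X : Type*} {k l : ℕ} (u : Fin k → X) (w : Fin l → X)
    (i : Fin l) (a : X) :
    Fin.append u (Function.update w i a) =
      Function.update (Fin.append u w) (Fin.natAdd k i) a := by
  ext1 j
  refine Fin.addCases (fun j => ?_) (fun j => ?_) j
  · rw [Fin.append_left, Function.update_of_ne, Fin.append_left]
    intro h
    have := congrArg Fin.val h
    simp at this
    omega
  · by_cases h : j = i
    · subst h; simp
    · rw [Fin.append_right, Function.update_of_ne h, Function.update_of_ne, Fin.append_right]
      intro h'
      exact h (by simpa using h')

section LinearAlgebra

variable {E : Type*} [NormedAddCommGroup E] [NormedSpace ℝ E]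
  {F : Type*} [NormedAddCommGroup F] [NormedSpace ℝ F] {k l : ℕ}

/-- The wedge product `θ ∧ α` of a 1-form and a `k`-form with real or complex values:
`(θ ∧ α)(v₀, …, v_k) = ∑ i, (-1)^i θ(v_i) α(v₀, …, v̂_i, …, v_k)`. -/
def wedgeOne {𝕜 : Type*} [RCLike 𝕜] (θ : E →L[ℝ] 𝕜) (α : E [⋀^Fin k]→L[ℝ] 𝕜) :
    E [⋀^Fin (k + 1)]→L[ℝ] 𝕜 :=
  ContinuousAlternatingMap.alternatizeUncurryFin (θ.smulRight α)

/-- The wedge product `lam 0 ∧ ⋯ ∧ lam (k-1)` of complex valued 1-forms. -/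
def wedgeProd : (k : ℕ) → (Fin k → (E →L[ℝ] ℂ)) → E [⋀^Fin k]→L[ℝ] ℂ
  | 0, _ => ContinuousAlternatingMap.constOfIsEmpty ℝ E (Fin 0) (1 : ℂ)
  | (k + 1), lam => wedgeOne (lam 0) (wedgeProd k (Fin.tail lam))

/-- The real part of a complex valued form. -/
def reForm (α : E [⋀^Fin k]→L[ℝ] ℂ) : E [⋀^Fin k]→L[ℝ] ℝ :=
  Complex.reCLM.compContinuousAlternatingMap α

/-- The kernel of a form: all `v` with `v ⌟ α = 0`. -/
def formKernel (α : E [⋀^Fin k]→L[ℝ] F) : Submodule ℝ E where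
  carrier := {v | ∀ (w : Fin k → E) (i : Fin k), α (Function.update w i v) = 0}
  add_mem' := by
    intro a b ha hb w i
    rw [α.map_update_add, ha w i, hb w i, add_zero]
  zero_mem' := by
    intro w i
    exact α.map_coord_zero i (by simp)
  smul_mem' := by
    intro c a ha w i
    rw [α.map_update_smul, ha w i, smul_zero]

/-- The kernel `{v ∈ W | h(v, w) = 0 for all w ∈ W}` of the restriction `h|_W`. -/
def radical (W : Submodule ℝ E) (h : E →L[ℝ] E →L[ℝ] ℝ) : Submodule ℝ E where
  carrier := {v | v ∈ W ∧ ∀ w ∈ W, h v w = 0}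
  add_mem' := by
    rintro a b ⟨ha, ha'⟩ ⟨hb, hb'⟩
    exact ⟨W.add_mem ha hb, fun w hw => by simp [ha' w hw, hb' w hw]⟩
  zero_mem' := ⟨W.zero_mem, fun w _ => by simp⟩
  smul_mem' := by
    rintro c a ⟨ha, ha'⟩
    exact ⟨W.smul_mem c ha, fun w hw => by simp [ha' w hw]⟩

/-- The kernel of the restriction of a 2-form to `W`. -/
def formRadical (W : Submodule ℝ E) (β : E [⋀^Fin 2]→L[ℝ] ℝ) : Submodule ℝ E where
  carrier := {v | v ∈ W ∧ ∀ w ∈ W, β ![v, w] = 0}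
  add_mem' := by
    rintro a b ⟨ha, ha'⟩ ⟨hb, hb'⟩
    refine ⟨W.add_mem ha hb, fun w hw => ?_⟩
    have e : β ![a + b, w] = β ![a, w] + β ![b, w] := β.vecCons_add ![w] a b
    rw [e, ha' w hw, hb' w hw, add_zero]
  zero_mem' := ⟨W.zero_mem, fun w _ => β.map_coord_zero 0 (by simp)⟩
  smul_mem' := by
    rintro c a ⟨ha, ha'⟩
    refine ⟨W.smul_mem c ha, fun w hw => ?_⟩
    have e : β ![c • a, w] = c • β ![a, w] := β.vecCons_smul ![w] c a
    rw [e, ha' w hw, smul_zero]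

/-- Contraction of a `(k+l)`-form with `u₁, …, u_k` in its first `k` slots. -/
def contractFirst (β : E [⋀^Fin (k + l)]→L[ℝ] F) (u : Fin k → E) : E [⋀^Fin l]→L[ℝ] F where
  toFun w := β (Fin.append u w)
  map_update_add' := by
    intro d w i a b
    rw [Subsingleton.elim d (instDecidableEqFin l)]
    simp only [append_update, β.map_update_add]
  map_update_smul' := by
    intro d w i c a
    rw [Subsingleton.elim d (instDecidableEqFin l)]
    simp only [append_update, β.map_update_smul]
  cont := by
    refine β.cont.comp (continuous_pi fun j => ?_)
    refine Fin.addCases (fun j => ?_) (fun j => ?_) j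
    · simpa using continuous_const
    · simpa using continuous_apply j
  map_eq_zero_of_eq' := by
    intro w i j hw hij
    exact β.map_eq_zero_of_eq (i := Fin.natAdd k i) (j := Fin.natAdd k j) _
      (by simpa using hw) (by simpa using hij)

variable [FiniteDimensional ℝ E]

/-- For the basis `b = Module.finBasis ℝ E`, the vectors `bⁱ` with `g(bⁱ, b_j) = δⁱ_j`
(for a non-degenerate symmetric `g`), obtained from the inverse Gram matrix. -/
def dualFrame (g : E →L[ℝ] E →L[ℝ] ℝ) (i : Fin (Module.finrank ℝ E)) : E :=
  ∑ j, (Matrix.of fun a b => g (Module.finBasis ℝ E a) (Module.finBasis ℝ E b))⁻¹ i j •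
    Module.finBasis ℝ E j

/-- The Hodge star operator of the scalar product `g` and the volume form `vol`:
`(∗β)(w) = (1/k!) ∑_{i₁,…,i_k} β(b^{i₁}, …, b^{i_k}) vol(b_{i₁}, …, b_{i_k}, w)`.
It satisfies `α ∧ ∗β = g(α, β) vol`; on complex valued forms it is the complex linear extension. -/
def hodgeStar (g : E →L[ℝ] E →L[ℝ] ℝ) (vol : E [⋀^Fin (k + l)]→L[ℝ] ℝ)
    (β : E [⋀^Fin k]→L[ℝ] F) : E [⋀^Fin l]→L[ℝ] F :=
  ((k.factorial : ℝ)⁻¹) • ∑ i : Fin k → Fin (Module.finrank ℝ E),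
    (ContinuousLinearMap.toSpanSingleton ℝ (β fun a => dualFrame g (i a))).compContinuousAlternatingMap
      (contractFirst vol fun a => Module.finBasis ℝ E (i a))

end LinearAlgebra

/-! ### Tensor fields on manifolds

`M` is a smooth manifold without boundary, modelled on the normed space `E`. As everywhere in
Mathlib, the tangent space `TangentSpace 𝓘(ℝ, E) x` at `x : M` is the space `E`, a tangent vector
being read in the preferred chart `chartAt E x`. Hence a vector field is a map `M → E`, a `k`-form
is a map `M → E [⋀^Fin k]→L[ℝ] F`, and a distribution is a map `M → Submodule ℝ E`. -/

section Manifold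

variable {E : Type*} [NormedAddCommGroup E] [NormedSpace ℝ E]
  {M : Type*} [TopologicalSpace M] [ChartedSpace E M]
  {E' : Type*} [NormedAddCommGroup E'] [NormedSpace ℝ E']
  {M' : Type*} [TopologicalSpace M'] [ChartedSpace E' M']
  {F : Type*} [NormedAddCommGroup F] [NormedSpace ℝ F] {k : ℕ}

/-- The differential `df_x : T_x M → T_{f x} M'` of a map between manifolds. -/
def tangentMapAt (f : M → M') (x : M) : E →L[ℝ] E' :=
  mfderiv 𝓘(ℝ, E) 𝓘(ℝ, E') f x

/-- The differential of a function with values in a normed space. -/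
def differential (f : M → F) (x : M) : E →L[ℝ] F :=
  mfderiv 𝓘(ℝ, E) 𝓘(ℝ, F) f x

/-- The coordinate expression of a form in the preferred chart at `x₀`, that is, its pull-back by
the inverse of the chart. -/
def inChart (α : M → E [⋀^Fin k]→L[ℝ] F) (x₀ : M) (y : E) : E [⋀^Fin k]→L[ℝ] F :=
  (α ((chartAt E x₀).symm y)).compContinuousLinearMap
    (tangentMapAt (chartAt E x₀).symm y)

/-- Smoothness of a form on an open set: its coordinate expressions are smooth. -/
def SmoothFormOn (α : M → E [⋀^Fin k]→L[ℝ] F) (U : Set M) : Prop :=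
  ∀ x₀ : M, ContDiffOn ℝ ∞ (inChart α x₀)
    ((chartAt E x₀).target ∩ (chartAt E x₀).symm ⁻¹' U)

/-- The exterior derivative of a form, computed at `x` in the preferred chart at `x`, in which the
tangent vectors at `x` are read. -/
def extDer (α : M → E [⋀^Fin k]→L[ℝ] F) (x : M) : E [⋀^Fin (k + 1)]→L[ℝ] F :=
  extDeriv (inChart α x) (chartAt E x x)

/-- A field of covectors as a 1-form. -/
def oneForm (θ : M → E →L[ℝ] F) (x : M) : E [⋀^Fin 1]→L[ℝ] F :=
  ContinuousAlternatingMap.ofSubsingleton ℝ E F (0 : Fin 1) (θ x)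

/-- The pull-back of a field of covectors. -/
def pullbackCovector (f : M → M') (θ : M' → E' →L[ℝ] F) (x : M) : E →L[ℝ] F :=
  (θ (f x)).comp (tangentMapAt f x)

/-- `W` is a smooth distribution of codimension one. -/
def IsHyperplaneDistribution (W : M → Submodule ℝ E) : Prop :=
  ∀ x₀ : M, ∃ U : Set M, IsOpen U ∧ x₀ ∈ U ∧ ∃ θ : M → E →L[ℝ] ℝ,
    SmoothFormOn (oneForm θ) U ∧ ∀ x ∈ U, θ x ≠ 0 ∧ W x = LinearMap.ker (θ x : E →ₗ[ℝ] ℝ)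

/-- A hyperplane distribution `W` on an even dimensional manifold is twisting if the kernel of
`dθ|_W` has dimension one (the least possible) for the local defining 1-forms `θ` of `W`. -/
def IsTwisting (W : M → Submodule ℝ E) : Prop :=
  ∀ x₀ : M, ∃ U : Set M, IsOpen U ∧ x₀ ∈ U ∧ ∃ θ : M → E →L[ℝ] ℝ,
    SmoothFormOn (oneForm θ) U ∧ (∀ x ∈ U, θ x ≠ 0 ∧ W x = LinearMap.ker (θ x : E →ₗ[ℝ] ℝ)) ∧
    ∀ x ∈ U, Module.finrank ℝ (formRadical (W x) (extDer (oneForm θ) x)) = 1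

/-- The velocity vector field at time `0` of a flow. -/
def fundamentalField (φ : Flow ℝ M) (x : M) : E :=
  mfderiv 𝓘(ℝ, ℝ) 𝓘(ℝ, E) (fun t : ℝ => φ t x) 0 (1 : ℝ)

/-- `π : M → M'` is a principal bundle with structure group `A = ℝ / Tℤ`, where `0 ≤ T`; so
`A = ℝ` for `T = 0` and `A` is a circle for `0 < T`. The action of `A` on `M` is given by the
flow `φ` of its fundamental vector field: it is smooth and free, its orbits are the fibres of `π`,
and `π` has smooth local sections. It is used for `dim M = dim M' + 1`, where these sections give
equivariant local trivialisations. -/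
structure IsPrincipalBundle (E E' : Type*) [NormedAddCommGroup E] [NormedSpace ℝ E]
    [NormedAddCommGroup E'] [NormedSpace ℝ E'] {M : Type*} [TopologicalSpace M] [ChartedSpace E M]
    {M' : Type*} [TopologicalSpace M'] [ChartedSpace E' M'] (T : ℝ) (φ : Flow ℝ M) (π : M → M') : Prop where
  period_nonneg : 0 ≤ T
  smooth_action : ContMDiff (𝓘(ℝ, ℝ).prod 𝓘(ℝ, E)) 𝓘(ℝ, E) ∞ fun q : ℝ × M => φ q.1 q.2
  smooth_proj : ContMDiff 𝓘(ℝ, E) 𝓘(ℝ, E') ∞ π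
  free : ∀ (t : ℝ) (x : M), φ t x = x ↔ ∃ n : ℤ, t = n * T
  fibres : ∀ x y : M, π x = π y ↔ ∃ t : ℝ, φ t x = y
  sections : ∀ b : M', ∃ U : Set M', IsOpen U ∧ b ∈ U ∧ ∃ σ : M' → M,
    ContMDiffOn 𝓘(ℝ, E') 𝓘(ℝ, E) ∞ σ U ∧ ∀ u ∈ U, π (σ u) = u

/-- `vol` is a smooth volume form on `U` for the metric `g`: it takes the values `±1` on
orthonormal frames, equivalently `vol(v₁, …, v_n)² = |det g(v_i, v_j)|`. -/
def IsVolumeForm {n : ℕ} (g : M → E →L[ℝ] E →L[ℝ] ℝ) (vol : M → E [⋀^Fin n]→L[ℝ] ℝ)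
    (U : Set M) : Prop :=
  SmoothFormOn vol U ∧ ∀ x ∈ U, ∀ v : Fin n → E,
    vol x v ^ 2 = |(Matrix.of fun i j => g x (v i) (v j)).det|

end Manifold

section SmoothManifold

variable {E : Type*} [NormedAddCommGroup E] [NormedSpace ℝ E]
  {M : Type*} [TopologicalSpace M] [ChartedSpace E M] [IsManifold 𝓘(ℝ, E) ∞ M]

/-- Smoothness of a vector field on `U`, as a section of the tangent bundle. -/
def SmoothVectorFieldOn (X : M → E) (U : Set M) : Prop :=
  ContMDiffOn 𝓘(ℝ, E) 𝓘(ℝ, E).tangent ∞ (fun x => (⟨x, X x⟩ : TangentBundle 𝓘(ℝ, E) M)) U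

/-- The Lie bracket of vector fields. -/
def bracket (X Y : M → E) (x : M) : E :=
  VectorField.mlieBracket 𝓘(ℝ, E) (M := M) X Y x

/-- Smoothness of a field of endomorphisms of the tangent spaces. -/
def SmoothEndomorphism (J : M → E →L[ℝ] E) : Prop :=
  ContMDiff 𝓘(ℝ, E) (𝓘(ℝ, E).prod 𝓘(ℝ, E →L[ℝ] E)) ∞ fun x =>
    Bundle.TotalSpace.mk' (E →L[ℝ] E)
      (E := fun x : M => TangentSpace 𝓘(ℝ, E) x →L[ℝ] TangentSpace 𝓘(ℝ, E) x) x (J x)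

/-- Smoothness of a field of bilinear forms on the tangent spaces. -/
def SmoothBilinear (h : M → E →L[ℝ] E →L[ℝ] ℝ) : Prop :=
  ContMDiff 𝓘(ℝ, E) (𝓘(ℝ, E).prod 𝓘(ℝ, E →L[ℝ] E →L[ℝ] ℝ)) ∞ fun x =>
    Bundle.TotalSpace.mk' (E →L[ℝ] E →L[ℝ] ℝ)
      (E := fun x : M => TangentSpace 𝓘(ℝ, E) x →L[ℝ] TangentSpace 𝓘(ℝ, E) x →L[ℝ] ℝ) x (h x)

/-- `g` is a Lorentzian metric of signature `(-, +, …, +)`. -/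
structure IsLorentzMetric (g : M → E →L[ℝ] E →L[ℝ] ℝ) : Prop where
  smooth : SmoothBilinear g
  symm : ∀ x v w, g x v w = g x w v
  signature : ∀ x, ∃ v, g x v v < 0 ∧ ∀ w, g x v w = 0 → w ≠ 0 → 0 < g x w w

/-- The Lie derivative `(𝓛_p h)(X, Y) = p(h(X, Y)) - h([p, X], Y) - h(X, [p, Y])`. -/
def lieDerivBilinear (p : M → E) (h : M → E →L[ℝ] E →L[ℝ] ℝ) (X Y : M → E) (x : M) : ℝ :=
  differential (fun y => h y (X y) (Y y)) x (p x)
    - h x (bracket p X x) (Y x) - h x (X x) (bracket p Y x)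

/-- `(W, [h])` is a shearfree structure: `W` is a hyperplane distribution, `[h]` is the conformal
class of the semipositive metric `h|_W`, the kernel of `h|_W` has dimension one, and locally a
nowhere zero vector field `p` in the kernel (hence each one) satisfies `𝓛_p W ⊆ W` and
`𝓛_p h = f h` on `W`. Only the restriction of `h` to `W` matters. -/
structure IsShearfreeStructure (W : M → Submodule ℝ E) (h : M → E →L[ℝ] E →L[ℝ] ℝ) : Prop where
  hyperplane : IsHyperplaneDistribution W
  smooth : SmoothBilinear h
  symm : ∀ x, ∀ v ∈ W x, ∀ w ∈ W x, h x v w = h x w v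
  nonneg : ∀ x, ∀ v ∈ W x, 0 ≤ h x v v
  finrank_kernel : ∀ x, Module.finrank ℝ (radical (W x) (h x)) = 1
  shearfree : ∀ x₀ : M, ∃ U : Set M, IsOpen U ∧ x₀ ∈ U ∧ ∃ (p : M → E) (f : M → ℝ),
    SmoothVectorFieldOn p U ∧ (∀ x ∈ U, p x ≠ 0 ∧ p x ∈ radical (W x) (h x)) ∧
    (∀ X : M → E, SmoothVectorFieldOn X U → (∀ x ∈ U, X x ∈ W x) →
      ∀ x ∈ U, bracket p X x ∈ W x) ∧
    (∀ X Y : M → E, SmoothVectorFieldOn X U → SmoothVectorFieldOn Y U →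
      (∀ x ∈ U, X x ∈ W x) → (∀ x ∈ U, Y x ∈ W x) →
      ∀ x ∈ U, lieDerivBilinear p h X Y x = f x * h x (X x) (Y x))

/-- A Robinson–Trautman bundle: a principal bundle with group `A = ℝ / Tℤ` and an `A`-invariant
shearfree structure `(W, [h])` on the total space, whose kernel is the vertical distribution. -/
structure IsRTBundle (E' : Type*) [NormedAddCommGroup E'] [NormedSpace ℝ E']
    {S : Type*} [TopologicalSpace S] [ChartedSpace E' S]
    (W : M → Submodule ℝ E) (h : M → E →L[ℝ] E →L[ℝ] ℝ)
    (T : ℝ) (φ : Flow ℝ M) (π : M → S) : Prop where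
  bundle : IsPrincipalBundle E E' T φ π
  shearfree : IsShearfreeStructure W h
  invariant : ∀ (t : ℝ) (x : M), ∀ v ∈ W x, tangentMapAt (φ t) x v ∈ W (φ t x)
  conformal : ∀ (t : ℝ) (x : M), ∃ c : ℝ, 0 < c ∧ ∀ v ∈ W x, ∀ w ∈ W x,
    h (φ t x) (tangentMapAt (φ t) x v) (tangentMapAt (φ t) x w) = c * h x v w
  vertical : ∀ x, radical (W x) (h x) = LinearMap.ker (tangentMapAt (E := E) (E' := E') π x : E →ₗ[ℝ] E')

/-- `(M, 𝒟 = ker θ, J)` is a Sasaki manifold with Reeb vector field `Z`: `θ` is a contact form,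
`J` is an integrable strongly pseudoconvex CR structure on `𝒟` with positive Levi form
`dθ(·, J·)`, and `Z` preserves `J`. The field `J` of endomorphisms of `𝒟` is extended to the whole
tangent space by `J Z = 0`. -/
structure IsSasaki (θ : M → E →L[ℝ] ℝ) (J : M → E →L[ℝ] E) (Z : M → E) : Prop where
  smooth_form : SmoothFormOn (oneForm θ) univ
  form_ne_zero : ∀ s, θ s ≠ 0
  contact : ∀ s v, θ s v = 0 → (∀ w, θ s w = 0 → extDer (oneForm θ) s ![v, w] = 0) → v = 0
  smooth_reeb : SmoothVectorFieldOn Z univ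
  reeb_form : ∀ s, θ s (Z s) = 1
  reeb_der : ∀ s v, extDer (oneForm θ) s ![Z s, v] = 0
  smooth_J : SmoothEndomorphism J
  J_reeb : ∀ s, J s (Z s) = 0
  J_mem : ∀ s v, θ s v = 0 → θ s (J s v) = 0
  J_sq : ∀ s v, θ s v = 0 → J s (J s v) = -v
  levi_symm : ∀ s v w, θ s v = 0 → θ s w = 0 →
    extDer (oneForm θ) s ![v, J s w] = extDer (oneForm θ) s ![w, J s v]
  levi_pos : ∀ s v, θ s v = 0 → v ≠ 0 → 0 < extDer (oneForm θ) s ![v, J s v]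
  nijenhuis : ∀ (U : Set M) (X Y : M → E), IsOpen U →
    SmoothVectorFieldOn X U → SmoothVectorFieldOn Y U →
    (∀ s ∈ U, θ s (X s) = 0) → (∀ s ∈ U, θ s (Y s) = 0) → ∀ s ∈ U,
      bracket X Y s - bracket (fun r => J r (X r)) (fun r => J r (Y r)) s
        + J s (bracket (fun r => J r (X r)) Y s + bracket X (fun r => J r (Y r)) s) = 0
  reeb_J : ∀ (U : Set M) (X : M → E), IsOpen U → SmoothVectorFieldOn X U →
    (∀ s ∈ U, θ s (X s) = 0) → ∀ s ∈ U,
      bracket Z (fun r => J r (X r)) s = J s (bracket Z X s)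

end SmoothManifold

/-! ### Kähler manifolds, regular Sasaki manifolds, and bundles of Kähler–Sasaki type -/

section KahlerSasakiType

variable {V : Type*} [NormedAddCommGroup V] [NormedSpace ℝ V] [NormedSpace ℂ V]
  {N : Type*} [TopologicalSpace N] [ChartedSpace V N]

/-- `κ` is the Kähler form of a Kähler metric on the complex manifold `N`, modelled on the complex
vector space `V`: a closed smooth real 2-form with `κ(iv, iw) = κ(v, w)` and `κ(v, iv) > 0` for
`v ≠ 0`. The Kähler metric is `g^N(v, w) = κ(v, iw)`. -/
structure IsKahlerForm (κ : N → V [⋀^Fin 2]→L[ℝ] ℝ) : Prop where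
  smooth : SmoothFormOn κ univ
  closed : ∀ y, extDer κ y = 0
  invariant : ∀ y v w, κ y ![Complex.I • v, Complex.I • w] = κ y ![v, w]
  pos : ∀ y v, v ≠ 0 → 0 < κ y ![v, Complex.I • v]

variable {E' : Type*} [NormedAddCommGroup E'] [NormedSpace ℝ E']
  {S : Type*} [TopologicalSpace S] [ChartedSpace E' S] [IsManifold 𝓘(ℝ, E') ∞ S]

/-- `(S, ker θ, J)` is a regular Sasaki manifold, with associated quantisable Kähler manifold
`(N, κ)`: the Reeb vector field of `θ` generates a flow `ψ` which makes `πS : S → N` a principal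
bundle with group `A' = ℝ / T'ℤ`, `J` projects to the complex structure of `N`, and `dθ = πS^* κ`,
i.e. the curvature of the connection form `θ` is the Kähler form. -/
structure IsRegularSasaki (θ : S → E' →L[ℝ] ℝ) (J : S → E' →L[ℝ] E')
    (T' : ℝ) (ψ : Flow ℝ S) (πS : S → N) (κ : N → V [⋀^Fin 2]→L[ℝ] ℝ) : Prop where
  sasaki : IsSasaki θ J (fundamentalField ψ)
  bundle : IsPrincipalBundle E' V T' ψ πS
  kahler : IsKahlerForm κ
  holomorphic : ∀ s v, θ s v = 0 →
    tangentMapAt (E' := V) πS s (J s v) = Complex.I • tangentMapAt (E' := V) πS s v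
  curvature : ∀ s v w,
    extDer (oneForm θ) s ![v, w] = κ (πS s) ![tangentMapAt πS s v, tangentMapAt πS s w]

variable {E : Type*} [NormedAddCommGroup E] [NormedSpace ℝ E]
  {M : Type*} [TopologicalSpace M] [ChartedSpace E M] [IsManifold 𝓘(ℝ, E) ∞ M]

/-- `(π : M → S, (W, [h]))` is a twisting Robinson–Trautman bundle of Kähler–Sasaki type:
`(S, ker θ, J)` is a regular Sasaki manifold over the Kähler manifold `(N, κ)`, the distribution
`W` projects onto `ker θ`, and `[h]` projects onto the conformal class of the positive Levi form
`dθ(·, J·)`. -/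
structure IsKahlerSasakiType (W : M → Submodule ℝ E) (h : M → E →L[ℝ] E →L[ℝ] ℝ)
    (T : ℝ) (φ : Flow ℝ M) (π : M → S)
    (θ : S → E' →L[ℝ] ℝ) (J : S → E' →L[ℝ] E')
    (T' : ℝ) (ψ : Flow ℝ S) (πS : S → N) (κ : N → V [⋀^Fin 2]→L[ℝ] ℝ) : Prop where
  rtBundle : IsRTBundle E' W h T φ π
  twisting : IsTwisting W
  projects : ∀ x, (W x).map (tangentMapAt (E := E) (E' := E') π x : E →ₗ[ℝ] E') =
    LinearMap.ker (θ (π x) : E' →ₗ[ℝ] ℝ)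
  levi : ∀ x, ∃ c : ℝ, 0 < c ∧ ∀ v ∈ W x, ∀ w ∈ W x,
    h x v w = c * extDer (oneForm θ) (π x) ![tangentMapAt π x v, J (π x) (tangentMapAt π x w)]
  sasaki : IsRegularSasaki θ J T' ψ πS κ

end KahlerSasakiType

/-! ### Generalised electromagnetic plane waves -/

section PlaneWaves

variable {E : Type*} [NormedAddCommGroup E] [NormedSpace ℝ E] [FiniteDimensional ℝ E]
  {M : Type*} [TopologicalSpace M] [ChartedSpace E M] {m : ℕ}

/-- The Hodge dual of an `(m+1)`-form in the middle degree of dimension `(m+1) + (m+1)`. -/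
def hodgeDual {F : Type*} [NormedAddCommGroup F] [NormedSpace ℝ F] (g : M → E →L[ℝ] E →L[ℝ] ℝ)
    (vol : M → E [⋀^Fin ((m + 1) + (m + 1))]→L[ℝ] ℝ) (Φ : M → E [⋀^Fin (m + 1)]→L[ℝ] F) (x : M) :
    E [⋀^Fin (m + 1)]→L[ℝ] F :=
  hodgeStar (g x) (vol x) (Φ x)

/-- On the open set `U` of a Lorentzian manifold of dimension `2(m+1)`, oriented by the volume form
`vol`, the form `Φ` of degree `m + 1` is a generalised electromagnetic plane wave `Φ = θ ∧ α`:
`Φ` is harmonic (`dΦ = 0 = d(∗Φ)`), the 1-form `θ` is null (the vector `p` with `g(p, ·) = θ` is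
null and not zero), and every null vector of `ker θ` lies in `ker α`. -/
structure IsPlaneWave (g : M → E →L[ℝ] E →L[ℝ] ℝ)
    (vol : M → E [⋀^Fin ((m + 1) + (m + 1))]→L[ℝ] ℝ) (U : Set M)
    (Φ : M → E [⋀^Fin (m + 1)]→L[ℝ] ℝ) (θ : M → E →L[ℝ] ℝ) (α : M → E [⋀^Fin m]→L[ℝ] ℝ) :
    Prop where
  smooth : SmoothFormOn Φ U
  smooth_one : SmoothFormOn (oneForm θ) U
  smooth_factor : SmoothFormOn α U
  closed : ∀ x ∈ U, extDer Φ x = 0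
  coclosed : ∀ x ∈ U, extDer (hodgeDual g vol Φ) x = 0
  decomposition : ∀ x ∈ U, Φ x = wedgeOne (θ x) (α x)
  null : ∀ x ∈ U, ∃ p : E, p ≠ 0 ∧ g x p = θ x ∧ g x p p = 0
  kernel : ∀ x ∈ U, ∀ v, θ x v = 0 → g x v v = 0 → v ∈ formKernel (α x)

/-- The pair `(K, W)` is the flag structure of the plane wave `Φ = θ ∧ α` on `U`:
`K = ker Φ ∩ ker ∗Φ` (which is also the kernel of `g|_W`) and `W = ker θ`. -/
def IsFlagStructure (g : M → E →L[ℝ] E →L[ℝ] ℝ)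
    (vol : M → E [⋀^Fin ((m + 1) + (m + 1))]→L[ℝ] ℝ) (U : Set M)
    (Φ : M → E [⋀^Fin (m + 1)]→L[ℝ] ℝ) (θ : M → E →L[ℝ] ℝ) (K W : M → Submodule ℝ E) : Prop :=
  ∀ x ∈ U, K x = formKernel (Φ x) ⊓ formKernel (hodgeDual g vol Φ x) ∧ K x = radical (W x) (g x) ∧
    W x = LinearMap.ker (θ x : E →ₗ[ℝ] ℝ)

/-- The complex form `dz¹ ∧ ⋯ ∧ dzᵐ` pulled back to `M`, where `zᵃ` are complex valued coordinate
functions `z` on `N` and `q : M → N` is the projection. -/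
def dzForm {N : Type*} (q : M → N) (z : N → EuclideanSpace ℂ (Fin m)) (x : M) :
    E [⋀^Fin m]→L[ℝ] ℂ :=
  wedgeProd m fun a => differential (fun y => z (q y) a) x

/-- The complex form `ϑ ∧ dz¹ ∧ ⋯ ∧ dzᵐ` on `M`. -/
def complexWave {N : Type*} (θ : M → E →L[ℝ] ℝ) (q : M → N)
    (z : N → EuclideanSpace ℂ (Fin m)) (x : M) : E [⋀^Fin (m + 1)]→L[ℝ] ℂ :=
  wedgeOne (Complex.ofRealCLM.comp (θ x)) (dzForm q z x)

end PlaneWaves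

end KahlerSasaki

end

open KahlerSasaki

/-!
# Plane waves on Lorentzian manifolds of Kähler–Sasaki type

All pointwise facts take place in a tangent space `E` of `M`. It carries the covector
`ϑ = π^* θ` and the differential `A` of the projection `M → N` onto the Kähler manifold, and on the
hyperplane `W = ker ϑ` the metric `g` is a positive multiple of the pull-back under `A` of the
Hermitian metric `κ(·, i·)` (`IsKahlerSasakiType.isHermitianQuotient`). Thus `ker ϑ ∩ ker A` is the
null line `ℝp` with `g(p, ·) = ϑ`, and `E` has a frame `p, q, e, f` in which `p, q` are null with
`g(p, q) = 1`, while `e` and `f = ie` lift a unitary basis of `ker ϑ / ℝp`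
(`IsHermitianQuotient.exists_nullFrame`).

*Eigenform of `∗`.* The complex form `Φ = ϑ ∧ dz¹ ∧ ⋯ ∧ dzᵐ` is annihilated by the wedge product
with each of its factors. If `λ ∧ Φ = 0`, then the vector `g`-dual to `λ` lies in the kernel of
`∗Φ` (`hodgeStar_cons_eq_zero`). Applied to `ϑ` and to the covectors `g(e_a, ·) + i g(f_a, ·)`,
which are combinations of the factors, this says that `∗Φ`, like `Φ`, is annihilated by `p` and is
complex linear on `ker ϑ / ℝp`. A form of degree `m + 1` with these properties is determined by its
value on `(q, e₁, …, e_m)` (`eq_zero_of_nullFrame`). Comparing the values there gives `∗Φ = ε iᵐ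
Φ`, where `ε = ±1` is the value of the volume form on `(p, f, q, e)` (`hodgeStar_waveAt`). In a
chart, `∗Φ` depends continuously on the point, so `ε` is constant on a connected chart domain
(`exists_constant_hodge_sign`).

*Closedness.* `dΦ = dϑ ∧ dz¹ ∧ ⋯ ∧ dzᵐ`, and `dϑ` is the pull-back of the Kähler form. The latter is
of type `(1,1)`, and its product with a form of type `(m,0)` vanishes in complex dimension `m`
(`alternatize_smul_eq_zero`, `extDer_complexWave`). Since `∗Φ` is a constant multiple of `Φ`, it is
closed as well.

*Flag structure.* The forms `Re Φ` and `Re ∗Φ` both vanish on vertical vectors. A vector in both of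
their kernels is vertical, because a horizontal argument of `Φ` may be multiplied by any complex
number (`mem_formKernel_reForm_iff`). For `m = 1` there is only one horizontal argument; there the
two forms are, up to sign, the real and imaginary parts of `Φ`.
-/

namespace KahlerSasaki

/-! ### Wedge products of 1-forms -/

section Wedge

variable {E : Type*} [NormedAddCommGroup E] [NormedSpace ℝ E]
  {E' : Type*} [NormedAddCommGroup E'] [NormedSpace ℝ E'] {k : ℕ}

theorem wedgeOne_apply {𝕜 : Type*} [RCLike 𝕜] (θ : E →L[ℝ] 𝕜) (α : E [⋀^Fin k]→L[ℝ] 𝕜)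
    (v : Fin (k + 1) → E) :
    wedgeOne θ α v = ∑ i : Fin (k + 1), (-1) ^ (i : ℕ) * (θ (v i) * α (i.removeNth v)) := by
  simp [wedgeOne, ContinuousAlternatingMap.alternatizeUncurryFin_apply, zsmul_eq_mul]

/-- A wedge product of 1-forms is the determinant of their values. -/
theorem wedgeProd_apply (k : ℕ) (lam : Fin k → (E →L[ℝ] ℂ)) (v : Fin k → E) :
    wedgeProd k lam v = (Matrix.of fun i j => lam i (v j)).det := by
  induction k with
  | zero => simp [wedgeProd]
  | succ k ih =>
    rw [wedgeProd, wedgeOne_apply, Matrix.det_succ_row_zero]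
    refine Finset.sum_congr rfl fun j _ => ?_
    rw [ih, ← mul_assoc]
    rfl

theorem wedgeProd_comp (lam : Fin k → (E' →L[ℝ] ℂ)) (A : E →L[ℝ] E') :
    (wedgeProd k lam).compContinuousLinearMap A = wedgeProd k fun i => (lam i).comp A := by
  ext v
  simp [wedgeProd_apply]

theorem wedgeOne_comp {𝕜 : Type*} [RCLike 𝕜] (θ : E' →L[ℝ] 𝕜) (α : E' [⋀^Fin k]→L[ℝ] 𝕜)
    (A : E →L[ℝ] E') :
    (wedgeOne θ α).compContinuousLinearMap A =
      wedgeOne (θ.comp A) (α.compContinuousLinearMap A) := by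
  ext v
  simp only [ContinuousAlternatingMap.compContinuousLinearMap_apply, wedgeOne_apply]
  rfl

theorem wedgeOne_add {𝕜 : Type*} [RCLike 𝕜] (θ θ' : E →L[ℝ] 𝕜) (α : E [⋀^Fin k]→L[ℝ] 𝕜) :
    wedgeOne (θ + θ') α = wedgeOne θ α + wedgeOne θ' α := by
  ext v
  simp [wedgeOne_apply, add_mul, mul_add, Finset.sum_add_distrib]

theorem wedgeOne_smul (c : ℂ) (θ : E →L[ℝ] ℂ) (α : E [⋀^Fin k]→L[ℝ] ℂ) :
    wedgeOne (c • θ) α = c • wedgeOne θ α := by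
  ext v
  simp only [wedgeOne_apply, _root_.smul_apply, ContinuousAlternatingMap.smul_apply,
    smul_eq_mul, Finset.mul_sum]
  exact Finset.sum_congr rfl fun j _ => by ring

theorem wedgeOne_wedgeProd (θ : E →L[ℝ] ℂ) (lam : Fin k → (E →L[ℝ] ℂ)) :
    wedgeOne θ (wedgeProd k lam) = wedgeProd (k + 1) (Fin.cons θ lam) := by
  simp [wedgeProd]

theorem wedgeProd_eq_zero_of_eq (lam : Fin k → (E →L[ℝ] ℂ)) {i j : Fin k} (hij : i ≠ j)
    (h : lam i = lam j) : wedgeProd k lam = 0 := by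
  ext v
  rw [wedgeProd_apply]
  exact Matrix.det_zero_of_row_eq hij (by ext a; simp [h])

/-- A factor of a wedge product annihilates it. -/
theorem wedgeOne_wedgeProd_self (lam : Fin k → (E →L[ℝ] ℂ)) (i : Fin k) :
    wedgeOne (lam i) (wedgeProd k lam) = 0 := by
  rw [wedgeOne_wedgeProd]
  exact wedgeProd_eq_zero_of_eq _ (i := 0) (j := i.succ) (Fin.succ_ne_zero i).symm (by simp)

/-- Multiplying the values of all factors on one argument by the same complex number. -/
theorem wedgeProd_update_of_eq_mul (lam : Fin k → (E →L[ℝ] ℂ)) (v : Fin k → E) (a : Fin k)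
    (x y : E) (c : ℂ) (h : ∀ i, lam i y = c * lam i x) :
    wedgeProd k lam (Function.update v a y) = c * wedgeProd k lam (Function.update v a x) := by
  have e : ∀ z : E, (Matrix.of fun i j => lam i (Function.update v a z j)) =
      (Matrix.of fun i j => lam i (v j)).updateCol a fun i => lam i z := by
    intro z
    ext i j
    by_cases hj : j = a
    · subst hj; simp
    · simp [hj]
  rw [wedgeProd_apply, wedgeProd_apply, e, e, ← Matrix.det_updateCol_smul]
  congr 2
  ext i
  simp [h]

theorem wedgeProd_update_of_eq_zero (lam : Fin k → (E →L[ℝ] ℂ)) (v : Fin k → E) (a : Fin k)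
    (x : E) (h : ∀ i, lam i x = 0) : wedgeProd k lam (Function.update v a x) = 0 := by
  simpa using wedgeProd_update_of_eq_mul lam v a x x 0 (by simpa using h)

theorem reForm_wedgeOne (θ : E →L[ℝ] ℝ) (α : E [⋀^Fin k]→L[ℝ] ℂ) :
    reForm (wedgeOne (Complex.ofRealCLM.comp θ) α) = wedgeOne θ (reForm α) := by
  ext v
  simp only [reForm, ContinuousLinearMap.compContinuousAlternatingMap_coe, Function.comp_apply,
    wedgeOne_apply, map_sum]
  refine Finset.sum_congr rfl fun j _ => ?_
  have : ((-1 : ℂ) ^ (j : ℕ)) = (((-1 : ℝ) ^ (j : ℕ) : ℝ) : ℂ) := by push_cast; rfl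
  rw [this]
  rw [Complex.reCLM_apply, Complex.re_ofReal_mul]
  simp

theorem reForm_apply (α : E [⋀^Fin k]→L[ℝ] ℂ) (v : Fin k → E) : reForm α v = (α v).re := rfl

end Wedge

/-! ### The Hodge star operator in an arbitrary frame -/

section Hodge

variable {E : Type*} [NormedAddCommGroup E] [NormedSpace ℝ E]
  {F : Type*} [NormedAddCommGroup F] [NormedSpace ℝ F] {k l : ℕ}
  {ι ι' : Type*} [Fintype ι] [Fintype ι']

theorem append_update_left {X : Type*} (u : Fin k → X) (w : Fin l → X) (i : Fin k) (a : X) :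
    Fin.append (Function.update u i a) w =
      Function.update (Fin.append u w) (Fin.castAdd l i) a := by
  ext1 j
  refine Fin.addCases (fun j => ?_) (fun j => ?_) j
  · by_cases h : j = i
    · subst h; simp
    · rw [Fin.append_left, Function.update_of_ne h, Function.update_of_ne, Fin.append_left]
      intro h'
      exact h (by simpa using h')
  · rw [Fin.append_right, Function.update_of_ne, Fin.append_right]
    intro h
    have := congrArg Fin.val h
    simp at this
    omega

/-- If the frame `c` is dual to `b` with respect to `g`, then `b` is dual to `c`. -/
theorem dual_expansion_symm {g : E →L[ℝ] E →L[ℝ] ℝ} (hs : ∀ v w, g v w = g w v)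
    (hn : ∀ v, (∀ w, g v w = 0) → v = 0) {b c : ι → E} (hbc : ∀ v, ∑ i, g (c i) v • b i = v)
    (v : E) : ∑ i, g (b i) v • c i = v := by
  rw [← sub_eq_zero]
  refine hn _ fun w => ?_
  rw [map_sub, _root_.sub_apply, sub_eq_zero]
  conv_rhs => rw [hs, ← hbc w]
  simp only [map_sum, map_smul, _root_.sum_apply, _root_.smul_apply, smul_eq_mul]
  refine Finset.sum_congr rfl fun i _ => ?_
  rw [mul_comm]

/-- The contraction of two multilinear maps over a frame and its dual does not depend on the
frame. -/
theorem sum_contract_eq {g : E →L[ℝ] E →L[ℝ] ℝ} (hs : ∀ v w, g v w = g w v)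
    (hn : ∀ v, (∀ w, g v w = 0) → v = 0) {b c : ι → E} (hbc : ∀ v, ∑ i, g (c i) v • b i = v)
    {b' c' : ι' → E} (hbc' : ∀ v, ∑ i, g (c' i) v • b' i = v)
    (T : MultilinearMap ℝ (fun _ : Fin k => E) ℝ) (β : MultilinearMap ℝ (fun _ : Fin k => E) F) :
    ∑ i : Fin k → ι, T (fun a => b (i a)) • β (fun a => c (i a)) =
      ∑ j : Fin k → ι', T (fun a => b' (j a)) • β (fun a => c' (j a)) := by
  classical
  have h1 : ∀ i : Fin k → ι, T (fun a => b (i a)) =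
      ∑ j : Fin k → ι', (∏ a, g (c' (j a)) (b (i a))) • T (fun a => b' (j a)) := by
    intro i
    conv_lhs => rw [show (fun a => b (i a)) = fun a => ∑ j, g (c' j) (b (i a)) • b' j from
      funext fun a => (hbc' _).symm]
    rw [T.map_sum]
    exact Finset.sum_congr rfl fun j _ => T.map_smul_univ _ _
  have h2 : ∀ j : Fin k → ι', β (fun a => c' (j a)) =
      ∑ i : Fin k → ι, (∏ a, g (c' (j a)) (b (i a))) • β (fun a => c (i a)) := by
    intro j
    conv_lhs => rw [show (fun a => c' (j a)) = fun a => ∑ i, g (c' (j a)) (b i) • c i from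
      funext fun a => by
        conv_lhs => rw [← dual_expansion_symm hs hn hbc (c' (j a))]
        exact Finset.sum_congr rfl fun i _ => by rw [hs]]
    rw [β.map_sum]
    exact Finset.sum_congr rfl fun j _ => β.map_smul_univ _ _
  simp only [h1, h2, Finset.sum_smul, Finset.smul_sum]
  rw [Finset.sum_comm]
  refine Finset.sum_congr rfl fun j _ => Finset.sum_congr rfl fun i _ => ?_
  rw [smul_smul, smul_eq_mul, mul_comm]

/-- Insertion of `w` into the last slots of a form, as a multilinear map of the first slots. -/
def insertLast (vol : E [⋀^Fin (k + l)]→L[ℝ] ℝ) (w : Fin l → E) :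
    MultilinearMap ℝ (fun _ : Fin k => E) ℝ where
  toFun u := vol (Fin.append u w)
  map_update_add' := by
    intro d u i a b
    rw [Subsingleton.elim d (instDecidableEqFin k)]
    simp only [append_update_left, vol.map_update_add]
  map_update_smul' := by
    intro d u i a b
    rw [Subsingleton.elim d (instDecidableEqFin k)]
    simp only [append_update_left, vol.map_update_smul]

theorem det_gram_ne_zero {ι : Type*} [Fintype ι] [DecidableEq ι] {g : E →L[ℝ] E →L[ℝ] ℝ}
    (hs : ∀ v w, g v w = g w v) (hn : ∀ v, (∀ w, g v w = 0) → v = 0) (B : Module.Basis ι ℝ E) :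
    (Matrix.of fun a b => g (B a) (B b)).det ≠ 0 := by
  intro h0
  obtain ⟨w, hw, hGw⟩ := Matrix.exists_mulVec_eq_zero_iff.2 h0
  have h1 : ∑ j, w j • B j = 0 := by
    have h2 : ∀ i, g (B i) (∑ j, w j • B j) = 0 := by
      intro i
      rw [← Pi.zero_apply (M := fun _ => ℝ) i, ← hGw, map_sum]
      exact Finset.sum_congr rfl fun j _ => by simp [mul_comm]
    refine hn _ fun x => ?_
    rw [hs, ← B.sum_repr x, map_sum g, _root_.sum_apply]
    exact Finset.sum_eq_zero fun i _ => by rw [map_smul, _root_.smul_apply, h2, smul_zero]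
  exact hw (funext fun j => Fintype.linearIndependent_iff.1 B.linearIndependent w h1 j)

variable [FiniteDimensional ℝ E]

/-- The frame `dualFrame g`, built from the inverse Gram matrix, is dual to the basis
`Module.finBasis`. -/
theorem dualFrame_expansion {g : E →L[ℝ] E →L[ℝ] ℝ} (hs : ∀ v w, g v w = g w v)
    (hn : ∀ v, (∀ w, g v w = 0) → v = 0) (v : E) :
    ∑ i, g (dualFrame g i) v • Module.finBasis ℝ E i = v := by
  set B := Module.finBasis ℝ E with hB
  set G : Matrix (Fin (Module.finrank ℝ E)) (Fin (Module.finrank ℝ E)) ℝ :=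
    Matrix.of fun a b => g (B a) (B b) with hG
  have hdet : G.det ≠ 0 := det_gram_ne_zero hs hn B
  have key : ∀ i j, g (dualFrame g i) (B j) = if i = j then 1 else 0 := by
    intro i j
    have h3 : (G⁻¹ * G) i j = (1 : Matrix _ _ ℝ) i j := by
      rw [Matrix.nonsing_inv_mul _ (isUnit_iff_ne_zero.2 hdet)]
    rw [Matrix.mul_apply, Matrix.one_apply] at h3
    rw [← h3]
    simp only [dualFrame, map_sum, map_smul, _root_.sum_apply, _root_.smul_apply, smul_eq_mul]
    rfl
  have : (∑ i, (g (dualFrame g i)).smulRight (B i) : E →L[ℝ] E).toLinearMap = LinearMap.id := by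
    refine B.ext fun j => ?_
    simp [key]
  simpa using congrArg (fun f : E →ₗ[ℝ] E => f v) this

theorem hodgeStar_apply (g : E →L[ℝ] E →L[ℝ] ℝ) (vol : E [⋀^Fin (k + l)]→L[ℝ] ℝ)
    (β : E [⋀^Fin k]→L[ℝ] F) (w : Fin l → E) :
    hodgeStar g vol β w = ((k.factorial : ℝ)⁻¹) • ∑ i : Fin k → Fin (Module.finrank ℝ E),
      vol (Fin.append (fun a => Module.finBasis ℝ E (i a)) w) • β fun a => dualFrame g (i a) := by
  simp only [hodgeStar, ContinuousAlternatingMap.smul_apply, ContinuousAlternatingMap.sum_apply]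
  rfl

/-- The Hodge star operator may be computed in any frame `b` with dual frame `c`. -/
theorem hodgeStar_eq_of_frame {g : E →L[ℝ] E →L[ℝ] ℝ} (hs : ∀ v w, g v w = g w v)
    (hn : ∀ v, (∀ w, g v w = 0) → v = 0) {b c : ι → E} (hbc : ∀ v, ∑ i, g (c i) v • b i = v)
    (vol : E [⋀^Fin (k + l)]→L[ℝ] ℝ) (β : E [⋀^Fin k]→L[ℝ] F) (w : Fin l → E) :
    hodgeStar g vol β w = ((k.factorial : ℝ)⁻¹) • ∑ i : Fin k → ι,
      vol (Fin.append (fun a => b (i a)) w) • β fun a => c (i a) := by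
  rw [hodgeStar_apply]
  congr 1
  exact sum_contract_eq hs hn (dualFrame_expansion hs hn) hbc (insertLast vol w)
    β.toMultilinearMap

/-- The Hodge star operator is natural under linear isomorphisms. -/
theorem hodgeStar_comp {E' : Type*} [NormedAddCommGroup E'] [NormedSpace ℝ E']
    [FiniteDimensional ℝ E'] {g : E →L[ℝ] E →L[ℝ] ℝ} (hs : ∀ v w, g v w = g w v)
    (hn : ∀ v, (∀ w, g v w = 0) → v = 0) (A : E' ≃L[ℝ] E) (g' : E' →L[ℝ] E' →L[ℝ] ℝ)
    (hg' : ∀ v w, g' v w = g (A v) (A w))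
    (vol : E [⋀^Fin (k + l)]→L[ℝ] ℝ) (β : E [⋀^Fin k]→L[ℝ] F) :
    hodgeStar g' (vol.compContinuousLinearMap (A : E' →L[ℝ] E))
        (β.compContinuousLinearMap (A : E' →L[ℝ] E)) =
      (hodgeStar g vol β).compContinuousLinearMap (A : E' →L[ℝ] E) := by
  have hs' : ∀ v w, g' v w = g' w v := fun v w => by rw [hg', hg', hs]
  have hn' : ∀ v, (∀ w, g' v w = 0) → v = 0 := by
    intro v hv
    refine A.injective (by
      rw [map_zero]
      refine hn _ fun w => ?_
      rw [← hv (A.symm w), hg', A.apply_symm_apply])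
  have hbc : ∀ v, ∑ i, g (A (dualFrame g' i)) v • A (Module.finBasis ℝ E' i) = v := by
    intro v
    conv_rhs => rw [← A.apply_symm_apply v, ← dualFrame_expansion hs' hn' (A.symm v)]
    simp only [map_sum, map_smul, hg', A.apply_symm_apply]
  ext w
  rw [hodgeStar_apply, ContinuousAlternatingMap.compContinuousLinearMap_apply,
    hodgeStar_eq_of_frame hs hn hbc]
  congr 1
  refine Finset.sum_congr rfl fun i _ => ?_
  simp only [ContinuousAlternatingMap.compContinuousLinearMap_apply]
  congr 2
  ext1 j
  refine Fin.addCases (fun j => ?_) (fun j => ?_) j <;> simp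

/-- Let `λ = g(v₁, ·) + i g(v₂, ·)` be a complex covector. If `λ ∧ β = 0`, then the complex vector
`v₁ + i v₂` lies in the kernel of `∗β`. -/
theorem hodgeStar_cons_eq_zero {g : E →L[ℝ] E →L[ℝ] ℝ} (hs : ∀ v w, g v w = g w v)
    (hn : ∀ v, (∀ w, g v w = 0) → v = 0)
    (vol : E [⋀^Fin ((k + 1) + (l + 1))]→L[ℝ] ℝ) (β : E [⋀^Fin (k + 1)]→L[ℝ] ℂ)
    (lam : E →L[ℝ] ℂ) (v₁ v₂ : E)
    (hlam : ∀ w, lam w = g v₁ w + Complex.I * g v₂ w) (h0 : wedgeOne lam β = 0) (w : Fin l → E) :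
    hodgeStar g vol β (Fin.cons v₁ w) + Complex.I * hodgeStar g vol β (Fin.cons v₂ w) = 0 := by
  -- if `λ = 0` then `v₁ = v₂ = 0` by nondegeneracy
  by_cases hl : ∃ v', lam v' ≠ 0
  swap
  · push Not at hl
    have hre : ∀ x, g v₁ x = 0 ∧ g v₂ x = 0 := by
      intro x
      have := hl x
      rw [hlam] at this
      exact ⟨by simpa using congrArg Complex.re this, by simpa using congrArg Complex.im this⟩
    have e1 : v₁ = 0 := hn _ fun x => (hre x).1
    have e2 : v₂ = 0 := hn _ fun x => (hre x).2
    subst e1; subst e2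
    rw [(hodgeStar g vol β).map_coord_zero 0 (by simp)]
    simp
  obtain ⟨v', hv'⟩ := hl
  set B := Module.finBasis ℝ E
  set c := dualFrame g
  have hbc : ∀ v, ∑ i, g (c i) v • B i = v := dualFrame_expansion hs hn
  -- `β` is recovered from its contraction with `v'`, because `λ ∧ β = 0`
  have hβ : ∀ x : Fin (k + 1) → E, lam v' * β x = ∑ j : Fin (k + 1),
      (-1) ^ (j : ℕ) * (lam (x j) * β (Fin.cons v' (j.removeNth x))) := by
    intro x
    have h1 : wedgeOne lam β (Fin.cons v' x) = 0 := by rw [h0]; rfl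
    rw [wedgeOne_apply, Fin.sum_univ_succ] at h1
    have h2 : ∀ j : Fin (k + 1), (j.succ.removeNth (Fin.cons v' x : Fin (k + 2) → E)) =
        (Fin.cons v' (j.removeNth x) : Fin (k + 1) → E) := by
      intro j
      ext1 i
      refine Fin.cases ?_ (fun i => ?_) i <;> simp [Fin.removeNth]
    simp only [Fin.val_zero, pow_zero, one_mul, Fin.cons_zero, Fin.cons_succ, h2, Fin.val_succ,
      pow_succ, mul_neg, mul_one, neg_mul, Finset.sum_neg_distrib] at h1
    have h3 : (Fin.removeNth 0 (Fin.cons v' x : Fin (k + 2) → E)) = x := by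
      ext1 i; simp [Fin.removeNth]
    rw [h3] at h1
    exact eq_of_sub_eq_zero (by rw [sub_eq_add_neg]; exact h1)
  -- the two slots in which `λ` is contracted are antisymmetric in `vol`
  have hj : ∀ j : Fin (k + 1), ∑ i : Fin (k + 1) → Fin (Module.finrank ℝ E),
      (vol (Fin.append (fun a => B (i a)) (Fin.cons v₁ w)) +
        Complex.I * vol (Fin.append (fun a => B (i a)) (Fin.cons v₂ w))) *
        (lam (c (i j)) * β (Fin.cons v' (j.removeNth fun a => c (i a)))) = 0 := by
    intro j
    rw [← (Fin.insertNthEquiv (fun _ => Fin (Module.finrank ℝ E)) j).sum_comp,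
      Fintype.sum_prod_type_right]
    refine Finset.sum_eq_zero fun i _ => ?_
    -- `Q` is skew, and the sum below is `Q(v, v)`, up to a factor, for `v = v₁ + i v₂`
    set Q : E → E → ℝ := fun y z =>
      vol (Fin.append (j.insertNth y fun a => B (i a) : Fin (k + 1) → E) (Fin.cons z w)) with hQ
    have hQ' : ∀ y z, Q y z = vol (Function.update (Function.update (Fin.append
        (j.insertNth 0 fun a => B (i a) : Fin (k + 1) → E) (Fin.cons 0 w)) (Fin.castAdd _ j) y)
        (Fin.natAdd _ 0) z) := by
      intro y z
      rw [← append_update_left, ← append_update, Fin.update_insertNth, Fin.update_cons_zero]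
    have hne : (Fin.castAdd (l + 1) j) ≠ Fin.natAdd (k + 1) 0 := by
      intro h
      have := congrArg Fin.val h
      simp at this
      omega
    have hz : ∀ y, Q y y = 0 := by
      intro y
      rw [hQ']
      exact vol.map_eq_zero_of_eq _ (by rw [Function.update_of_ne hne]; simp) hne
    have hsum : ∀ y z, ∑ t, g (c t) y * Q (B t) z = Q y z := by
      intro y z
      conv_rhs => rw [← hbc y]
      simp only [hQ', Function.update_comm hne]
      refine Eq.trans ?_ (map_sum (vol.toAlternatingMap.toMultilinearMap.toLinearMap _ _) _ _).symm
      exact Finset.sum_congr rfl fun t _ => (vol.map_update_smul _ _ _ _).symm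
    have hadd : ∀ y y' z, Q (y + y') z = Q y z + Q y' z := by
      intro y y' z
      simp only [hQ', Function.update_comm hne, vol.map_update_add]
    have hadd' : ∀ y z z', Q y (z + z') = Q y z + Q y z' := by
      intro y y' z
      simp only [hQ', vol.map_update_add]
    have hanti : Q v₁ v₂ + Q v₂ v₁ = 0 := by
      have := hz (v₁ + v₂)
      rw [hadd, hadd', hadd', hz, hz] at this
      linarith
    have hterm : ∀ t, (j.insertNth t i : Fin (k + 1) → _) j = t := fun t => by simp
    have e1 : ∀ t, (fun a => B ((j.insertNth t i : Fin (k + 1) → Fin (Module.finrank ℝ E)) a)) =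
        (j.insertNth (B t) fun a => B (i a) : Fin (k + 1) → E) := by
      intro t
      ext1 a
      refine Fin.succAboveCases j ?_ (fun a => ?_) a <;> simp
    have e2 : ∀ t, (j.removeNth fun a => c ((j.insertNth t i : Fin (k + 1) → _) a)) =
        fun a => c (i a) := by
      intro t
      ext1 a
      simp [Fin.removeNth]
    have e3 : ∀ t, ((Fin.insertNthEquiv (fun _ => Fin (Module.finrank ℝ E)) j) (t, i)) =
      (j.insertNth t i : Fin (k + 1) → _) := fun t => rfl
    simp only [e3, hterm, e1, e2]
    change ∑ t, ((Q (B t) v₁ : ℂ) + Complex.I * (Q (B t) v₂ : ℝ)) *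
      (lam (c t) * β (Fin.cons v' fun a => c (i a))) = 0
    simp only [← mul_assoc, ← Finset.sum_mul]
    rw [mul_eq_zero]
    left
    calc _ = ((∑ t, g (c t) v₁ * Q (B t) v₁ : ℝ) : ℂ)
            + Complex.I * ((∑ t, g (c t) v₁ * Q (B t) v₂ : ℝ) : ℂ)
            + Complex.I * ((∑ t, g (c t) v₂ * Q (B t) v₁ : ℝ) : ℂ)
            + Complex.I * Complex.I * ((∑ t, g (c t) v₂ * Q (B t) v₂ : ℝ) : ℂ) := by
          push_cast
          simp only [Finset.mul_sum, ← Finset.sum_add_distrib]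
          refine Finset.sum_congr rfl fun t _ => ?_
          rw [hlam, hs v₁, hs v₂]
          ring
      _ = 0 := by
          simp only [hsum, hz]
          have : ((Q v₁ v₂ : ℝ) : ℂ) = -(Q v₂ v₁ : ℝ) := by
            rw [← Complex.ofReal_neg]; congr 1; linarith
          rw [this]; simp
  have hmul : lam v' * (hodgeStar g vol β (Fin.cons v₁ w) +
      Complex.I * hodgeStar g vol β (Fin.cons v₂ w)) = 0 := by
    rw [hodgeStar_apply, hodgeStar_apply]
    simp only [Complex.real_smul]
    calc _ = (((k + 1).factorial : ℝ)⁻¹ : ℝ) * ∑ i : Fin (k + 1) → Fin (Module.finrank ℝ E),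
        (vol (Fin.append (fun a => B (i a)) (Fin.cons v₁ w)) +
        Complex.I * vol (Fin.append (fun a => B (i a)) (Fin.cons v₂ w))) *
          (lam v' * β fun a => c (i a)) := by
            simp only [Finset.mul_sum, ← Finset.sum_add_distrib]
            refine Finset.sum_congr rfl fun i _ => by ring
      _ = 0 := by
        rw [mul_eq_zero]
        right
        simp only [hβ, Finset.mul_sum]
        rw [Finset.sum_comm]
        refine Finset.sum_eq_zero fun j _ => ?_
        rw [← mul_zero ((-1 : ℂ) ^ (j : ℕ)), ← hj j, Finset.mul_sum]
        refine Finset.sum_congr rfl fun i _ => by ring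
  exact (mul_eq_zero.1 hmul).resolve_left hv'

/-- If a frame is split into two halves `u, u'` with dual vectors `c, c'`, then only the
permutations of the first half contribute to `(∗β)(u')`: an argument repeated from the second half
makes the volume form vanish. Their `k!` equal contributions cancel the factor `1/k!`. -/
theorem hodgeStar_apply_half {g : E →L[ℝ] E →L[ℝ] ℝ} (hs : ∀ v w, g v w = g w v)
    (hn : ∀ v, (∀ w, g v w = 0) → v = 0) {u c : Fin k → E} {u' c' : Fin l → E}
    (hbc : ∀ v, ∑ i, g (c i) v • u i + ∑ i, g (c' i) v • u' i = v)
    (vol : E [⋀^Fin (k + l)]→L[ℝ] ℝ) (β : E [⋀^Fin k]→L[ℝ] F) :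
    hodgeStar g vol β u' = vol (Fin.append u u') • β c := by
  have hbc' : ∀ v, ∑ i, g (Sum.elim c c' i) v • Sum.elim u u' i = v := by
    intro v
    rw [Fintype.sum_sum_type]
    exact hbc v
  rw [hodgeStar_eq_of_frame hs hn hbc']
  have hsum : ∑ σ : Equiv.Perm (Fin k), vol (Fin.append u u') • β c =
      ∑ i : Fin k → Fin k ⊕ Fin l, vol (Fin.append (fun a => Sum.elim u u' (i a)) u') •
        β fun a => Sum.elim c c' (i a) := by
    refine Fintype.sum_of_injective (fun (σ : Equiv.Perm (Fin k)) a => Sum.inl (σ a)) ?_ _ _ ?_ ?_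
    · intro σ τ h
      ext1 a
      simpa using congrFun h a
    · intro i hi
      have : vol (Fin.append (fun a => Sum.elim u u' (i a)) u') = 0 := by
        by_cases h : ∃ a b, i a = Sum.inr b
        · obtain ⟨a, b, hab⟩ := h
          refine vol.map_eq_zero_of_eq (i := Fin.castAdd l a) (j := Fin.natAdd k b) _
            (by simp [hab]) ?_
          intro h
          have := congrArg Fin.val h
          simp at this
          omega
        · push Not at h
          have h' : ∀ a, ∃ b, i a = Sum.inl b := by
            intro a
            rcases hia : i a with b | b
            · exact ⟨b, rfl⟩
            · exact absurd hia (h a b)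
          choose s hs using h'
          have hns : ¬ Function.Injective s := by
            intro hinj
            refine hi ⟨Equiv.ofBijective s (Finite.injective_iff_bijective.1 hinj), ?_⟩
            ext1 a
            simp [hs]
          simp only [Function.Injective, not_forall] at hns
          obtain ⟨a, b, hab, hne⟩ := hns
          exact vol.map_eq_zero_of_eq (i := Fin.castAdd l a) (j := Fin.castAdd l b) _
            (by simp [hs, hab]) (by simpa using hne)
      rw [this, zero_smul]
    · intro σ
      have h1 : Fin.append (fun a => u (σ a)) u' = Fin.append u u' ∘
          (finSumFinEquiv.permCongr (Equiv.sumCongr σ (Equiv.refl (Fin l)))) := by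
        ext1 j
        refine Fin.addCases (fun j => ?_) (fun j => ?_) j
        · simp [Equiv.permCongr_apply]
        · simp [Equiv.permCongr_apply]
      have h2 : β (fun a => c (σ a)) = Equiv.Perm.sign σ • β c :=
        β.toAlternatingMap.map_perm c σ
      have h3 : vol (Fin.append (fun a => u (σ a)) u') =
          Equiv.Perm.sign σ • vol (Fin.append u u') := by
        rw [h1]
        refine (vol.toAlternatingMap.map_perm _ _).trans ?_
        rw [Equiv.Perm.sign_permCongr]
        have := Equiv.Perm.sign_sumCongr σ (Equiv.refl (Fin l))
        rw [Equiv.Perm.sumCongr] at this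
        rw [this]
        simp
      simp only [Sum.elim_inl]
      rw [h2, h3]
      rcases Int.units_eq_one_or (Equiv.Perm.sign σ) with h | h <;> simp [h]
  rw [← hsum, Finset.sum_const, Finset.card_univ, Fintype.card_perm, Fintype.card_fin,
    ← Nat.cast_smul_eq_nsmul ℝ, smul_smul, inv_mul_cancel₀, one_smul]
  exact_mod_cast k.factorial_ne_zero

end Hodge

/-! ### Unitary bases for a positive form of type (1,1) -/

section Unitary

variable {V : Type*} [AddCommGroup V] [Module ℝ V] [Module ℂ V] [IsScalarTower ℝ ℂ V]

theorem complex_smul_eq (r : ℂ) (v : V) : r • v = r.re • v + r.im • (Complex.I • v) := by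
  have h : r = r.re • (1 : ℂ) + r.im • Complex.I := by
    rw [Complex.real_smul, Complex.real_smul, mul_one, Complex.re_add_im]
  conv_lhs => rw [h]
  rw [add_smul, smul_assoc, smul_assoc, one_smul]

/-- A positive real `(1,1)`-form `K` admits a unitary basis for the Hermitian scalar product
`K(v, iw) + i K(v, w)`. -/
theorem exists_unitary_basis [FiniteDimensional ℂ V] {m : ℕ} (hm : Module.finrank ℂ V = m)
    (K : V →ₗ[ℝ] V →ₗ[ℝ] ℝ) (halt : ∀ v w, K v w = -K w v)
    (hinv : ∀ v w, K (Complex.I • v) (Complex.I • w) = K v w)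
    (hpos : ∀ v, v ≠ 0 → 0 < K v (Complex.I • v)) :
    ∃ e : Module.Basis (Fin m) ℂ V, ∀ a b,
      K (e a) (Complex.I • e b) = (if a = b then 1 else 0) ∧ K (e a) (e b) = 0 := by
  have hI : ∀ v w, K (Complex.I • v) w = -K v (Complex.I • w) := by
    intro v w
    rw [← hinv (Complex.I • v) w, smul_smul, Complex.I_mul_I, neg_one_smul, map_neg,
      LinearMap.neg_apply]
  let core : InnerProductSpace.Core ℂ V :=
    { inner := fun v w => (K v (Complex.I • w) : ℂ) + Complex.I * (K v w : ℂ)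
      conj_inner_symm := by
        intro v w
        simp only [map_add, map_mul, Complex.conj_ofReal, Complex.conj_I]
        rw [halt w v, halt w (Complex.I • v), hI]
        push_cast
        ring
      re_inner_nonneg := by
        intro v
        by_cases h : v = 0
        · simp [h]
        · simpa using (hpos v h).le
      add_left := by
        intro u v w
        simp only [map_add, LinearMap.add_apply]
        push_cast
        ring
      smul_left := by
        intro v w r
        rw [complex_smul_eq r v]
        simp only [map_add, LinearMap.add_apply, map_smul, LinearMap.smul_apply, smul_eq_mul, hI,
          smul_smul, Complex.I_mul_I, neg_one_smul, map_neg]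
        rw [show (starRingEnd ℂ) r = (r.re : ℂ) - r.im * Complex.I from
          Complex.ext (by simp) (by simp)]
        push_cast
        linear_combination (r.im : ℂ) * (K v w : ℂ) * Complex.I_mul_I
      definite := by
        intro v hv
        by_contra h
        have := congrArg Complex.re hv
        simp at this
        exact (hpos v h).ne' this }
  let _ : NormedAddCommGroup V := core.toNormedAddCommGroup
  let _ : InnerProductSpace ℂ V := InnerProductSpace.ofCore core.toCore
  let b := (stdOrthonormalBasis ℂ V).reindex (finCongr hm)
  refine ⟨b.toBasis, fun a c => ?_⟩
  have h : inner ℂ (b a) (b c) = if a = c then (1 : ℂ) else 0 :=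
    orthonormal_iff_ite.1 b.orthonormal a c
  have h' : (K (b a) (Complex.I • b c) : ℂ) + Complex.I * (K (b a) (b c) : ℂ) =
    if a = c then (1 : ℂ) else 0 := h
  rw [OrthonormalBasis.coe_toBasis]
  constructor
  · have := congrArg Complex.re h'
    by_cases hac : a = c <;> simpa [hac] using this
  · have := congrArg Complex.im h'
    by_cases hac : a = c <;> simpa [hac] using this

end Unitary

/-! ### 2-forms as bilinear maps -/

section TwoForm

variable {V : Type*} [NormedAddCommGroup V] [NormedSpace ℝ V]

theorem twoForm_antisymm (κ : V [⋀^Fin 2]→L[ℝ] ℝ) (v w : V) : κ ![v, w] = -κ ![w, v] := by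
  have := κ.toAlternatingMap.map_swap ![w, v] (i := 0) (j := 1) (by decide)
  rw [show ![w, v] ∘ Equiv.swap (0 : Fin 2) 1 = ![v, w] by
    ext1 i; fin_cases i <;> simp] at this
  exact this

theorem twoForm_zero_left (κ : V [⋀^Fin 2]→L[ℝ] ℝ) (w : V) : κ ![0, w] = 0 :=
  κ.map_coord_zero 0 rfl

/-- A 2-form as a bilinear map. -/
def formBilin (κ : V [⋀^Fin 2]→L[ℝ] ℝ) : V →ₗ[ℝ] V →ₗ[ℝ] ℝ :=
  LinearMap.mk₂ ℝ (fun v w => κ ![v, w]) (fun a b w => κ.vecCons_add ![w] a b)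
    (fun c a w => κ.vecCons_smul ![w] c a)
    (fun w a b => by
      have e : κ ![a + b, w] = κ ![a, w] + κ ![b, w] := κ.vecCons_add ![w] a b
      rw [twoForm_antisymm κ w, twoForm_antisymm κ w a, twoForm_antisymm κ w b, e]
      ring)
    (fun c w a => by
      have e : κ ![c • a, w] = c • κ ![a, w] := κ.vecCons_smul ![w] c a
      rw [twoForm_antisymm κ w, twoForm_antisymm κ w a, e]
      simp)

theorem formBilin_apply (κ : V [⋀^Fin 2]→L[ℝ] ℝ) (v w : V) : formBilin κ v w = κ ![v, w] := rfl

end TwoForm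

/-! ### Null frames of a tangent space -/

section Point

variable {E : Type*} [NormedAddCommGroup E] [NormedSpace ℝ E]
  {V : Type*} [NormedAddCommGroup V] [NormedSpace ℝ V] [NormedSpace ℂ V]
  {m : ℕ}

/-- The situation in a single tangent space of a bundle of Kähler–Sasaki type. The map `A` onto the
Hermitian space `(V, κ)` stands for the differential of the projection of `M` onto the Kähler
manifold, and on the hyperplane `ker θ` the scalar product `g` is a positive multiple of the
pull-back of the Hermitian metric `κ(·, i·)`. -/
structure IsHermitianQuotient (g : E →L[ℝ] E →L[ℝ] ℝ) (θ : E →L[ℝ] ℝ) (A : E →L[ℝ] V)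
    (κ : V [⋀^Fin 2]→L[ℝ] ℝ) : Prop where
  symm : ∀ v w, g v w = g w v
  nondegenerate : ∀ v, (∀ w, g v w = 0) → v = 0
  exists_vertical : ∃ p, p ≠ 0 ∧ θ p = 0 ∧ A p = 0
  surjective : ∀ (t : ℝ) (v : V), ∃ x, θ x = t ∧ A x = v
  invariant : ∀ v w, κ ![Complex.I • v, Complex.I • w] = κ ![v, w]
  pos : ∀ v, v ≠ 0 → 0 < κ ![v, Complex.I • v]
  levi : ∃ c : ℝ, 0 < c ∧ ∀ v w, θ v = 0 → θ w = 0 →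
    g v w = c * κ ![A v, Complex.I • A w]

/-- A null frame `p, q, e, f` adapted to the flag `ℝp ⊂ ker θ` and to the complex structure
on `V = ker θ / ℝp`. -/
structure IsNullFrame (g : E →L[ℝ] E →L[ℝ] ℝ) (θ : E →L[ℝ] ℝ) (A : E →L[ℝ] V)
    (p q : E) (e f : Fin m → E) : Prop where
  g_p : ∀ w, g p w = θ w
  θ_p : θ p = 0
  A_p : A p = 0
  θ_q : θ q = 1
  g_qq : g q q = 0
  g_qe : ∀ a, g q (e a) = 0
  g_qf : ∀ a, g q (f a) = 0
  θ_e : ∀ a, θ (e a) = 0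
  θ_f : ∀ a, θ (f a) = 0
  A_f : ∀ a, A (f a) = Complex.I • A (e a)
  g_ee : ∀ a b, g (e a) (e b) = if a = b then 1 else 0
  g_ff : ∀ a b, g (f a) (f b) = if a = b then 1 else 0
  g_ef : ∀ a b, g (e a) (f b) = 0
  basis : ∃ b : Module.Basis (Fin m) ℂ V, ∀ a, b a = A (e a)

variable {g : E →L[ℝ] E →L[ℝ] ℝ} {θ : E →L[ℝ] ℝ} {A : E →L[ℝ] V} {κ : V [⋀^Fin 2]→L[ℝ] ℝ}

namespace IsHermitianQuotient

/-- The vector `p` with `g(p, ·) = θ` spans the vertical line, hence is null. -/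
theorem exists_dual (h : IsHermitianQuotient g θ A κ) :
    ∃ p, (∀ w, g p w = θ w) ∧ θ p = 0 ∧ A p = 0 := by
  obtain ⟨p, hp, hθ, hA⟩ := h.exists_vertical
  obtain ⟨q, hq, -⟩ := h.surjective 1 0
  obtain ⟨c, -, hc⟩ := h.levi
  have key : ∀ w, g p w = g p q * θ w := by
    intro w
    have h1 : g p (w - θ w • q) = 0 := by
      rw [hc p _ hθ (by simp [hq]), hA, twoForm_zero_left, mul_zero]
    rw [map_sub, map_smul, smul_eq_mul] at h1
    linarith
  have hs : g p q ≠ 0 := by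
    intro h0
    exact hp (h.nondegenerate p fun w => by rw [key, h0, zero_mul])
  refine ⟨(g p q)⁻¹ • p, fun w => ?_, by simp [hθ], by simp [hA]⟩
  rw [map_smul, _root_.smul_apply, key w, smul_eq_mul, inv_mul_cancel_left₀ hs]

/-- The vertical space `ker θ ∩ ker A` is a line. -/
theorem eq_smul_of_vertical (h : IsHermitianQuotient g θ A κ) {p : E}
    (hp : ∀ w, g p w = θ w) {v : E} (hθ : θ v = 0) (hA : A v = 0) : ∃ t : ℝ, v = t • p := by
  obtain ⟨q, hq, -⟩ := h.surjective 1 0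
  obtain ⟨c, -, hc⟩ := h.levi
  refine ⟨g v q, ?_⟩
  rw [← sub_eq_zero]
  refine h.nondegenerate _ fun w => ?_
  have h1 : g v (w - θ w • q) = 0 := by
    rw [hc v _ hθ (by simp [hq]), hA, twoForm_zero_left, mul_zero]
  rw [map_sub, map_smul, smul_eq_mul] at h1
  rw [map_sub, map_smul, _root_.sub_apply, _root_.smul_apply, hp, smul_eq_mul]
  linarith

/-- A unitary basis of `V` and its multiples by `i` lift to `ker θ`, where the scalar product is
the pull-back from `V`; the dual `p` of `θ` and a complementary null vector `q` complete the
frame. -/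
theorem exists_nullFrame [IsScalarTower ℝ ℂ V] [FiniteDimensional ℂ V]
    (h : IsHermitianQuotient g θ A κ) (hm : Module.finrank ℂ V = m) :
    ∃ (p q : E) (e f : Fin m → E), IsNullFrame g θ A p q e f := by
  obtain ⟨p, hp, hθp, hAp⟩ := h.exists_dual
  obtain ⟨c, hc0, hc⟩ := h.levi
  obtain ⟨b, hb⟩ := exists_unitary_basis hm (c • formBilin κ)
    (fun v w => by simp [formBilin_apply, twoForm_antisymm κ v w])
    (fun v w => by simp [formBilin_apply, h.invariant])
    (fun v hv => by simpa [formBilin_apply] using mul_pos hc0 (h.pos v hv))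
  simp only [LinearMap.smul_apply, formBilin_apply, smul_eq_mul] at hb
  choose e hθe hAe using fun a => h.surjective 0 (b a)
  choose f hθf hAf using fun a => h.surjective 0 (Complex.I • b a)
  have hee : ∀ a a', g (e a) (e a') = if a = a' then 1 else 0 := fun a a' => by
    rw [hc _ _ (hθe a) (hθe a'), hAe, hAe, (hb a a').1]
  have hff : ∀ a a', g (f a) (f a') = if a = a' then 1 else 0 := fun a a' => by
    rw [hc _ _ (hθf a) (hθf a'), hAf, hAf, h.invariant, (hb a a').1]
  have hef : ∀ a a', g (e a) (f a') = 0 := fun a a' => by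
    have : (Complex.I • Complex.I • b a') = -b a' := by
      rw [smul_smul, Complex.I_mul_I, neg_one_smul]
    have hn : κ ![b a, -b a'] = -κ ![b a, b a'] := by
      rw [← formBilin_apply, map_neg, formBilin_apply]
    rw [hc _ _ (hθe a) (hθf a'), hAe, hAf, this, hn, mul_neg, (hb a a').2, neg_zero]
  obtain ⟨q₀, hq₀, -⟩ := h.surjective 1 0
  -- project `q₀` to the orthogonal complement of the `e` and `f`, then correct it along `p`
  set q₁ : E := q₀ - ∑ a, g q₀ (e a) • e a - ∑ a, g q₀ (f a) • f a with hq₁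
  have h1 : θ q₁ = 1 := by simp [hq₁, hq₀, hθe, hθf]
  have hfe : ∀ a a', g (f a) (e a') = 0 := fun a a' => by rw [h.symm, hef]
  have h2 : ∀ a, g q₁ (e a) = 0 := by
    intro a
    simp [hq₁, hee, hfe]
  have h3 : ∀ a, g q₁ (f a) = 0 := by
    intro a
    simp [hq₁, hff, hef]
  refine ⟨p, q₁ - (g q₁ q₁ / 2) • p, e, f, ?_⟩
  have hgp : ∀ w, g w p = θ w := fun w => by rw [h.symm, hp]
  constructor
  · exact hp
  · exact hθp
  · exact hAp
  · simp [h1, hθp]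
  · simp only [map_sub, map_smul, _root_.sub_apply, _root_.smul_apply, hp, hgp, smul_eq_mul, h1,
      hθp]
    ring
  · intro a; simp [h2, hp, hθe]
  · intro a; simp [h3, hp, hθf]
  · exact hθe
  · exact hθf
  · intro a; rw [hAf, hAe]
  · exact hee
  · exact hff
  · exact hef
  · exact ⟨b, fun a => (hAe a).symm⟩

/-- Every vector is expanded in a null frame; the vectors dual to `p, f, q, e` are
`q, f, p, e`. -/
theorem nullFrame_expansion [IsScalarTower ℝ ℂ V] (h : IsHermitianQuotient g θ A κ) {p q : E}
    {e f : Fin m → E} (hF : IsNullFrame g θ A p q e f) (v : E) :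
    (g q v • p + ∑ a, g (f a) v • f a) + (g p v • q + ∑ a, g (e a) v • e a) = v := by
  obtain ⟨b, hb⟩ := hF.basis
  obtain ⟨c, hc0, hc⟩ := h.levi
  have hfe : ∀ a a', g (f a) (e a') = 0 := fun a a' => by rw [h.symm, hF.g_ef]
  have hgp : ∀ w, g w p = θ w := fun w => by rw [h.symm, hF.g_p]
  have heq : ∀ a, g (e a) q = 0 := fun a => by rw [h.symm, hF.g_qe]
  have hfq : ∀ a, g (f a) q = 0 := fun a => by rw [h.symm, hF.g_qf]
  -- the difference `d` of both sides is orthogonal to the whole frame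
  set d := (g q v • p + ∑ a, g (f a) v • f a) + (g p v • q + ∑ a, g (e a) v • e a) - v with hd
  have d1 : θ d = 0 := by simp [hd, hF.θ_p, hF.θ_f, hF.θ_e, hF.θ_q, hF.g_p]
  have d2 : ∀ a, g (e a) d = 0 := by
    intro a
    simp [hd, hgp, hF.θ_e, hF.g_ef, heq, hF.g_ee]
  have d3 : ∀ a, g (f a) d = 0 := by
    intro a
    simp [hd, hgp, hF.θ_f, hF.g_ff, hfq, hfe]
  have d4 : g q d = 0 := by
    simp [hd, hgp, hF.θ_q, hF.g_qq, hF.g_qe, hF.g_qf]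
  have hAd : A d = 0 := by
    by_contra hne
    have hK : ∀ w : V, c * κ ![w, Complex.I • A d] = 0 := by
      intro w
      have h1 : ∀ a, κ ![A (e a), Complex.I • A d] = 0 := fun a =>
        (mul_eq_zero.1 ((hc _ _ (hF.θ_e a) d1).symm.trans (d2 a))).resolve_left hc0.ne'
      have h2 : ∀ a, κ ![Complex.I • A (e a), Complex.I • A d] = 0 := fun a => by
        rw [← hF.A_f]
        exact (mul_eq_zero.1 ((hc _ _ (hF.θ_f a) d1).symm.trans (d3 a))).resolve_left hc0.ne'
      rw [← b.sum_repr w, ← formBilin_apply, map_sum, LinearMap.sum_apply,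
        Finset.sum_eq_zero, mul_zero]
      intro a _
      have hr : b.repr w a • b a = (b.repr w a).re • A (e a) +
          (b.repr w a).im • (Complex.I • A (e a)) := by
        rw [complex_smul_eq, hb]
      rw [hr, map_add, LinearMap.map_smul, LinearMap.map_smul, LinearMap.add_apply,
        LinearMap.smul_apply, LinearMap.smul_apply, formBilin_apply, formBilin_apply, h1, h2]
      simp
    exact (mul_pos hc0 (h.pos _ hne)).ne' (hK _)
  obtain ⟨t, ht⟩ := h.eq_smul_of_vertical hF.g_p d1 hAd
  have ht0 : t = 0 := by
    rw [ht, map_smul, hgp, hF.θ_q] at d4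
    simpa using d4
  rw [ht0, zero_smul] at ht
  exact sub_eq_zero.1 ht

end IsHermitianQuotient

end Point

/-! ### The wave in a tangent space and its Hodge dual -/

section PointWave

variable {E : Type*} [NormedAddCommGroup E] [NormedSpace ℝ E]
  {V : Type*} [NormedAddCommGroup V] [NormedSpace ℝ V]
  {m : ℕ}
  {g : E →L[ℝ] E →L[ℝ] ℝ} {θ : E →L[ℝ] ℝ} {A : E →L[ℝ] V} {κ : V [⋀^Fin 2]→L[ℝ] ℝ}

/-- The 1-forms `θ, λ₁ ∘ A, …, λ_m ∘ A`, whose wedge product is the wave. -/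
noncomputable def waveFactors (θ : E →L[ℝ] ℝ) (A : E →L[ℝ] V) (lam : Fin m → (V →L[ℝ] ℂ)) :
    Fin (m + 1) → (E →L[ℝ] ℂ) :=
  Fin.cons (Complex.ofRealCLM.comp θ) fun a => (lam a).comp A

theorem waveFactors_zero_apply (lam : Fin m → (V →L[ℝ] ℂ)) (v : E) :
    waveFactors θ A lam 0 v = (θ v : ℂ) := rfl

theorem waveFactors_succ_apply (lam : Fin m → (V →L[ℝ] ℂ)) (a : Fin m) (v : E) :
    waveFactors θ A lam a.succ v = lam a (A v) := rfl

/-- The wave `θ ∧ λ₁ ∘ A ∧ ⋯ ∧ λ_m ∘ A` in a single tangent space. -/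
noncomputable def waveAt (θ : E →L[ℝ] ℝ) (A : E →L[ℝ] V) (lam : Fin m → (V →L[ℝ] ℂ)) :
    E [⋀^Fin (m + 1)]→L[ℝ] ℂ :=
  wedgeOne (Complex.ofRealCLM.comp θ) (wedgeProd m fun a => (lam a).comp A)

theorem waveAt_eq (lam : Fin m → (V →L[ℝ] ℂ)) :
    waveAt θ A lam = wedgeProd (m + 1) (waveFactors θ A lam) :=
  wedgeOne_wedgeProd _ _

theorem waveAt_update_zero {lam : Fin m → (V →L[ℝ] ℂ)}
    (v : Fin (m + 1) → E) (a : Fin (m + 1)) {x : E} (hx : θ x = 0) (hA : A x = 0) :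
    waveAt θ A lam (Function.update v a x) = 0 := by
  rw [waveAt_eq]
  refine wedgeProd_update_of_eq_zero _ _ _ _ fun i => ?_
  refine Fin.cases ?_ (fun i => ?_) i
  · simp [waveFactors_zero_apply, hx]
  · rw [waveFactors_succ_apply, hA, map_zero]

theorem waveAt_cons (lam : Fin m → (V →L[ℝ] ℂ)) (q : E) (e : Fin m → E) (he : ∀ a, θ (e a) = 0) :
    waveAt θ A lam (Fin.cons q e) = θ q * (Matrix.of fun i j => lam i (A (e j))).det := by
  rw [waveAt_eq, wedgeProd_apply, Matrix.det_succ_row_zero, Fin.sum_univ_succ]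
  simp only [Matrix.of_apply, Fin.val_zero, pow_zero, one_mul, Fin.cons_zero, Fin.cons_succ,
    waveFactors_zero_apply, he, Complex.ofReal_zero, mul_zero, zero_mul, Finset.sum_const_zero,
    add_zero]
  congr 2

variable [NormedSpace ℂ V]

/-- The covectors `λ₁, …, λ_m` form a basis of the complex dual of `V`. -/
structure IsComplexCoframe (lam : Fin m → (V →L[ℝ] ℂ)) : Prop where
  map_I : ∀ a v, lam a (Complex.I • v) = Complex.I * lam a v
  separating : ∀ v, (∀ a, lam a v = 0) → v = 0

theorem IsComplexCoframe.map_smul [IsScalarTower ℝ ℂ V] {lam : Fin m → (V →L[ℝ] ℂ)}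
    (hl : IsComplexCoframe lam) (a : Fin m) (c : ℂ) (v : V) : lam a (c • v) = c * lam a v := by
  rw [complex_smul_eq, map_add, _root_.map_smul, _root_.map_smul, hl.map_I, Complex.real_smul,
    Complex.real_smul, ← mul_assoc, ← add_mul, Complex.re_add_im]

/-- The complex coordinates defined by a coframe. -/
theorem IsComplexCoframe.exists_equiv [IsScalarTower ℝ ℂ V] [FiniteDimensional ℂ V]
    (hm : Module.finrank ℂ V = m) {lam : Fin m → (V →L[ℝ] ℂ)} (hl : IsComplexCoframe lam) :
    ∃ L : V ≃ₗ[ℂ] (Fin m → ℂ), ∀ v a, L v a = lam a v := by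
  let L₀ : V →ₗ[ℂ] (Fin m → ℂ) :=
    { toFun := fun v a => lam a v
      map_add' := fun v w => by ext a; simp
      map_smul' := fun c v => by ext a; simp [hl.map_smul] }
  have hinj : Function.Injective L₀ := by
    rw [injective_iff_map_eq_zero]
    intro v hv
    exact hl.separating v fun a => congrFun hv a
  refine ⟨L₀.linearEquivOfInjective hinj (by simp [hm]), fun v a => rfl⟩

theorem waveAt_update_mul [IsScalarTower ℝ ℂ V] {lam : Fin m → (V →L[ℝ] ℂ)}
    (hl : IsComplexCoframe lam) (v : Fin (m + 1) → E) (a : Fin (m + 1)) {x y : E} (c : ℂ)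
    (hx : θ x = 0) (hy : θ y = 0) (hA : A y = c • A x) :
    waveAt θ A lam (Function.update v a y) = c * waveAt θ A lam (Function.update v a x) := by
  rw [waveAt_eq]
  refine wedgeProd_update_of_eq_mul _ _ _ _ _ _ fun i => ?_
  refine Fin.cases ?_ (fun i => ?_) i
  · simp [waveFactors_zero_apply, hx, hy]
  · rw [waveFactors_succ_apply, waveFactors_succ_apply, hA, hl.map_smul]

theorem waveAt_cons_ne_zero [IsScalarTower ℝ ℂ V] [FiniteDimensional ℂ V]
    (hm : Module.finrank ℂ V = m) {lam : Fin m → (V →L[ℝ] ℂ)}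
    (hl : IsComplexCoframe lam) {q : E} (hq : θ q ≠ 0) {e : Fin m → E} (he : ∀ a, θ (e a) = 0)
    (hli : LinearIndependent ℂ fun a => A (e a)) : waveAt θ A lam (Fin.cons q e) ≠ 0 := by
  obtain ⟨L, hL⟩ := hl.exists_equiv hm
  rw [waveAt_cons lam q e he, mul_ne_zero_iff]
  refine ⟨by exact_mod_cast hq, fun h0 => ?_⟩
  obtain ⟨w, hw, hMw⟩ := Matrix.exists_mulVec_eq_zero_iff.2 h0
  refine hw (funext fun j => Fintype.linearIndependent_iff.1 hli w ?_ j)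
  refine L.injective (funext fun i => ?_)
  have := congrFun hMw i
  simp only [Matrix.mulVec, dotProduct, Matrix.of_apply, Pi.zero_apply] at this
  rw [map_zero, Pi.zero_apply, ← this, map_sum, Finset.sum_apply]
  refine Finset.sum_congr rfl fun j _ => ?_
  rw [map_smul, Pi.smul_apply, hL, smul_eq_mul, mul_comm]

/-- An alternating form of degree `m + 1` which is annihilated by `p` and complex linear on
`ker θ / ℝp` is determined by its value on `(q, e₁, …, e_m)`. -/
theorem eq_zero_of_nullFrame [IsScalarTower ℝ ℂ V] (h : IsHermitianQuotient g θ A κ) {p q : E}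
    {e f : Fin m → E} (hF : IsNullFrame g θ A p q e f) (α : E [⋀^Fin (m + 1)]→L[ℝ] ℂ)
    (hp : ∀ w, α (Fin.cons p w) = 0)
    (hf : ∀ a w, α (Fin.cons (f a) w) = Complex.I * α (Fin.cons (e a) w))
    (h0 : α (Fin.cons q e) = 0) : α = 0 := by
  have hup : ∀ (x : Fin (m + 1) → E) i y, α (Function.update x i y) =
      (-1) ^ (i : ℕ) * α (Fin.cons y (i.removeNth x)) := by
    intro x i y
    rw [← Fin.insertNth_removeNth, α.map_insertNth]
    simp [zsmul_eq_mul, Matrix.vecCons]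
  have hp' : ∀ x i, α (Function.update x i p) = 0 := fun x i => by rw [hup, hp, mul_zero]
  have hf' : ∀ x i a, α (Function.update x i (f a)) =
      Complex.I * α (Function.update x i (e a)) := fun x i a => by
    rw [hup, hup, hf]; ring
  set u : Fin (m + 1) → E := Fin.cons q e with hu
  -- the arguments with index in `s` are arbitrary, the remaining ones are taken from `q, e`
  have key : ∀ (s : Finset (Fin (m + 1))) (x : Fin (m + 1) → E),
      (∀ a ∉ s, ∃ j, x a = u j) → α x = 0 := by
    intro s
    induction s using Finset.induction_on with
    | empty =>
      intro x hx
      choose r hr using fun a => hx a (Finset.notMem_empty a)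
      have hxr : x = fun a => u (r a) := funext hr
      by_cases hinj : Function.Injective r
      · have hσ := α.toAlternatingMap.map_perm u
          (Equiv.ofBijective r (Finite.injective_iff_bijective.1 hinj))
        have h1 : α x = Equiv.Perm.sign
          (Equiv.ofBijective r (Finite.injective_iff_bijective.1 hinj)) • α u := by
          rw [hxr]; exact hσ
        rw [h1, h0, smul_zero]
      · simp only [Function.Injective, not_forall] at hinj
        obtain ⟨a, b, hab, hne⟩ := hinj
        exact α.map_eq_zero_of_eq x (by rw [hr, hr, hab]) hne
    | insert a s _ ih =>
      intro x hx
      have hj : ∀ j, α (Function.update x a (u j)) = 0 := by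
        intro j
        refine ih _ fun b hb => ?_
        by_cases hab : b = a
        · subst hab; exact ⟨j, by simp⟩
        · obtain ⟨j', hj'⟩ := hx b (by simp [hab, hb])
          exact ⟨j', by simp [hab, hj']⟩
      have hq' : α (Function.update x a q) = 0 := hj 0
      have he' : ∀ b, α (Function.update x a (e b)) = 0 := fun b => hj b.succ
      set ℓ := α.toAlternatingMap.toMultilinearMap.toLinearMap x a with hℓ
      have hℓ' : ∀ y, ℓ y = α (Function.update x a y) := fun y => rfl
      have hx' : α x = ℓ (x a) := by rw [hℓ', Function.update_eq_self]
      rw [hx', ← h.nullFrame_expansion hF (x a)]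
      simp only [map_add, map_sum, map_smul]
      simp only [hℓ', hp', hf', hq', he', smul_zero, mul_zero,
        Finset.sum_const_zero, add_zero]
  ext x
  exact key Finset.univ x fun a ha => absurd (Finset.mem_univ a) ha

/-- A volume form takes the values `±1` on an adapted null frame. -/
theorem vol_nullFrame_sq (h : IsHermitianQuotient g θ A κ) {p q : E}
    {e f : Fin m → E} (hF : IsNullFrame g θ A p q e f)
    (vol : E [⋀^Fin ((m + 1) + (m + 1))]→L[ℝ] ℝ)
    (hvol : ∀ v, vol v ^ 2 = |(Matrix.of fun i j => g (v i) (v j)).det|) :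
    vol (Fin.append (Fin.cons p f) (Fin.cons q e)) ^ 2 = 1 := by
  rw [hvol]
  set u : Fin (m + 1) → E := Fin.cons p f
  set u' : Fin (m + 1) → E := Fin.cons q e
  have hfe : ∀ a a', g (f a) (e a') = 0 := fun a a' => by rw [h.symm, hF.g_ef]
  have hgp : ∀ w, g w p = θ w := fun w => by rw [h.symm, hF.g_p]
  have heq : ∀ a, g (e a) q = 0 := fun a => by rw [h.symm, hF.g_qe]
  have hfq : ∀ a, g (f a) q = 0 := fun a => by rw [h.symm, hF.g_qf]
  -- the Gram matrix of `p, f, q, e` is an involution, so its determinant is `±1`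
  set D₁ : Matrix (Fin (m + 1)) (Fin (m + 1)) ℝ := Matrix.diagonal (Fin.cons 0 fun _ => 1)
  set D₂ : Matrix (Fin (m + 1)) (Fin (m + 1)) ℝ := Matrix.diagonal (Fin.cons 1 fun _ => 0)
  have hG : (Matrix.of fun i j => g (Fin.append u u' i) (Fin.append u u' j)) =
      (Matrix.fromBlocks D₁ D₂ D₂ D₁).submatrix finSumFinEquiv.symm finSumFinEquiv.symm := by
    ext i j
    refine Fin.addCases (fun i => ?_) (fun i => ?_) i <;>
    refine Fin.addCases (fun j => ?_) (fun j => ?_) j <;>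
    refine Fin.cases ?_ (fun i => ?_) i <;>
    refine Fin.cases ?_ (fun j => ?_) j <;>
    simp [-Fin.natAdd_eq_addNat, u, u', D₁, D₂, Matrix.diagonal_apply, hF.g_p, hF.θ_p, hF.θ_f,
      hF.θ_q, hF.θ_e, hF.g_qq, hF.g_qe, hF.g_qf, hF.g_ee, hF.g_ff, hF.g_ef, hfe, hgp, heq, hfq,
      (Fin.succ_ne_zero _).symm]
  rw [hG, Matrix.det_submatrix_equiv_self]
  have hsq : Matrix.fromBlocks D₁ D₂ D₂ D₁ * Matrix.fromBlocks D₁ D₂ D₂ D₁ = 1 := by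
    rw [Matrix.fromBlocks_multiply, ← Matrix.fromBlocks_one]
    simp only [D₁, D₂, Matrix.diagonal_mul_diagonal, Matrix.diagonal_add, ← Matrix.diagonal_one,
      ← Matrix.diagonal_zero]
    congr 2 <;> ext i <;> refine Fin.cases ?_ (fun i => ?_) i <;> simp
  have hdet := congrArg Matrix.det hsq
  rw [Matrix.det_mul, Matrix.det_one] at hdet
  rcases mul_self_eq_one_iff.1 hdet with h1 | h1 <;> simp [h1]

/-- The wave is an eigenform of the Hodge star operator. The `g`-dual of a factor of the wave lies
in the kernel of its Hodge dual, so both forms are annihilated by `p` and complex linear on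
`ker θ / ℝp`. They are then compared on the single tuple `(q, e₁, …, e_m)`. -/
theorem hodgeStar_waveAt [IsScalarTower ℝ ℂ V] [FiniteDimensional ℂ V] [FiniteDimensional ℝ E]
    (h : IsHermitianQuotient g θ A κ) (hm : Module.finrank ℂ V = m)
    {lam : Fin m → (V →L[ℝ] ℂ)} (hl : IsComplexCoframe lam)
    (vol : E [⋀^Fin ((m + 1) + (m + 1))]→L[ℝ] ℝ)
    (hvol : ∀ v, vol v ^ 2 = |(Matrix.of fun i j => g (v i) (v j)).det|) :
    ∃ ε : ℂ, (ε = 1 ∨ ε = -1) ∧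
      hodgeStar g vol (waveAt θ A lam) = (ε * Complex.I ^ m) • waveAt θ A lam := by
  obtain ⟨p, q, e, f, hF⟩ := h.exists_nullFrame hm
  set Φ := waveAt θ A lam with hΦ
  have hL0 : ∀ i, wedgeOne (waveFactors θ A lam i) Φ = 0 := fun i => by
    rw [hΦ, waveAt_eq]; exact wedgeOne_wedgeProd_self _ _
  have hp : ∀ w, hodgeStar g vol Φ (Fin.cons p w) = 0 := by
    intro w
    have := hodgeStar_cons_eq_zero h.symm h.nondegenerate vol Φ (waveFactors θ A lam 0) p 0
      (fun w => by simp [waveFactors_zero_apply, hF.g_p]) (hL0 0) w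
    rwa [(hodgeStar g vol Φ).map_coord_zero (m := Fin.cons 0 w) 0 (by simp), mul_zero,
      add_zero] at this
  have hf : ∀ a w, hodgeStar g vol Φ (Fin.cons (f a) w) =
      Complex.I * hodgeStar g vol Φ (Fin.cons (e a) w) := by
    intro a w
    -- the covector `g(e_a, ·) + i g(f_a, ·)` is a combination of `θ` and the `λ_b ∘ A`, because it
    -- vanishes on `p` and is complex linear on `ker θ / ℝp`
    obtain ⟨L, hL⟩ := hl.exists_equiv hm
    obtain ⟨b, hb⟩ := hF.basis
    set d : Fin m → ℂ := fun j => b.repr (L.symm (Pi.single j 1)) a with hd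
    have hrepr : ∀ v, b.repr v a = ∑ j, d j * lam j v := by
      intro v
      have h1 : v = ∑ j, lam j v • L.symm (Pi.single j 1) := by
        refine L.injective ?_
        rw [map_sum]
        ext i
        simp [hL, Finset.sum_apply, Pi.single_apply]
      conv_lhs => rw [h1]
      simp [hd, mul_comm]
    set lam' : E →L[ℝ] ℂ := ∑ j, d j • waveFactors θ A lam j.succ with hlam'
    have h1 : ∀ w, lam' w = b.repr (A w) a := by
      intro w
      simp [hlam', waveFactors_succ_apply, hrepr]
    have h2 : ∀ w, b.repr (A w) a = g (e a) w + Complex.I * g (f a) w +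
        θ w * b.repr (A q) a := by
      intro w
      have hAw : A w = ∑ j, (g (f j) w : ℂ) • (Complex.I • b j) + (θ w : ℂ) • A q
          + ∑ j, (g (e j) w : ℂ) • b j := by
        conv_lhs => rw [← h.nullFrame_expansion hF w]
        simp only [map_add, map_sum, map_smul, hF.A_p, smul_zero, zero_add, hF.A_f, hF.g_p, hb]
        have hr : ∀ (r : ℝ) (v : V), (r : ℂ) • v = r • v := fun r v => by
          rw [complex_smul_eq]; simp
        simp only [hr]
        abel
      rw [hAw]
      simp only [map_add, map_sum, map_smul, Finsupp.add_apply, Finsupp.finsetSum_apply,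
        Finsupp.smul_apply, Module.Basis.repr_self, Finsupp.single_apply, smul_eq_mul, mul_ite,
        mul_one, mul_zero, Finset.sum_ite_eq', Finset.mem_univ, if_true]
      ring
    have h3 := hodgeStar_cons_eq_zero h.symm h.nondegenerate vol Φ
      (lam' + (-b.repr (A q) a) • waveFactors θ A lam 0) (e a) (f a)
      (fun w => by
        simp only [_root_.add_apply, _root_.smul_apply, h1, h2 w, waveFactors_zero_apply,
          smul_eq_mul]
        ring)
      (by
        have hz : ∀ (r : ℂ) i, wedgeOne (r • waveFactors θ A lam i) Φ = 0 := fun r i => by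
          rw [wedgeOne_smul, hL0]
          ext v
          exact mul_zero r
        rw [wedgeOne_add, hz, add_zero, hlam']
        have : ∀ s : Finset (Fin m),
            wedgeOne (∑ j ∈ s, d j • waveFactors θ A lam j.succ) Φ = 0 := by
          intro s
          induction s using Finset.induction_on with
          | empty =>
            ext v
            simp [wedgeOne_apply]
          | insert j s hj ih =>
            rw [Finset.sum_insert hj, wedgeOne_add, ih, hz, add_zero]
        exact this _) w
    linear_combination (-Complex.I) * h3 +
      hodgeStar g vol Φ (Fin.cons (f a) w) * Complex.I_mul_I
  -- the dual of the half frame `p, f` is `q, f`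
  have hval : hodgeStar g vol Φ (Fin.cons q e) =
      vol (Fin.append (Fin.cons p f) (Fin.cons q e)) • Φ (Fin.cons q f) := by
    refine hodgeStar_apply_half h.symm h.nondegenerate (c' := Fin.cons p e) (fun v => ?_) vol Φ
    simp only [Fin.sum_univ_succ, Fin.cons_zero, Fin.cons_succ]
    exact h.nullFrame_expansion hF v
  have hqf : Φ (Fin.cons q f) = Complex.I ^ m * Φ (Fin.cons q e) := by
    rw [hΦ, waveAt_cons _ _ _ hF.θ_f, waveAt_cons _ _ _ hF.θ_e]
    have : (Matrix.of fun i j => lam i (A (f j))) = Complex.I • Matrix.of fun i j =>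
        lam i (A (e j)) := by
      ext i j
      simp [hF.A_f, hl.map_I]
    rw [this, Matrix.det_smul, Fintype.card_fin]
    ring
  set ε : ℝ := vol (Fin.append (Fin.cons p f) (Fin.cons q e)) with hε
  have hε1 : ε = 1 ∨ ε = -1 := mul_self_eq_one_iff.1
    ((sq ε).symm.trans (vol_nullFrame_sq h hF vol hvol))
  refine ⟨ε, by rcases hε1 with h1 | h1 <;> simp [h1], ?_⟩
  rw [← sub_eq_zero]
  refine eq_zero_of_nullFrame h hF _ (fun w => ?_) (fun a w => ?_) ?_
  · have : Φ (Fin.cons p w) = 0 := by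
      have := waveAt_update_zero (lam := lam) (Fin.cons p w : Fin (m + 1) → E) 0 hF.θ_p hF.A_p
      rwa [Fin.update_cons_zero] at this
    simp [hp, this]
  · have := waveAt_update_mul hl (Fin.cons p w : Fin (m + 1) → E) 0 Complex.I (hF.θ_e a) (hF.θ_f a)
      (hF.A_f a)
    rw [Fin.update_cons_zero, Fin.update_cons_zero] at this
    simp only [ContinuousAlternatingMap.sub_apply, ContinuousAlternatingMap.smul_apply,
      smul_eq_mul]
    rw [hf, show Φ (Fin.cons (f a) w) = _ from this]
    ring
  · simp only [ContinuousAlternatingMap.sub_apply, ContinuousAlternatingMap.smul_apply, hval, hqf,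
      smul_eq_mul, Complex.real_smul]
    ring

end PointWave

/-! ### Non-vanishing and kernel of the real part -/

section PointFlag

variable {E : Type*} [NormedAddCommGroup E] [NormedSpace ℝ E]
  {V : Type*} [NormedAddCommGroup V] [NormedSpace ℝ V] [NormedSpace ℂ V] {m : ℕ}
  {g : E →L[ℝ] E →L[ℝ] ℝ} {θ : E →L[ℝ] ℝ} {A : E →L[ℝ] V} {κ : V [⋀^Fin 2]→L[ℝ] ℝ}

/-- The radical of `g` on `ker θ` is the vertical line, because `g` is positive on
`ker θ / ker A`. -/
theorem IsHermitianQuotient.mem_radical_iff (h : IsHermitianQuotient g θ A κ) (v : E) :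
    v ∈ radical (LinearMap.ker (θ : E →ₗ[ℝ] ℝ)) g ↔ θ v = 0 ∧ A v = 0 := by
  obtain ⟨c, hc0, hc⟩ := h.levi
  constructor
  · rintro ⟨hv, hv'⟩
    have hv0 : θ v = 0 := hv
    refine ⟨hv0, ?_⟩
    by_contra hne
    have h1 := hv' v hv
    rw [hc v v hv0 hv0] at h1
    exact (mul_pos hc0 (h.pos _ hne)).ne' h1
  · rintro ⟨hv, hA⟩
    refine ⟨hv, fun w hw => ?_⟩
    rw [hc v w hv hw, hA, twoForm_zero_left, mul_zero]

theorem IsHermitianQuotient.exists_null_dual (h : IsHermitianQuotient g θ A κ) :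
    ∃ p : E, p ≠ 0 ∧ g p = θ ∧ g p p = 0 := by
  obtain ⟨p, hp, hθ, -⟩ := h.exists_dual
  refine ⟨p, ?_, ContinuousLinearMap.ext hp, by rw [hp, hθ]⟩
  rintro rfl
  obtain ⟨q, hq, -⟩ := h.surjective 1 0
  have := hp q
  simp [hq] at this

/-- A null vector of `ker θ` is vertical. -/
theorem IsHermitianQuotient.eq_zero_of_null (h : IsHermitianQuotient g θ A κ) {v : E}
    (hv : θ v = 0) (hn : g v v = 0) : A v = 0 := by
  obtain ⟨c, hc0, hc⟩ := h.levi
  by_contra hne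
  rw [hc v v hv hv] at hn
  exact (mul_pos hc0 (h.pos _ hne)).ne' hn

theorem IsNullFrame.linearIndependent {p q : E} {e f : Fin m → E}
    (hF : IsNullFrame g θ A p q e f) : LinearIndependent ℂ fun a => A (e a) := by
  obtain ⟨b, hb⟩ := hF.basis
  rw [show (fun a => A (e a)) = b from funext fun a => (hb a).symm]
  exact b.linearIndependent

theorem apply_eq_zero_of_mem_formKernel {k : ℕ} {F : Type*} [NormedAddCommGroup F] [NormedSpace ℝ F]
    {α : E [⋀^Fin k]→L[ℝ] F} {v : E} (hv : v ∈ formKernel α) (u : Fin k → E) (i : Fin k)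
    (hu : u i = v) : α u = 0 := by
  have := hv u i
  rwa [← hu, Function.update_eq_self] at this

variable [IsScalarTower ℝ ℂ V]

/-- Multiplying a horizontal argument by a suitable complex number makes the value of the wave
real and non-zero. -/
theorem exists_reForm_update_ne_zero (h : IsHermitianQuotient g θ A κ)
    {lam : Fin m → (V →L[ℝ] ℂ)} (hl : IsComplexCoframe lam) {u : Fin (m + 1) → E}
    (hu : waveAt θ A lam u ≠ 0) (a : Fin (m + 1)) (ha : θ (u a) = 0) :
    ∃ y, reForm (waveAt θ A lam) (Function.update u a y) ≠ 0 := by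
  obtain ⟨y, hy, hAy⟩ := h.surjective 0 ((starRingEnd ℂ) (waveAt θ A lam u) • A (u a))
  refine ⟨y, ?_⟩
  rw [reForm_apply, waveAt_update_mul hl u a _ ha hy hAy, Function.update_eq_self,
    ← Complex.normSq_eq_conj_mul_self, Complex.ofReal_re]
  exact (Complex.normSq_pos.2 hu).ne'

variable [FiniteDimensional ℂ V]

/-- Rotating a horizontal argument, which exists for `1 ≤ m`, turns a non-zero value of the wave
into a real one. -/
theorem reForm_waveAt_ne_zero (h : IsHermitianQuotient g θ A κ)
    (hm : Module.finrank ℂ V = m) (hm1 : 1 ≤ m)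
    {lam : Fin m → (V →L[ℝ] ℂ)} (hl : IsComplexCoframe lam) :
    reForm (waveAt θ A lam) ≠ 0 := by
  obtain ⟨p, q, e, f, hF⟩ := h.exists_nullFrame hm
  have hne := waveAt_cons_ne_zero hm hl (q := q) (by rw [hF.θ_q]; exact one_ne_zero) hF.θ_e
    hF.linearIndependent
  obtain ⟨y, hy⟩ := exists_reForm_update_ne_zero h hl hne (Fin.succ ⟨0, hm1⟩)
    (by rw [Fin.cons_succ]; exact hF.θ_e _)
  intro h0
  rw [h0] at hy
  exact hy rfl

/-- The kernels of the real part of the wave and of its Hodge dual intersect in the vertical line.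
For `m = 1` both kernels are needed, for `m ≥ 2` they coincide. -/
theorem mem_formKernel_reForm_iff (h : IsHermitianQuotient g θ A κ)
    (hm : Module.finrank ℂ V = m) (hm1 : 1 ≤ m)
    {lam : Fin m → (V →L[ℝ] ℂ)} (hl : IsComplexCoframe lam) {ε : ℂ} (hε : ε = 1 ∨ ε = -1) (v : E) :
    v ∈ formKernel (reForm (waveAt θ A lam)) ⊓
        formKernel (reForm ((ε * Complex.I ^ m) • waveAt θ A lam)) ↔ θ v = 0 ∧ A v = 0 := by
  constructor
  · rintro ⟨hv1, hv2⟩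
    obtain ⟨p, q, e, f, hF⟩ := h.exists_nullFrame hm
    have hv : θ v = 0 := by
      by_contra hne
      have h1 := waveAt_cons_ne_zero hm hl hne hF.θ_e
        hF.linearIndependent
      obtain ⟨y, hy⟩ := exists_reForm_update_ne_zero h hl h1 (Fin.succ ⟨0, hm1⟩)
        (by rw [Fin.cons_succ]; exact hF.θ_e _)
      exact hy (apply_eq_zero_of_mem_formKernel hv1 _ 0 (by simp [Function.update_of_ne]))
    refine ⟨hv, ?_⟩
    by_contra hne
    -- a basis of `V` which contains `A v` is lifted to `ker θ`
    obtain ⟨a, ha⟩ : ∃ a, lam a (A v) ≠ 0 := by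
      by_contra hcon
      push Not at hcon
      exact hne (hl.separating _ hcon)
    obtain ⟨L, hL⟩ := hl.exists_equiv hm
    choose x hθx hAx using fun j => h.surjective 0 (L.symm (Pi.single j 1))
    set u : Fin m → E := Function.update x a v with hu
    have hθu : ∀ j, θ (u j) = 0 := by
      intro j
      by_cases hj : j = a
      · subst hj; simpa [hu] using hv
      · simpa [hu, hj] using hθx j
    -- the determinant of the unit matrix with column `a` replaced by `λ(A v)` is `λ_a(A v)`
    have hΦ : waveAt θ A lam (Fin.cons q u) ≠ 0 := by
      rw [waveAt_cons _ _ _ hθu, hF.θ_q, Complex.ofReal_one, one_mul]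
      have hM : (Matrix.of fun i j => lam i (A (u j))) =
          (1 : Matrix (Fin m) (Fin m) ℂ).updateCol a fun i => lam i (A v) := by
        ext i j
        by_cases hj : j = a
        · subst hj; simp [hu]
        · simp [hu, hj, hAx, ← hL, Matrix.one_apply, Pi.single_apply]
      rw [hM, ← Matrix.cramer_apply, Matrix.cramer_one]
      exact ha
    by_cases hm2 : ∃ j : Fin m, j ≠ a
    · obtain ⟨j, hj⟩ := hm2
      obtain ⟨y, hy⟩ := exists_reForm_update_ne_zero h hl hΦ j.succ
        (by rw [Fin.cons_succ]; exact hθu j)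
      refine hy (apply_eq_zero_of_mem_formKernel hv1 _ a.succ ?_)
      rw [Function.update_of_ne (by simpa using Ne.symm hj), Fin.cons_succ]
      simp [hu]
    -- for `m = 1` the two forms are the real and, up to sign, the imaginary part of the wave
    · push Not at hm2
      have hm' : m = 1 := by
        have h1 : Fintype.card (Fin m) ≤ 1 :=
          Fintype.card_le_one_iff.2 fun i j => (hm2 i).trans (hm2 j).symm
        rw [Fintype.card_fin] at h1
        omega
      have h1 := apply_eq_zero_of_mem_formKernel hv1 (Fin.cons q u) a.succ (by simp [hu])
      have h2 := apply_eq_zero_of_mem_formKernel hv2 (Fin.cons q u) a.succ (by simp [hu])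
      rw [reForm_apply] at h1 h2
      rw [ContinuousAlternatingMap.smul_apply,
        show Complex.I ^ m = Complex.I by rw [hm', pow_one], smul_eq_mul] at h2
      refine hΦ (Complex.ext h1 ?_)
      rw [Complex.zero_im]
      rcases hε with rfl | rfl
      · simpa using h2
      · simpa using h2
  · rintro ⟨hv, hA⟩
    refine ⟨fun w i => ?_, fun w i => ?_⟩
    · rw [reForm_apply, waveAt_update_zero w i hv hA, Complex.zero_re]
    · rw [reForm_apply, ContinuousAlternatingMap.smul_apply, waveAt_update_zero w i hv hA,
        smul_zero, Complex.zero_re]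

end PointFlag

/-! ### The product of a (1,1)-form and an (m,0)-form -/

section Antisymmetrization

open ContinuousAlternatingMap (alternatizeUncurryFin alternatizeUncurryFinCLM
  alternatizeUncurryFin_apply alternatizeUncurryFinCLM_apply
  alternatizeUncurryFin_alternatizeUncurryFinCLM_comp_apply)

variable {E : Type*} [NormedAddCommGroup E] [NormedSpace ℝ E]
  {F : Type*} [NormedAddCommGroup F] [NormedSpace ℝ F] {k : ℕ}

/-- The full alternation of `f` depends only on the part of `f` which is skew in the first two
arguments. -/
theorem alternatize_congr {f f' : E →L[ℝ] E →L[ℝ] E [⋀^Fin k]→L[ℝ] F}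
    (h : ∀ u v, f u v - f v u = f' u v - f' v u) :
    alternatizeUncurryFin (alternatizeUncurryFinCLM ℝ E F ∘L f) =
      alternatizeUncurryFin (alternatizeUncurryFinCLM ℝ E F ∘L f') := by
  ext v
  rw [alternatizeUncurryFin_alternatizeUncurryFinCLM_comp_apply,
    alternatizeUncurryFin_alternatizeUncurryFinCLM_comp_apply]
  refine Finset.sum_congr rfl fun i _ => Finset.sum_congr rfl fun j _ => ?_
  rw [← ContinuousAlternatingMap.sub_apply, h, ContinuousAlternatingMap.sub_apply]

/-- The wedge product with a complex 1-form as a continuous bilinear map. -/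
noncomputable def wedgeOneL (E : Type*) [NormedAddCommGroup E] [NormedSpace ℝ E] (k : ℕ) :
    (E [⋀^Fin k]→L[ℝ] ℂ) →L[ℝ] (E →L[ℝ] ℂ) →L[ℝ] (E [⋀^Fin (k + 1)]→L[ℝ] ℂ) :=
  (ContinuousLinearMap.compL ℝ (E →L[ℝ] ℂ) (E →L[ℝ] E [⋀^Fin k]→L[ℝ] ℂ) _
    (alternatizeUncurryFinCLM ℝ E ℂ)) ∘L
  (ContinuousLinearMap.compL ℝ E ℂ (E [⋀^Fin k]→L[ℝ] ℂ)) ∘L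
    (ContinuousLinearMap.lsmul ℝ ℂ :
      ℂ →L[ℝ] (E [⋀^Fin k]→L[ℝ] ℂ) →L[ℝ] (E [⋀^Fin k]→L[ℝ] ℂ)).flip

theorem wedgeOneL_apply (θ : E →L[ℝ] ℂ) (α : E [⋀^Fin k]→L[ℝ] ℂ) :
    wedgeOneL E k α θ = wedgeOne θ α := by
  rw [wedgeOneL, wedgeOne]
  simp only [ContinuousLinearMap.comp_apply, ContinuousLinearMap.compL_apply,
    alternatizeUncurryFinCLM_apply]
  congr 1

variable {V : Type*} [NormedAddCommGroup V] [NormedSpace ℝ V] [NormedSpace ℂ V]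
  [IsScalarTower ℝ ℂ V] [FiniteDimensional ℂ V] [FiniteDimensional ℝ E] {m : ℕ}

/-- A `(1,1)`-form wedge a form of type `(m,0)` vanishes in complex dimension `m`. Here `B` is any
bilinear form with skew part `A^* κ`, such as the derivative of a 1-form with differential
`A^* κ`, and the left hand side is `A^* κ ∧ λ₁ ∘ A ∧ ⋯ ∧ λ_m ∘ A`. -/
theorem alternatize_smul_eq_zero {A : E →L[ℝ] V} {κ : V [⋀^Fin 2]→L[ℝ] ℝ}
    (hinv : ∀ v w, κ ![Complex.I • v, Complex.I • w] = κ ![v, w])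
    (hm : Module.finrank ℂ V = m) {lam : Fin m → (V →L[ℝ] ℂ)} (hl : IsComplexCoframe lam)
    (B : E → E → ℂ) (hB : ∀ u v, B u v - B v u = κ ![A u, A v])
    (f : E →L[ℝ] E →L[ℝ] E [⋀^Fin m]→L[ℝ] ℂ)
    (hf : ∀ u v, f u v = B u v • wedgeProd m fun a => (lam a).comp A) :
    alternatizeUncurryFin (alternatizeUncurryFinCLM ℝ E ℂ ∘L f) = 0 := by
  obtain ⟨L, hL⟩ := hl.exists_equiv hm
  set K := formBilin κ
  have hI : ∀ v w, K (Complex.I • v) w = -K v (Complex.I • w) := by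
    intro v w
    have := hinv (Complex.I • v) w
    rw [smul_smul, Complex.I_mul_I, neg_one_smul] at this
    change K (Complex.I • v) w = -κ ![v, Complex.I • w]
    rw [show K (Complex.I • v) w = κ ![Complex.I • v, w] from rfl, ← this]
    change K (-v) _ = -K v _
    rw [map_neg, LinearMap.neg_apply]
  -- `κ(u, v) = P(u, v) - P(v, u)`, where `P` is complex linear in the first argument
  let P : V →ₗ[ℂ] V →ₗ[ℝ] ℂ :=
    { toFun := fun v => (2⁻¹ : ℂ) • (Complex.ofRealCLM.toLinearMap ∘ₗ K v -
        Complex.I • (Complex.ofRealCLM.toLinearMap ∘ₗ K (Complex.I • v)))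
      map_add' := by
        intro v w
        ext x
        simp
        ring
      map_smul' := by
        intro c v
        ext x
        rw [complex_smul_eq c v]
        simp only [map_add, map_smul, smul_add, smul_comm Complex.I, smul_smul Complex.I,
          Complex.I_mul_I, neg_one_smul, map_neg, LinearMap.smul_apply, LinearMap.sub_apply,
          LinearMap.comp_apply, LinearMap.add_apply, LinearMap.neg_apply, smul_eq_mul,
          RingHom.id_apply, ContinuousLinearMap.coe_coe,
          Complex.ofRealCLM_apply, Complex.ofReal_mul, Complex.ofReal_neg]
        conv_rhs => rw [← Complex.re_add_im c]
        linear_combination (2⁻¹ * (c.im : ℂ) * (K (Complex.I • v) x : ℂ)) * Complex.I_mul_I }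
  have hP : ∀ u v, P u v = 2⁻¹ * ((K u v : ℂ) - Complex.I * (K (Complex.I • u) v : ℂ)) :=
    fun u v => rfl
  have hPK : ∀ u v, P u v - P v u = K u v := by
    intro u v
    have h1 : K v u = -K u v := twoForm_antisymm κ v u
    have h2 : K (Complex.I • v) u = K (Complex.I • u) v := by
      rw [hI u v]
      exact twoForm_antisymm κ _ _
    rw [hP, hP, h1, h2]
    push_cast
    ring
  set μ : Fin m → (E →L[ℝ] ℂ) := fun a =>
    LinearMap.toContinuousLinearMap (P (L.symm (Pi.single a 1)) ∘ₗ (A : E →ₗ[ℝ] V)) with hμ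
  have hPμ : ∀ u v : E, P (A u) (A v) = ∑ a, lam a (A u) * μ a v := by
    intro u v
    have h1 : A u = ∑ j, lam j (A u) • L.symm (Pi.single j 1) := by
      refine L.injective ?_
      rw [map_sum]
      ext i
      simp [hL, Finset.sum_apply, Pi.single_apply]
    conv_lhs => rw [h1]
    rw [map_sum, LinearMap.sum_apply]
    refine Finset.sum_congr rfl fun a _ => ?_
    rw [map_smul]
    rfl
  set η := wedgeProd m fun a => (lam a).comp A with hη
  -- `A^* κ` is also the skew part of `Q = -∑ μ_a ⊗ λ_a ∘ A`, and `λ_a ∘ A` annihilates `η`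
  let Q : E →L[ℝ] E →L[ℝ] ℂ := LinearMap.toContinuousLinearMap
    { toFun := fun u => -∑ a, μ a u • (lam a).comp A
      map_add' := fun u v => by
        ext w
        simp only [_root_.neg_apply, _root_.sum_apply, _root_.smul_apply, _root_.add_apply, map_add,
          smul_eq_mul, add_mul, Finset.sum_add_distrib, neg_add]
      map_smul' := fun c u => by
        simp only [map_smul, smul_assoc, RingHom.id_apply, smul_neg, Finset.smul_sum] }
  have hQu : ∀ u, Q u = -∑ a, μ a u • (lam a).comp A := fun u => rfl
  let f' : E →L[ℝ] E →L[ℝ] E [⋀^Fin m]→L[ℝ] ℂ :=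
    (ContinuousLinearMap.compL ℝ E ℂ (E [⋀^Fin m]→L[ℝ] ℂ) ((ContinuousLinearMap.lsmul ℝ ℂ :
      ℂ →L[ℝ] (E [⋀^Fin m]→L[ℝ] ℂ) →L[ℝ] (E [⋀^Fin m]→L[ℝ] ℂ)).flip η)) ∘L Q
  have hf'v : ∀ u v x, f' u v x = -(P (A v) (A u) * η x) := by
    intro u v x
    change Q u v * η x = _
    rw [hPμ, hQu, ← neg_mul, _root_.neg_apply, _root_.sum_apply]
    simp only [_root_.smul_apply, ContinuousLinearMap.comp_apply, smul_eq_mul, mul_comm]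
  rw [alternatize_congr (f' := f')]
  · have : alternatizeUncurryFinCLM ℝ E ℂ ∘L f' = 0 := by
      ext1 u
      change wedgeOne (Q u) η = 0
      have h1 : ∀ a, wedgeOneL E m η (μ a u • (lam a).comp A) = 0 := by
        intro a
        rw [wedgeOneL_apply, wedgeOne_smul, hη, wedgeOne_wedgeProd_self (fun a => (lam a).comp A) a]
        ext y
        exact mul_zero _
      rw [← wedgeOneL_apply, hQu, map_neg, map_sum, Finset.sum_eq_zero fun a _ => h1 a, neg_zero]
    rw [this]
    ext x
    simp [alternatizeUncurryFin_apply]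
  · intro u v
    rw [hf, hf]
    ext x
    rw [ContinuousAlternatingMap.sub_apply (f' u v), hf'v, hf'v]
    have h1 := hB u v
    have h2 := hPK (A u) (A v)
    change B u v * η x - B v u * η x = -(P (A v) (A u) * η x) - -(P (A u) (A v) * η x)
    have h3 : (K (A u) (A v) : ℂ) = κ ![A u, A v] := rfl
    linear_combination (η x) * h1 - (η x) * h2 - η x * h3

end Antisymmetrization

/-! ### Exterior derivatives of products of 1-forms -/

section Leibniz

open ContinuousAlternatingMap (alternatizeUncurryFin alternatizeUncurryFinCLM
  alternatizeUncurryFin_apply alternatizeUncurryFin_add alternatizeUncurryFinCLM_apply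
  alternatizeUncurryFin_alternatizeUncurryFinCLM_comp_of_symmetric)

variable {E : Type*} [NormedAddCommGroup E] [NormedSpace ℝ E] {k : ℕ}

/-- The Leibniz rule for the product of a 1-form with a closed form: `d(θ ∧ η)` is the alternation
of `Dθ ⊗ η`, that is, `dθ ∧ η`. -/
theorem extDeriv_wedgeOne {θ : E → E →L[ℝ] ℂ} {η : E → E [⋀^Fin k]→L[ℝ] ℂ} {x : E}
    (hθ : DifferentiableAt ℝ θ x) (hη : DifferentiableAt ℝ η x) (hd : extDeriv η x = 0)
    (f : E →L[ℝ] E →L[ℝ] E [⋀^Fin k]→L[ℝ] ℂ) (hf : ∀ u v, f u v = fderiv ℝ θ x u v • η x) :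
    extDeriv (fun y => wedgeOne (θ y) (η y)) x =
      alternatizeUncurryFin (alternatizeUncurryFinCLM ℝ E ℂ ∘L f) := by
  have h1 := (wedgeOneL E k).hasFDerivAt_of_bilinear hη.hasFDerivAt hθ.hasFDerivAt
  simp only [wedgeOneL_apply] at h1
  rw [extDeriv, h1.fderiv, alternatizeUncurryFin_add]
  have e1 : (wedgeOneL E k).precompR E (η x) (fderiv ℝ θ x) =
      alternatizeUncurryFinCLM ℝ E ℂ ∘L f := by
    ext1 u
    change wedgeOneL E k (η x) (fderiv ℝ θ x u) = alternatizeUncurryFinCLM ℝ E ℂ (f u)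
    rw [wedgeOneL_apply, wedgeOne, alternatizeUncurryFinCLM_apply]
    congr 1
    ext1 v
    rw [hf]
    rfl
  rw [e1, add_eq_left]
  set f₂ : E →L[ℝ] E →L[ℝ] E [⋀^Fin k]→L[ℝ] ℂ :=
    ((ContinuousLinearMap.compL ℝ E (E [⋀^Fin k]→L[ℝ] ℂ) (E [⋀^Fin k]→L[ℝ] ℂ)).flip
      (fderiv ℝ η x)) ∘L (ContinuousLinearMap.lsmul ℝ ℂ :
        ℂ →L[ℝ] (E [⋀^Fin k]→L[ℝ] ℂ) →L[ℝ] (E [⋀^Fin k]→L[ℝ] ℂ)) ∘L (-θ x)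
  have hf₂ : ∀ u v, f₂ u v = (-θ x u) • fderiv ℝ η x v := fun u v => rfl
  set f₁ : E →L[ℝ] E →L[ℝ] E [⋀^Fin k]→L[ℝ] ℂ := -f₂.flip
  have e2 : (wedgeOneL E k).precompL E (fderiv ℝ η x) (θ x) =
      alternatizeUncurryFinCLM ℝ E ℂ ∘L f₁ := by
    ext1 u
    change wedgeOneL E k (fderiv ℝ η x u) (θ x) = alternatizeUncurryFinCLM ℝ E ℂ (f₁ u)
    rw [wedgeOneL_apply, wedgeOne, alternatizeUncurryFinCLM_apply]
    congr 1
    ext1 v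
    ext w
    change θ x v * fderiv ℝ η x u w = -(-θ x v * fderiv ℝ η x u w)
    ring
  -- transposing `f₁` turns the second term into `-θ ∧ dη`, which vanishes
  rw [e2, alternatize_congr (f' := f₂)]
  · have : alternatizeUncurryFinCLM ℝ E ℂ ∘L f₂ = 0 := by
      ext1 u
      ext v
      have h3 := congrArg (fun β : E [⋀^Fin (k + 1)]→L[ℝ] ℂ => -θ x u * β v) hd
      simp only [extDeriv, alternatizeUncurryFin_apply] at h3
      rw [ContinuousLinearMap.comp_apply, alternatizeUncurryFinCLM_apply,
        alternatizeUncurryFin_apply]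
      simp only [hf₂]
      simpa [Finset.mul_sum, mul_left_comm] using h3
    rw [this]
    ext v
    simp [alternatizeUncurryFin_apply]
  · intro u v
    simp only [f₁, _root_.neg_apply, ContinuousLinearMap.flip_apply]
    abel

theorem contDiffAt_wedgeProd {n : WithTop ℕ∞} {x : E} (k : ℕ) {lam : E → Fin k → (E →L[ℝ] ℂ)}
    (h : ∀ a, ContDiffAt ℝ n (fun y => lam y a) x) :
    ContDiffAt ℝ n (fun y => wedgeProd k (lam y)) x := by
  induction k with
  | zero => exact contDiffAt_const
  | succ k ih =>
    simp only [wedgeProd, ← wedgeOneL_apply]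
    have h1 := ih (lam := fun y => Fin.tail (lam y)) fun a => h a.succ
    exact ((wedgeOneL E k).contDiff.comp_contDiffAt _ h1).clm_apply (h 0)

/-- A wedge product of differentials of functions is closed. -/
theorem extDeriv_wedgeProd_fderiv {x : E} (k : ℕ) {ζ : Fin k → E → ℂ}
    (h : ∀ a, ContDiffAt ℝ ∞ (ζ a) x) :
    extDeriv (fun y => wedgeProd k fun a => fderiv ℝ (ζ a) y) x = 0 := by
  have hd : ∀ {ζ : E → ℂ}, ContDiffAt ℝ ∞ ζ x → ContDiffAt ℝ ∞ (fderiv ℝ ζ) x :=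
    fun h => h.fderiv_right (m := ∞) le_rfl
  induction k with
  | zero =>
    simp only [wedgeProd, extDeriv, fderiv_fun_const]
    ext v
    simp [alternatizeUncurryFin_apply]
  | succ k ih =>
    simp only [wedgeProd]
    set f : E →L[ℝ] E →L[ℝ] E [⋀^Fin k]→L[ℝ] ℂ :=
      ((ContinuousLinearMap.compL ℝ E ℂ (E [⋀^Fin k]→L[ℝ] ℂ))
        ((ContinuousLinearMap.lsmul ℝ ℂ :
          ℂ →L[ℝ] (E [⋀^Fin k]→L[ℝ] ℂ) →L[ℝ] (E [⋀^Fin k]→L[ℝ] ℂ)).flip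
          (wedgeProd k fun a => fderiv ℝ (ζ a.succ) x))) ∘L fderiv ℝ (fderiv ℝ (ζ 0)) x with hf
    have hfv : ∀ u v, f u v = fderiv ℝ (fderiv ℝ (ζ 0)) x u v •
        wedgeProd k fun a => fderiv ℝ (ζ a.succ) x := fun u v => rfl
    have h1 : extDeriv (fun y => wedgeProd k fun a => fderiv ℝ (ζ a.succ) y) x = 0 :=
      ih fun a => h a.succ
    refine (extDeriv_wedgeOne (θ := fun y => fderiv ℝ (ζ 0) y)
      (η := fun y => wedgeProd k fun a => fderiv ℝ (ζ a.succ) y)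
      ((hd (h 0)).differentiableAt (by simp))
      ((contDiffAt_wedgeProd k fun a => hd (h a.succ)).differentiableAt (by simp)) h1 f
      hfv).trans ?_
    refine alternatizeUncurryFin_alternatizeUncurryFinCLM_comp_of_symmetric fun u v => ?_
    have hsymm : IsSymmSndFDerivAt ℝ (ζ 0) x :=
      (h 0).isSymmSndFDerivAt (by
        rw [minSmoothness_of_isRCLikeNormedField]
        exact WithTop.coe_le_coe.2 le_top)
    rw [hfv, hfv, hsymm u v]

end Leibniz

/-! ### Differential forms in charts -/

section Charts

variable {E : Type*} [NormedAddCommGroup E] [NormedSpace ℝ E]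
  {M : Type*} [TopologicalSpace M] [ChartedSpace E M]
  {E' : Type*} [NormedAddCommGroup E'] [NormedSpace ℝ E']
  {M' : Type*} [TopologicalSpace M'] [ChartedSpace E' M']
  {E'' : Type*} [NormedAddCommGroup E''] [NormedSpace ℝ E'']
  {M'' : Type*} [TopologicalSpace M''] [ChartedSpace E'' M'']
  {F : Type*} [NormedAddCommGroup F] [NormedSpace ℝ F] {k : ℕ}

theorem tangentMapAt_comp {f : M' → M''} {g : M → M'} {x : M}
    (hf : ContMDiffAt 𝓘(ℝ, E') 𝓘(ℝ, E'') ∞ f (g x)) (hg : ContMDiffAt 𝓘(ℝ, E) 𝓘(ℝ, E') ∞ g x) :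
    tangentMapAt (E := E) (E' := E'') (f ∘ g) x =
      (tangentMapAt (E := E') (E' := E'') f (g x)).comp (tangentMapAt (E := E) (E' := E') g x) :=
  mfderiv_comp x (hf.mdifferentiableAt (by simp)) (hg.mdifferentiableAt (by simp))

/-- Read in the preferred charts of `x` and `f x`, the differential of `f` at `x` is the Fréchet
derivative of the coordinate expression of `f`. -/
theorem tangentMapAt_eq_fderiv {f : M → M'} {x : M}
    (hf : ContMDiffAt 𝓘(ℝ, E) 𝓘(ℝ, E') ∞ f x) :
    tangentMapAt (E := E) (E' := E') f x =
      fderiv ℝ (chartAt E' (f x) ∘ f ∘ (chartAt E x).symm) (chartAt E x x) := by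
  have h := (hf.mdifferentiableAt (by simp)).mfderiv
  simp only [mfld_simps, fderivWithin_univ, writtenInExtChartAt] at h
  exact h

theorem tangentMapAt_congr {f f' : M → M'} {x : M} (h : f =ᶠ[𝓝 x] f') :
    tangentMapAt (E := E) (E' := E') f x = tangentMapAt f' x :=
  h.mfderiv_eq

theorem tangentMapAt_id (x : M) :
    tangentMapAt (E := E) (E' := E) (fun y : M => y) x = ContinuousLinearMap.id ℝ E :=
  mfderiv_id

theorem tangentMapAt_vectorSpace (f : E → E') (y : E) :
    tangentMapAt (E := E) (E' := E') f y = fderiv ℝ f y :=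
  mfderiv_eq_fderiv

/-- The coordinate expression of a field of covectors. -/
noncomputable def covectorInChart (θ : M → E →L[ℝ] F) (x₀ : M) (y : E) : E →L[ℝ] F :=
  (θ ((chartAt E x₀).symm y)).comp (tangentMapAt (chartAt E x₀).symm y)

theorem inChart_oneForm (θ : M → E →L[ℝ] F) (x₀ : M) (y : E) :
    inChart (oneForm θ) x₀ y =
      ContinuousAlternatingMap.ofSubsingletonLIE (𝕜 := ℝ) (E := E) (F := F) (0 : Fin 1)
        (covectorInChart θ x₀ y) := by
  ext v
  rfl

theorem contDiffAt_inChart_oneForm_iff {θ : M → E →L[ℝ] F} {x₀ : M} {y : E} :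
    ContDiffAt ℝ ∞ (inChart (oneForm θ) x₀) y ↔ ContDiffAt ℝ ∞ (covectorInChart θ x₀) y := by
  have h : inChart (oneForm θ) x₀ =
      ContinuousAlternatingMap.ofSubsingletonLIE (𝕜 := ℝ) (E := E) (F := F) (0 : Fin 1) ∘
        covectorInChart θ x₀ := funext fun y => inChart_oneForm θ x₀ y
  rw [h]
  exact (ContinuousAlternatingMap.ofSubsingletonLIE (𝕜 := ℝ) (E := E) (F := F)
    (0 : Fin 1)).toContinuousLinearEquiv.comp_contDiffAt_iff

theorem SmoothFormOn.contDiffAt {α : M → E [⋀^Fin k]→L[ℝ] F} {U : Set M} (h : SmoothFormOn α U)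
    (hU : IsOpen U) {x₀ : M} {y : E} (hy : y ∈ (chartAt E x₀).target)
    (hyU : (chartAt E x₀).symm y ∈ U) : ContDiffAt ℝ ∞ (inChart α x₀) y :=
  (h x₀).contDiffAt (((chartAt E x₀).symm.isOpen_inter_preimage hU).mem_nhds ⟨hy, hyU⟩)

variable [IsManifold 𝓘(ℝ, E) ∞ M]

theorem contMDiffAt_chart_symm {x₀ : M} {y : E} (hy : y ∈ (chartAt E x₀).target) :
    ContMDiffAt 𝓘(ℝ, E) 𝓘(ℝ, E) ∞ (chartAt E x₀).symm y :=
  contMDiffOn_chart_symm.contMDiffAt ((chartAt E x₀).open_target.mem_nhds hy)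

theorem contMDiffAt_chart {x₀ x : M} (hx : x ∈ (chartAt E x₀).source) :
    ContMDiffAt 𝓘(ℝ, E) 𝓘(ℝ, E) ∞ (chartAt E x₀) x :=
  contMDiffOn_chart.contMDiffAt ((chartAt E x₀).open_source.mem_nhds hx)

theorem tangentMapAt_chart_symm_comp {x₀ x : M} (hx : x ∈ (chartAt E x₀).source) :
    (tangentMapAt (E := E) (E' := E) (chartAt E x₀).symm (chartAt E x₀ x)).comp
      (tangentMapAt (E := E) (E' := E) (chartAt E x₀) x) = ContinuousLinearMap.id ℝ E := by
  rw [← tangentMapAt_comp (contMDiffAt_chart_symm ((chartAt E x₀).map_source hx))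
    (contMDiffAt_chart hx), ← tangentMapAt_id (M := M) x]
  exact tangentMapAt_congr ((chartAt E x₀).eventually_left_inverse hx)

theorem tangentMapAt_chart_comp_symm {x₀ : M} {y : E} (hy : y ∈ (chartAt E x₀).target) :
    (tangentMapAt (E := E) (E' := E) (chartAt E x₀) ((chartAt E x₀).symm y)).comp
      (tangentMapAt (E := E) (E' := E) (chartAt E x₀).symm y) = ContinuousLinearMap.id ℝ E := by
  rw [← tangentMapAt_comp (contMDiffAt_chart ((chartAt E x₀).map_target hy))
    (contMDiffAt_chart_symm hy), ← tangentMapAt_id (M := E) y]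
  exact tangentMapAt_congr ((chartAt E x₀).eventually_right_inverse hy)

/-- The differential of the inverse of a chart, as an isomorphism. -/
noncomputable def chartSymmEquiv {x₀ : M} {y : E} (hy : y ∈ (chartAt E x₀).target) : E ≃L[ℝ] E :=
  ContinuousLinearEquiv.equivOfInverse (tangentMapAt (E := E) (E' := E) (chartAt E x₀).symm y)
    (tangentMapAt (E := E) (E' := E) (chartAt E x₀) ((chartAt E x₀).symm y))
    (fun v => congrArg (fun L : E →L[ℝ] E => L v) (tangentMapAt_chart_comp_symm hy))
    (fun v => by
      have h := tangentMapAt_chart_symm_comp ((chartAt E x₀).map_target hy)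
      rw [(chartAt E x₀).right_inv hy] at h
      exact congrArg (fun L : E →L[ℝ] E => L v) h)

/-- Tangent spaces are trivialised by the preferred charts, so the differential of the preferred
chart at its base point is the identity. -/
theorem tangentMapAt_chart_symm_self (x : M) :
    tangentMapAt (E := E) (E' := E) (chartAt E x).symm (chartAt E x x) =
      ContinuousLinearMap.id ℝ E := by
  have hy := mem_chart_target E x
  rw [tangentMapAt_eq_fderiv (contMDiffAt_chart_symm hy)]
  rw [(chartAt E x).left_inv (mem_chart_source E x), ← fderiv_fun_id (𝕜 := ℝ) (x := chartAt E x x)]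
  have h : chartAt E x ∘ (chartAt E x).symm =ᶠ[𝓝 (chartAt E x x)] fun y => y :=
    (chartAt E x).eventually_right_inverse hy
  exact h.fderiv_eq

theorem inChart_eq_zero_iff {α : M → E [⋀^Fin k]→L[ℝ] F} {x₀ : M} {y : E}
    (hy : y ∈ (chartAt E x₀).target) :
    inChart α x₀ y = 0 ↔ α ((chartAt E x₀).symm y) = 0 := by
  refine ⟨fun h0 => ContinuousAlternatingMap.ext fun w => ?_, fun h0 => by rw [inChart, h0]; rfl⟩
  have h1 := congrArg (fun β : E [⋀^Fin k]→L[ℝ] F =>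
    β fun i => (chartSymmEquiv hy).symm (w i)) h0
  have h2 : (fun i => tangentMapAt (E := E) (E' := E) (chartAt E x₀).symm y
      ((chartSymmEquiv hy).symm (w i))) = w :=
    funext fun i => (chartSymmEquiv hy).apply_symm_apply (w i)
  change α _ (fun i => tangentMapAt (E := E) (E' := E) (chartAt E x₀).symm y
    ((chartSymmEquiv hy).symm (w i))) = 0 at h1
  rwa [h2] at h1

theorem fderiv_comp_chart_symm {f : M → F} {x₀ : M} {y : E} (hy : y ∈ (chartAt E x₀).target)
    (hf : ContMDiffAt 𝓘(ℝ, E) 𝓘(ℝ, F) ∞ f ((chartAt E x₀).symm y)) :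
    fderiv ℝ (fun w => f ((chartAt E x₀).symm w)) y =
      (differential (E := E) f ((chartAt E x₀).symm y)).comp
        (tangentMapAt (chartAt E x₀).symm y) := by
  rw [← tangentMapAt_vectorSpace]
  exact tangentMapAt_comp hf (contMDiffAt_chart_symm hy)

theorem contDiffAt_comp_chart_symm {f : M → F} {x₀ : M} {y : E} (hy : y ∈ (chartAt E x₀).target)
    (hf : ContMDiffAt 𝓘(ℝ, E) 𝓘(ℝ, F) ∞ f ((chartAt E x₀).symm y)) :
    ContDiffAt ℝ ∞ (fun w => f ((chartAt E x₀).symm w)) y :=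
  (hf.comp y (contMDiffAt_chart_symm hy)).contDiffAt

/-- The coordinate expression of `f^* θ` is the pull-back of the coordinate expression of `θ` by the
smooth coordinate expression of `f`, in any chart `s₀` of the target. -/
theorem covectorInChart_pullback [IsManifold 𝓘(ℝ, E') ∞ M'] {f : M → M'}
    (hf : ContMDiff 𝓘(ℝ, E) 𝓘(ℝ, E') ∞ f) (θ : M' → E' →L[ℝ] F) {x₀ : M} {y : E}
    (hy : y ∈ (chartAt E x₀).target) {s₀ : M'}
    (hs : f ((chartAt E x₀).symm y) ∈ (chartAt E' s₀).source) :
    ContDiffAt ℝ ∞ (chartAt E' s₀ ∘ f ∘ (chartAt E x₀).symm) y ∧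
    covectorInChart (pullbackCovector f θ) x₀ y =
      (covectorInChart θ s₀ ((chartAt E' s₀ ∘ f ∘ (chartAt E x₀).symm) y)).comp
        (fderiv ℝ (chartAt E' s₀ ∘ f ∘ (chartAt E x₀).symm) y) := by
  have hc := contMDiffAt_chart_symm hy
  have hfc : ContMDiffAt 𝓘(ℝ, E) 𝓘(ℝ, E') ∞ (f ∘ (chartAt E x₀).symm) y :=
    hf.contMDiffAt.comp y hc
  have hP : ContMDiffAt 𝓘(ℝ, E) 𝓘(ℝ, E') ∞ (chartAt E' s₀ ∘ f ∘ (chartAt E x₀).symm) y :=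
    (contMDiffAt_chart hs).comp y hfc
  refine ⟨hP.contDiffAt, ?_⟩
  have hPt : (chartAt E' s₀ ∘ f ∘ (chartAt E x₀).symm) y ∈ (chartAt E' s₀).target :=
    (chartAt E' s₀).map_source hs
  have hinv : (chartAt E' s₀).symm ((chartAt E' s₀ ∘ f ∘ (chartAt E x₀).symm) y) =
      f ((chartAt E x₀).symm y) := (chartAt E' s₀).left_inv hs
  have heq : (chartAt E' s₀).symm ∘ (chartAt E' s₀ ∘ f ∘ (chartAt E x₀).symm) =ᶠ[𝓝 y]
      f ∘ (chartAt E x₀).symm := by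
    have := hfc.continuousAt.eventually ((chartAt E' s₀).eventually_left_inverse hs)
    exact this
  rw [covectorInChart, covectorInChart, pullbackCovector, ContinuousLinearMap.comp_assoc,
    ContinuousLinearMap.comp_assoc, ← tangentMapAt_comp hf.contMDiffAt hc,
    ← tangentMapAt_vectorSpace, ← tangentMapAt_comp (contMDiffAt_chart_symm hPt) hP,
    tangentMapAt_congr heq, hinv]

theorem eventually_covectorInChart_pullback [IsManifold 𝓘(ℝ, E') ∞ M'] {f : M → M'}
    (hf : ContMDiff 𝓘(ℝ, E) 𝓘(ℝ, E') ∞ f) (θ : M' → E' →L[ℝ] F) {x₀ : M} {y : E}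
    (hy : y ∈ (chartAt E x₀).target) {s₀ : M'}
    (hs : f ((chartAt E x₀).symm y) ∈ (chartAt E' s₀).source) :
    covectorInChart (pullbackCovector f θ) x₀ =ᶠ[𝓝 y] fun y =>
      (covectorInChart θ s₀ ((chartAt E' s₀ ∘ f ∘ (chartAt E x₀).symm) y)).comp
        (fderiv ℝ (chartAt E' s₀ ∘ f ∘ (chartAt E x₀).symm) y) := by
  have h1 : ContinuousAt (f ∘ (chartAt E x₀).symm) y :=
    hf.continuous.continuousAt.comp (contMDiffAt_chart_symm hy).continuousAt
  filter_upwards [h1.eventually ((chartAt E' s₀).open_source.mem_nhds hs),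
    (chartAt E x₀).open_target.mem_nhds hy] with w hw hwt
  exact (covectorInChart_pullback hf θ hwt hw).2

theorem contDiffAt_covectorInChart_pullback [IsManifold 𝓘(ℝ, E') ∞ M'] {f : M → M'}
    (hf : ContMDiff 𝓘(ℝ, E) 𝓘(ℝ, E') ∞ f) {θ : M' → E' →L[ℝ] F}
    (hθ : SmoothFormOn (oneForm θ) univ) {x₀ : M} {y : E} (hy : y ∈ (chartAt E x₀).target) :
    ContDiffAt ℝ ∞ (covectorInChart (pullbackCovector f θ) x₀) y := by
  set s₀ := f ((chartAt E x₀).symm y)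
  have hs := mem_chart_source E' s₀
  refine ContDiffAt.congr_of_eventuallyEq ?_ (eventually_covectorInChart_pullback hf θ hy hs)
  have hP := (covectorInChart_pullback hf θ hy hs).1
  have h1 : ContDiffAt ℝ ∞ (covectorInChart θ s₀)
      ((chartAt E' s₀ ∘ f ∘ (chartAt E x₀).symm) y) :=
    contDiffAt_inChart_oneForm_iff.1
      (hθ.contDiffAt isOpen_univ ((chartAt E' s₀).map_source hs) (mem_univ _))
  exact (h1.comp y hP).clm_comp (hP.fderiv_right (m := ∞) le_rfl)

/-- The exterior derivative of a 1-form is the skew part of its derivative. -/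
theorem extDeriv_ofSubsingleton {θ : E → E →L[ℝ] F} {y : E} (h : DifferentiableAt ℝ θ y)
    (u v : E) :
    extDeriv (fun w => ContinuousAlternatingMap.ofSubsingletonLIE (𝕜 := ℝ) (E := E) (F := F)
      (0 : Fin 1) (θ w)) y ![u, v] = fderiv ℝ θ y u v - fderiv ℝ θ y v u := by
  have h1 : DifferentiableAt ℝ (fun w => ContinuousAlternatingMap.ofSubsingletonLIE (𝕜 := ℝ)
      (E := E) (F := F) (0 : Fin 1) (θ w)) y :=
    (ContinuousAlternatingMap.ofSubsingletonLIE (𝕜 := ℝ) (E := E) (F := F)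
      (0 : Fin 1)).differentiable.differentiableAt.comp y h
  have h2 : ∀ a b, fderiv ℝ (fun w => θ w a) y b = fderiv ℝ θ y b a := by
    intro a b
    rw [fderiv_clm_apply h (differentiableAt_const a)]
    simp
  rw [extDeriv_apply h1, Fin.sum_univ_two]
  have e0 : (fun w => ContinuousAlternatingMap.ofSubsingletonLIE (𝕜 := ℝ) (E := E) (F := F)
      (0 : Fin 1) (θ w) ((0 : Fin 2).removeNth ![u, v])) = fun w => θ w v := rfl
  have e1 : (fun w => ContinuousAlternatingMap.ofSubsingletonLIE (𝕜 := ℝ) (E := E) (F := F)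
      (0 : Fin 1) (θ w) ((1 : Fin 2).removeNth ![u, v])) = fun w => θ w u := rfl
  rw [e0, e1, h2, h2]
  simp [sub_eq_add_neg]

/-- The exterior derivative commutes with the pull-back of 1-forms: the left hand side is
`d(f^* θ)(u, v)`. -/
theorem fderiv_covectorInChart_pullback_sub [IsManifold 𝓘(ℝ, E') ∞ M'] {f : M → M'}
    (hf : ContMDiff 𝓘(ℝ, E) 𝓘(ℝ, E') ∞ f) {θ : M' → E' →L[ℝ] F}
    (hθ : SmoothFormOn (oneForm θ) univ) (x : M) (u v : E) :
    fderiv ℝ (covectorInChart (pullbackCovector f θ) x) (chartAt E x x) u v -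
      fderiv ℝ (covectorInChart (pullbackCovector f θ) x) (chartAt E x x) v u =
    extDer (oneForm θ) (f x) ![tangentMapAt f x u, tangentMapAt f x v] := by
  have hy := mem_chart_target E x
  have hx := (chartAt E x).left_inv (mem_chart_source E x)
  have hs : f ((chartAt E x).symm (chartAt E x x)) ∈ (chartAt E' (f x)).source := by
    rw [hx]; exact mem_chart_source E' (f x)
  set P := chartAt E' (f x) ∘ f ∘ (chartAt E x).symm with hPdef
  have hP := (covectorInChart_pullback hf θ hy hs).1
  have hPx : P (chartAt E x x) = chartAt E' (f x) (f x) := by simp [hPdef, hx]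
  have hω : ContDiffAt ℝ ∞ (inChart (oneForm θ) (f x)) (P (chartAt E x x)) := by
    rw [hPx]
    exact hθ.contDiffAt isOpen_univ (mem_chart_target E' (f x)) (mem_univ _)
  rw [← extDeriv_ofSubsingleton
    ((contDiffAt_covectorInChart_pullback hf hθ hy).differentiableAt (by simp))]
  have h1 := extDeriv_pullback (hω.differentiableAt (by simp)) hP
    (by rw [minSmoothness_of_isRCLikeNormedField]; exact WithTop.coe_le_coe.2 le_top)
  rw [extDer, ← hPx, tangentMapAt_eq_fderiv hf.contMDiffAt]
  refine Eq.trans ?_ (congrArg (fun β => β ![u, v]) h1 |>.trans ?_)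
  · refine congrArg (fun β : E [⋀^Fin 2]→L[ℝ] F => β ![u, v]) (Filter.EventuallyEq.extDeriv_eq ?_)
    filter_upwards [eventually_covectorInChart_pullback hf θ hy hs] with w hw
    rw [hw, inChart_oneForm]
    rfl
  · change extDeriv _ _ _ = extDeriv _ _ _
    congr 1
    ext i
    fin_cases i <;> rfl

end Charts

/-! ### Holomorphic coordinates -/

section HolomorphicCoordinates

variable {m : ℕ} {N : Type*} [TopologicalSpace N] [ChartedSpace (EuclideanSpace ℂ (Fin m)) N]
  [IsManifold 𝓘(ℂ, EuclideanSpace ℂ (Fin m)) ω N]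
  {z : OpenPartialHomeomorph N (EuclideanSpace ℂ (Fin m))} {y : N}

theorem contDiffAt_coordinates (hz : z ∈ IsManifold.maximalAtlas 𝓘(ℂ, EuclideanSpace ℂ (Fin m)) ω N)
    (hy : y ∈ z.source) :
    ContDiffAt ℂ ω (z ∘ (chartAt (EuclideanSpace ℂ (Fin m)) y).symm)
      (chartAt (EuclideanSpace ℂ (Fin m)) y y) := by
  have h1 : ContMDiffAt 𝓘(ℂ, EuclideanSpace ℂ (Fin m)) 𝓘(ℂ, EuclideanSpace ℂ (Fin m)) ω
      (chartAt (EuclideanSpace ℂ (Fin m)) y).symm (chartAt (EuclideanSpace ℂ (Fin m)) y y) :=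
    contMDiffOn_chart_symm.contMDiffAt
      ((chartAt _ y).open_target.mem_nhds (mem_chart_target _ y))
  refine ContMDiffAt.contDiffAt (ContMDiffAt.comp _ ?_ h1)
  rw [(chartAt (EuclideanSpace ℂ (Fin m)) y).left_inv (mem_chart_source _ y)]
  exact contMDiffAt_of_mem_maximalAtlas hz hy

theorem contDiffAt_coordinates_symm
    (hz : z ∈ IsManifold.maximalAtlas 𝓘(ℂ, EuclideanSpace ℂ (Fin m)) ω N) (hy : y ∈ z.source) :
    ContDiffAt ℂ ω (chartAt (EuclideanSpace ℂ (Fin m)) y ∘ z.symm) (z y) := by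
  have h1 : ContMDiffAt 𝓘(ℂ, EuclideanSpace ℂ (Fin m)) 𝓘(ℂ, EuclideanSpace ℂ (Fin m)) ω
      z.symm (z y) := contMDiffAt_symm_of_mem_maximalAtlas hz (z.map_source hy)
  refine ContMDiffAt.contDiffAt (ContMDiffAt.comp _ ?_ h1)
  rw [z.left_inv hy]
  exact contMDiffOn_chart.contMDiffAt ((chartAt _ y).open_source.mem_nhds (mem_chart_source _ y))

/-- Holomorphic coordinates are smooth for the underlying real structure. -/
theorem contMDiffAt_coordinate
    (hz : z ∈ IsManifold.maximalAtlas 𝓘(ℂ, EuclideanSpace ℂ (Fin m)) ω N) (hy : y ∈ z.source)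
    (a : Fin m) :
    ContMDiffAt 𝓘(ℝ, EuclideanSpace ℂ (Fin m)) 𝓘(ℝ, ℂ) ∞ (fun n => z n a) y := by
  have h1 := ((contDiffAt_coordinates hz hy).restrict_scalars ℝ).of_le (m := ∞) le_top
  have h2 : ContDiffAt ℝ ∞ (fun v : EuclideanSpace ℂ (Fin m) => v a)
      ((z ∘ (chartAt (EuclideanSpace ℂ (Fin m)) y).symm)
        (chartAt (EuclideanSpace ℂ (Fin m)) y y)) :=
    ((EuclideanSpace.proj a : EuclideanSpace ℂ (Fin m) →L[ℂ] ℂ).contDiff.restrict_scalars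
      ℝ).contDiffAt
  rw [contMDiffAt_iff]
  constructor
  · exact (EuclideanSpace.proj a : EuclideanSpace ℂ (Fin m) →L[ℂ] ℂ).continuous.continuousAt.comp
      (z.continuousAt hy)
  · simp only [mfld_simps]
    exact (h2.comp _ h1).contDiffWithinAt

/-- The real differential of a holomorphic coordinate is its complex derivative in the preferred
chart. -/
theorem differential_coordinate
    (hz : z ∈ IsManifold.maximalAtlas 𝓘(ℂ, EuclideanSpace ℂ (Fin m)) ω N) (hy : y ∈ z.source)
    (a : Fin m) (v : EuclideanSpace ℂ (Fin m)) :
    differential (fun n => z n a) y v =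
      fderiv ℂ (z ∘ (chartAt (EuclideanSpace ℂ (Fin m)) y).symm)
        (chartAt (EuclideanSpace ℂ (Fin m)) y y) v a := by
  have h1 := ((contDiffAt_coordinates hz hy).differentiableAt (by simp)).hasFDerivAt
  have h2 := ((EuclideanSpace.proj a : EuclideanSpace ℂ (Fin m) →L[ℂ] ℂ).hasFDerivAt.comp _
    h1).restrictScalars ℝ
  have h3 : differential (fun n => z n a) y = fderiv ℝ _ _ :=
    tangentMapAt_eq_fderiv (contMDiffAt_coordinate hz hy a)
  rw [h3]
  exact congrArg (fun L : EuclideanSpace ℂ (Fin m) →L[ℝ] ℂ => L v) h2.fderiv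

/-- The differentials of holomorphic coordinates form a coframe of type `(1,0)`. -/
theorem isComplexCoframe_differential
    (hz : z ∈ IsManifold.maximalAtlas 𝓘(ℂ, EuclideanSpace ℂ (Fin m)) ω N) (hy : y ∈ z.source) :
    IsComplexCoframe fun a => differential (E := EuclideanSpace ℂ (Fin m)) (fun n => z n a) y where
  map_I := by
    intro a v
    rw [differential_coordinate hz hy, differential_coordinate hz hy, map_smul]
    rfl
  separating := by
    intro v hv
    set G := z ∘ (chartAt (EuclideanSpace ℂ (Fin m)) y).symm with hG
    have hGy : G (chartAt (EuclideanSpace ℂ (Fin m)) y y) = z y := by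
      simp [hG]
    have h1 := ((contDiffAt_coordinates hz hy).differentiableAt (by simp)).hasFDerivAt
    have h2 := ((contDiffAt_coordinates_symm hz hy).differentiableAt (by simp)).hasFDerivAt
    rw [← hGy] at h2
    -- the transition map `G` to the coordinates `z` is invertible, hence so is its derivative
    have h3 : (chartAt (EuclideanSpace ℂ (Fin m)) y ∘ z.symm) ∘ G
        =ᶠ[𝓝 (chartAt (EuclideanSpace ℂ (Fin m)) y y)] id := by
      have hc : ContinuousAt (chartAt (EuclideanSpace ℂ (Fin m)) y).symm
          (chartAt (EuclideanSpace ℂ (Fin m)) y y) :=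
        (chartAt _ y).continuousAt_symm (mem_chart_target _ y)
      have hs : z.source ∈ 𝓝 ((chartAt (EuclideanSpace ℂ (Fin m)) y).symm
          (chartAt (EuclideanSpace ℂ (Fin m)) y y)) := by
        rw [(chartAt (EuclideanSpace ℂ (Fin m)) y).left_inv (mem_chart_source _ y)]
        exact z.open_source.mem_nhds hy
      filter_upwards [hc.eventually hs, (chartAt (EuclideanSpace ℂ (Fin m)) y).open_target.mem_nhds
        (mem_chart_target _ y)] with w hw hwt
      simp only [hG, Function.comp_apply, id_eq]
      rw [z.left_inv hw, (chartAt (EuclideanSpace ℂ (Fin m)) y).right_inv hwt]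
    have h4 := ((h2.comp _ h1).congr_of_eventuallyEq h3.symm).unique (hasFDerivAt_id _)
    have h5 : fderiv ℂ G (chartAt (EuclideanSpace ℂ (Fin m)) y y) v = 0 := by
      ext a
      rw [← differential_coordinate hz hy]
      exact hv a
    have h6 := congrArg (fun L : EuclideanSpace ℂ (Fin m) →L[ℂ] EuclideanSpace ℂ (Fin m) => L v) h4
    have h7 : v = fderiv ℂ (chartAt (EuclideanSpace ℂ (Fin m)) y ∘ z.symm) _
      (fderiv ℂ G (chartAt (EuclideanSpace ℂ (Fin m)) y y) v) := h6.symm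
    rw [h7, h5, map_zero]

end HolomorphicCoordinates

/-! ### Values of forms under linear maps -/

section Forms

variable {E : Type*} [NormedAddCommGroup E] [NormedSpace ℝ E]
  {M : Type*} [TopologicalSpace M] [ChartedSpace E M]
  {F : Type*} [NormedAddCommGroup F] [NormedSpace ℝ F]
  {F' : Type*} [NormedAddCommGroup F'] [NormedSpace ℝ F'] {k : ℕ}

theorem extDeriv_compContinuousAlternatingMap (L : F →L[ℝ] F') {β : E → E [⋀^Fin k]→L[ℝ] F} {y : E}
    (h : DifferentiableAt ℝ β y) :
    extDeriv (fun w => L.compContinuousAlternatingMap (β w)) y =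
      L.compContinuousAlternatingMap (extDeriv β y) := by
  have h1 : DifferentiableAt ℝ (fun w => L.compContinuousAlternatingMap (β w)) y :=
    (L.compContinuousAlternatingMapCLM ℝ E F F' (Fin k)).differentiableAt.comp y h
  ext v
  rw [extDeriv_apply h1, ContinuousLinearMap.compContinuousAlternatingMap_coe, Function.comp_apply,
    extDeriv_apply h, map_sum]
  refine Finset.sum_congr rfl fun i _ => ?_
  rw [map_zsmul]
  congr 1
  have h2 : DifferentiableAt ℝ (fun w => β w (i.removeNth v)) y :=
    h.continuousAlternatingMap_apply_const _
  exact congrArg (fun L : E →L[ℝ] F' => L (v i)) (L.hasFDerivAt.comp y h2.hasFDerivAt).fderiv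

theorem SmoothFormOn.compContinuousAlternatingMap {α : M → E [⋀^Fin k]→L[ℝ] F} {U : Set M}
    (h : SmoothFormOn α U) (L : F →L[ℝ] F') :
    SmoothFormOn (fun x => L.compContinuousAlternatingMap (α x)) U := fun x₀ =>
  (L.compContinuousAlternatingMapCLM ℝ E F F' (Fin k)).contDiff.comp_contDiffOn (h x₀)

theorem extDer_compContinuousAlternatingMap {α : M → E [⋀^Fin k]→L[ℝ] F} {U : Set M}
    (h : SmoothFormOn α U) (hU : IsOpen U) {x : M} (hx : x ∈ U) (L : F →L[ℝ] F') :
    extDer (fun x => L.compContinuousAlternatingMap (α x)) x =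
      L.compContinuousAlternatingMap (extDer α x) := by
  refine extDeriv_compContinuousAlternatingMap L ((h.contDiffAt hU (mem_chart_target E x)
    ?_).differentiableAt (by simp))
  rwa [(chartAt E x).left_inv (mem_chart_source E x)]

/-- The exterior derivative is a local operator. -/
theorem extDer_congr {α β : M → E [⋀^Fin k]→L[ℝ] F} {U : Set M} (hU : IsOpen U)
    (h : ∀ x ∈ U, α x = β x) {x : M} (hx : x ∈ U) : extDer α x = extDer β x := by
  refine Filter.EventuallyEq.extDeriv_eq ?_
  have h1 : (chartAt E x).symm ⁻¹' U ∈ 𝓝 (chartAt E x x) := by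
    refine ((chartAt E x).continuousAt_symm (mem_chart_target E x)).preimage_mem_nhds ?_
    rw [(chartAt E x).left_inv (mem_chart_source E x)]
    exact hU.mem_nhds hx
  filter_upwards [h1] with w hw
  rw [inChart, inChart, h _ hw]

end Forms

/-! ### Smoothness and closedness of the wave -/

section Wave

variable {E : Type*} [NormedAddCommGroup E] [NormedSpace ℝ E]
  {M : Type*} [TopologicalSpace M] [ChartedSpace E M] [IsManifold 𝓘(ℝ, E) ∞ M]
  {E' : Type*} [NormedAddCommGroup E'] [NormedSpace ℝ E']
  {S : Type*} [TopologicalSpace S] [ChartedSpace E' S] [IsManifold 𝓘(ℝ, E') ∞ S]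
  {N : Type*} {m : ℕ} {q : M → N} {z : N → EuclideanSpace ℂ (Fin m)} {U : Set M}

theorem inChart_dzForm {x₀ : M} {y : E} (hy : y ∈ (chartAt E x₀).target)
    (hq : ∀ a, ContMDiffAt 𝓘(ℝ, E) 𝓘(ℝ, ℂ) ∞ (fun x => z (q x) a) ((chartAt E x₀).symm y)) :
    inChart (dzForm (E := E) q z) x₀ y =
      wedgeProd m fun a => fderiv ℝ (fun w => z (q ((chartAt E x₀).symm w)) a) y := by
  rw [inChart, dzForm, wedgeProd_comp]
  congr 1
  funext a
  exact (fderiv_comp_chart_symm hy (hq a)).symm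

theorem inChart_complexWave (ϑ : M → E →L[ℝ] ℝ) {x₀ : M} {y : E}
    (hy : y ∈ (chartAt E x₀).target)
    (hq : ∀ a, ContMDiffAt 𝓘(ℝ, E) 𝓘(ℝ, ℂ) ∞ (fun x => z (q x) a) ((chartAt E x₀).symm y)) :
    inChart (complexWave ϑ q z) x₀ y =
      wedgeOne (Complex.ofRealCLM.comp (covectorInChart ϑ x₀ y))
        (wedgeProd m fun a => fderiv ℝ (fun w => z (q ((chartAt E x₀).symm w)) a) y) := by
  rw [← inChart_dzForm hy hq, inChart, inChart, complexWave, wedgeOne_comp]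
  rfl

theorem smoothFormOn_dzForm (hU : IsOpen U)
    (hq : ∀ x ∈ U, ∀ a, ContMDiffAt 𝓘(ℝ, E) 𝓘(ℝ, ℂ) ∞ (fun x => z (q x) a) x) :
    SmoothFormOn (dzForm (E := E) q z) U := by
  intro x₀ y hy
  refine ContDiffAt.contDiffWithinAt (ContDiffAt.congr_of_eventuallyEq
    (contDiffAt_wedgeProd m fun a => ContDiffAt.fderiv_right (m := ∞)
      (contDiffAt_comp_chart_symm hy.1 (hq _ hy.2 a)) le_rfl) ?_)
  filter_upwards [((chartAt E x₀).symm.isOpen_inter_preimage hU).mem_nhds hy] with w hw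
  exact inChart_dzForm hw.1 (hq _ hw.2)

theorem smoothFormOn_complexWave {ϑ : M → E →L[ℝ] ℝ} (hU : IsOpen U)
    (hϑ : SmoothFormOn (oneForm ϑ) U)
    (hq : ∀ x ∈ U, ∀ a, ContMDiffAt 𝓘(ℝ, E) 𝓘(ℝ, ℂ) ∞ (fun x => z (q x) a) x) :
    SmoothFormOn (complexWave ϑ q z) U := by
  intro x₀ y hy
  have h1 : ContDiffAt ℝ ∞ (fun w => Complex.ofRealCLM.comp (covectorInChart ϑ x₀ w)) y :=
    contDiffAt_const.clm_comp (contDiffAt_inChart_oneForm_iff.1 (hϑ.contDiffAt hU hy.1 hy.2))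
  have h2 := ((wedgeOneL E m).contDiff.comp_contDiffAt _
    (((smoothFormOn_dzForm hU hq).contDiffAt hU hy.1 hy.2))).clm_apply h1
  refine ContDiffAt.contDiffWithinAt (ContDiffAt.congr_of_eventuallyEq h2 ?_)
  filter_upwards [((chartAt E x₀).symm.isOpen_inter_preimage hU).mem_nhds hy] with w hw
  rw [inChart_complexWave ϑ hw.1 (hq _ hw.2), ← inChart_dzForm hw.1 (hq _ hw.2)]
  exact (wedgeOneL_apply _ _).symm

theorem smoothFormOn_pullback {f : M → S} (hf : ContMDiff 𝓘(ℝ, E) 𝓘(ℝ, E') ∞ f)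
    {θ : S → E' →L[ℝ] ℝ} (hθ : SmoothFormOn (oneForm θ) univ) :
    SmoothFormOn (oneForm (pullbackCovector (E := E) f θ)) U := fun _ _ hy =>
  (contDiffAt_inChart_oneForm_iff.2
    (contDiffAt_covectorInChart_pullback hf hθ hy.1)).contDiffWithinAt

variable [FiniteDimensional ℝ E] in
/-- The wave is closed: `d(ϑ ∧ dz) = dϑ ∧ dz`, where `dϑ` is the pull-back of the Kähler form,
which has type `(1,1)`, and `dz` has the top type `(m,0)`. -/
theorem extDer_complexWave {V : Type*} [NormedAddCommGroup V] [NormedSpace ℝ V] [NormedSpace ℂ V]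
    [IsScalarTower ℝ ℂ V] [FiniteDimensional ℂ V] (hU : IsOpen U)
    (hq : ∀ x ∈ U, ∀ a, ContMDiffAt 𝓘(ℝ, E) 𝓘(ℝ, ℂ) ∞ (fun x => z (q x) a) x)
    {f : M → S} (hf : ContMDiff 𝓘(ℝ, E) 𝓘(ℝ, E') ∞ f)
    {θ : S → E' →L[ℝ] ℝ} (hθ : SmoothFormOn (oneForm θ) univ) {x : M} (hx : x ∈ U)
    {A : E →L[ℝ] V} {κ : V [⋀^Fin 2]→L[ℝ] ℝ}
    (hinv : ∀ v w, κ ![Complex.I • v, Complex.I • w] = κ ![v, w])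
    (hm : Module.finrank ℂ V = m) {lam : Fin m → (V →L[ℝ] ℂ)} (hl : IsComplexCoframe lam)
    (hlam : ∀ a, differential (E := E) (fun x => z (q x) a) x = (lam a).comp A)
    (hκ : ∀ u v, extDer (oneForm θ) (f x) ![tangentMapAt f x u, tangentMapAt f x v] =
      κ ![A u, A v]) :
    extDer (complexWave (pullbackCovector (E := E) f θ) q z) x = 0 := by
  set y := chartAt E x x
  have hy : y ∈ (chartAt E x).target := mem_chart_target E x
  have hyx : (chartAt E x).symm y = x := (chartAt E x).left_inv (mem_chart_source E x)
  have hyU : (chartAt E x).symm y ∈ U := by rwa [hyx]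
  set Θ := covectorInChart (pullbackCovector (E := E) f θ) x
  have hΘ : DifferentiableAt ℝ Θ y :=
    (contDiffAt_covectorInChart_pullback hf hθ hy).differentiableAt (by simp)
  have hζ : ∀ a, ContDiffAt ℝ ∞ (fun w => z (q ((chartAt E x).symm w)) a) y := fun a =>
    contDiffAt_comp_chart_symm hy (hq _ hyU a)
  set η : E → E [⋀^Fin m]→L[ℝ] ℂ := fun w =>
    wedgeProd m fun a => fderiv ℝ (fun w => z (q ((chartAt E x).symm w)) a) w
  have hη : ContDiffAt ℝ ∞ η y :=
    contDiffAt_wedgeProd m fun a => (hζ a).fderiv_right (m := ∞) le_rfl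
  have hηy : η y = wedgeProd m fun a => (lam a).comp A := by
    change wedgeProd m _ = _
    congr 1
    funext a
    rw [fderiv_comp_chart_symm hy (hq _ hyU a), hyx, hlam a, tangentMapAt_chart_symm_self]
    rfl
  have hΘc := ((ContinuousLinearMap.compL ℝ E ℝ ℂ) Complex.ofRealCLM).hasFDerivAt.comp y
    hΘ.hasFDerivAt
  have hΘc' : ∀ u v, fderiv ℝ (fun w => Complex.ofRealCLM.comp (Θ w)) y u v =
      (fderiv ℝ Θ y u v : ℂ) := fun u v =>
    congrArg (fun L : E →L[ℝ] E →L[ℝ] ℂ => L u v) hΘc.fderiv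
  let F : E →L[ℝ] E →L[ℝ] E [⋀^Fin m]→L[ℝ] ℂ :=
    ((ContinuousLinearMap.compL ℝ E ℂ (E [⋀^Fin m]→L[ℝ] ℂ))
      ((ContinuousLinearMap.lsmul ℝ ℂ :
        ℂ →L[ℝ] (E [⋀^Fin m]→L[ℝ] ℂ) →L[ℝ] (E [⋀^Fin m]→L[ℝ] ℂ)).flip (η y))) ∘L
      fderiv ℝ (fun w => Complex.ofRealCLM.comp (Θ w)) y
  have hF : ∀ u v, F u v = fderiv ℝ (fun w => Complex.ofRealCLM.comp (Θ w)) y u v • η y :=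
    fun u v => rfl
  have h1 : inChart (complexWave (pullbackCovector (E := E) f θ) q z) x =ᶠ[𝓝 y]
      fun w => wedgeOne (Complex.ofRealCLM.comp (Θ w)) (η w) := by
    filter_upwards [((chartAt E x).symm.isOpen_inter_preimage hU).mem_nhds ⟨hy, hyU⟩] with w hw
    exact inChart_complexWave _ hw.1 (hq _ hw.2)
  rw [extDer, h1.extDeriv_eq, extDeriv_wedgeOne
    (θ := fun w => Complex.ofRealCLM.comp (Θ w)) hΘc.differentiableAt
    (hη.differentiableAt (by simp)) (extDeriv_wedgeProd_fderiv m hζ) F hF]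
  refine alternatize_smul_eq_zero (A := A) hinv hm hl
    (fun u v => fderiv ℝ (fun w => Complex.ofRealCLM.comp (Θ w)) y u v) ?_ F ?_
  · intro u v
    rw [← hκ, ← fderiv_covectorInChart_pullback_sub hf hθ, hΘc', hΘc', ← Complex.ofReal_sub]
  · intro u v
    rw [hF, hηy]

end Wave

/-! ### Tangent spaces of bundles of Kähler–Sasaki type -/

section Bundles

variable {E : Type*} [NormedAddCommGroup E] [NormedSpace ℝ E]
  {M : Type*} [TopologicalSpace M] [ChartedSpace E M]
  {E' : Type*} [NormedAddCommGroup E'] [NormedSpace ℝ E']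
  {S : Type*} [TopologicalSpace S] [ChartedSpace E' S]

/-- The projection of a principal bundle is a submersion: a local section through a given point is
obtained by moving any local section along the orbits. -/
theorem IsPrincipalBundle.surjective_tangentMapAt {T : ℝ} {φ : Flow ℝ M} {π : M → S}
    (h : IsPrincipalBundle E E' T φ π) (x : M) :
    Function.Surjective (tangentMapAt (E := E) (E' := E') π x) := by
  obtain ⟨U, hU, hxU, σ, hσ, hσU⟩ := h.sections (π x)
  obtain ⟨t, ht⟩ := (h.fibres (σ (π x)) x).1 (hσU _ hxU)
  have hφ : ContMDiff 𝓘(ℝ, E) 𝓘(ℝ, E) ∞ (φ t) :=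
    h.smooth_action.comp (contMDiff_const.prodMk contMDiff_id)
  have hs : ContMDiffAt 𝓘(ℝ, E') 𝓘(ℝ, E) ∞ (φ t ∘ σ) (π x) :=
    hφ.contMDiffAt.comp _ (hσ.contMDiffAt (hU.mem_nhds hxU))
  have hsx : (φ t ∘ σ) (π x) = x := ht
  have h1 : π ∘ (φ t ∘ σ) =ᶠ[𝓝 (π x)] fun y => y := by
    filter_upwards [hU.mem_nhds hxU] with u hu
    have : π (σ u) = π (φ t (σ u)) := (h.fibres _ _).2 ⟨t, rfl⟩
    rw [Function.comp_apply, Function.comp_apply, ← this, hσU u hu]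
  have h2 := tangentMapAt_congr (E := E') (E' := E') h1
  rw [tangentMapAt_id, tangentMapAt_comp h.smooth_proj.contMDiffAt hs, hsx] at h2
  intro v
  exact ⟨tangentMapAt (φ t ∘ σ) (π x) v, congrArg (fun L : E' →L[ℝ] E' => L v) h2⟩

variable [IsManifold 𝓘(ℝ, E) ∞ M] [IsManifold 𝓘(ℝ, E') ∞ S]
  {V : Type*} [NormedAddCommGroup V] [NormedSpace ℝ V] [NormedSpace ℂ V]
  {N : Type*} [TopologicalSpace N] [ChartedSpace V N]
  {θ : S → E' →L[ℝ] ℝ} {J : S → E' →L[ℝ] E'} {T' : ℝ} {ψ : Flow ℝ S} {πS : S → N}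
  {κ : N → V [⋀^Fin 2]→L[ℝ] ℝ}

/-- The Reeb field `Z` is vertical: `dθ(Z, ·) = 0`, whereas `dθ` is the pull-back of the
nondegenerate form `κ`. -/
theorem IsRegularSasaki.tangentMapAt_reeb (h : IsRegularSasaki θ J T' ψ πS κ) (s : S) :
    tangentMapAt (E := E') (E' := V) πS s (fundamentalField ψ s) = 0 := by
  by_contra hne
  obtain ⟨w, hw⟩ := h.bundle.surjective_tangentMapAt s
    (Complex.I • tangentMapAt (E := E') (E' := V) πS s (fundamentalField ψ s))
  have h1 := h.sasaki.reeb_der s w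
  rw [h.curvature, hw] at h1
  exact (h.kahler.pos _ _ hne).ne' h1

/-- The value of `θ` and the projection to `N` of a tangent vector can be prescribed independently,
since adding a multiple of the Reeb field changes only the former. -/
theorem IsRegularSasaki.exists_tangentMapAt_eq (h : IsRegularSasaki θ J T' ψ πS κ) (s : S) (t : ℝ)
    (v : V) : ∃ u, θ s u = t ∧ tangentMapAt (E := E') (E' := V) πS s u = v := by
  obtain ⟨u, hu⟩ := h.bundle.surjective_tangentMapAt s v
  refine ⟨u + (t - θ s u) • fundamentalField ψ s, ?_, ?_⟩
  · rw [map_add, map_smul, h.sasaki.reeb_form]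
    simp
  · rw [map_add, map_smul, h.tangentMapAt_reeb, smul_zero, add_zero, hu]

variable {W : M → Submodule ℝ E} {g : M → E →L[ℝ] E →L[ℝ] ℝ} {T : ℝ} {φ : Flow ℝ M} {π : M → S}

/-- As `W` contains the vertical vectors, it is the full preimage of its projection `ker θ`. -/
theorem IsKahlerSasakiType.mem_distribution_iff
    (h : IsKahlerSasakiType W g T φ π θ J T' ψ πS κ) (x : M) (v : E) :
    v ∈ W x ↔ pullbackCovector π θ x v = 0 := by
  have hp := h.projects x
  constructor
  · intro hv
    have : tangentMapAt (E := E) (E' := E') π x v ∈ LinearMap.ker (θ (π x) : E' →ₗ[ℝ] ℝ) := by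
      rw [← hp]
      exact Submodule.mem_map_of_mem hv
    exact this
  · intro hv
    have h1 : tangentMapAt (E := E) (E' := E') π x v ∈ LinearMap.ker (θ (π x) : E' →ₗ[ℝ] ℝ) := hv
    rw [← hp] at h1
    obtain ⟨w, hw, hwv⟩ := h1
    have h2 : v - w ∈ LinearMap.ker (tangentMapAt (E := E) (E' := E') π x : E →ₗ[ℝ] E') := by
      rw [LinearMap.mem_ker, map_sub, sub_eq_zero]
      exact hwv.symm
    rw [← h.rtBundle.vertical] at h2
    simpa using (W x).add_mem h2.1 hw

theorem IsKahlerSasakiType.distribution_eq_ker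
    (h : IsKahlerSasakiType W g T φ π θ J T' ψ πS κ) (x : M) :
    W x = LinearMap.ker (pullbackCovector (E := E) π θ x : E →ₗ[ℝ] ℝ) :=
  Submodule.ext fun v => h.mem_distribution_iff x v

/-- The tangent spaces of a Lorentzian manifold of Kähler–Sasaki type have the algebraic structure
on which the pointwise computations are based. -/
theorem IsKahlerSasakiType.isHermitianQuotient
    (h : IsKahlerSasakiType W g T φ π θ J T' ψ πS κ) (hg : IsLorentzMetric g) (x : M) :
    IsHermitianQuotient (g x) (pullbackCovector π θ x)
      ((tangentMapAt (E := E') (E' := V) πS (π x)).comp (tangentMapAt (E := E) (E' := E') π x))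
      (κ (πS (π x))) where
  symm := hg.symm x
  nondegenerate := by
    intro v hv
    obtain ⟨t, -, ht⟩ := hg.signature x
    by_contra hne
    have h1 := ht v (by rw [hg.symm, hv]) hne
    rw [hv] at h1
    exact h1.false
  exists_vertical := by
    have h1 := h.rtBundle.shearfree.finrank_kernel x
    obtain ⟨⟨p, hp⟩, hp0, -⟩ := finrank_eq_one_iff'.1 h1
    rw [h.rtBundle.vertical] at hp
    have hp' : tangentMapAt (E := E) (E' := E') π x p = 0 := hp
    refine ⟨p, fun h0 => hp0 (Subtype.ext h0), ?_, ?_⟩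
    · rw [pullbackCovector, ContinuousLinearMap.comp_apply, hp', map_zero]
    · rw [ContinuousLinearMap.comp_apply, hp', map_zero]
  surjective := by
    intro t v
    obtain ⟨u, hu, huv⟩ := h.sasaki.exists_tangentMapAt_eq (π x) t v
    obtain ⟨w, hw⟩ := h.rtBundle.bundle.surjective_tangentMapAt x u
    refine ⟨w, ?_, ?_⟩
    · rw [pullbackCovector, ContinuousLinearMap.comp_apply, hw, hu]
    · rw [ContinuousLinearMap.comp_apply, hw, huv]
  invariant := h.sasaki.kahler.invariant _
  pos := h.sasaki.kahler.pos _
  levi := by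
    obtain ⟨c, hc, hl⟩ := h.levi x
    refine ⟨c, hc, fun v w hv hw => ?_⟩
    rw [hl v ((h.mem_distribution_iff x v).2 hv) w ((h.mem_distribution_iff x w).2 hw),
      h.sasaki.curvature,
      h.sasaki.holomorphic (π x) (tangentMapAt (E := E) (E' := E') π x w) hw]
    rfl

end Bundles

/-! ### Continuity of the Hodge star operator -/

section Continuity

variable {E : Type*} [NormedAddCommGroup E] [NormedSpace ℝ E]
  {X : Type*} [TopologicalSpace X] {G : X → E →L[ℝ] E →L[ℝ] ℝ} {x : X} {k l : ℕ}

/-- If two forms which depend continuously on a point of a connected set agree up to sign, and one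
of them vanishes nowhere, then the sign is constant. -/
theorem exists_constant_sign {D : Set X} (hD : IsPreconnected D) {Ψ Φ : X → E [⋀^Fin k]→L[ℝ] ℂ}
    {c : ℂ} (hc : c ≠ 0) (hΨ : ∀ x ∈ D, ∀ w, ContinuousAt (fun x => Ψ x w) x)
    (hΦ : ∀ x ∈ D, ∀ w, ContinuousAt (fun x => Φ x w) x) (hΦ0 : ∀ x ∈ D, Φ x ≠ 0)
    (h : ∀ x ∈ D, ∃ ε : ℂ, (ε = 1 ∨ ε = -1) ∧ Ψ x = (ε * c) • Φ x) :
    ∃ ε : ℂ, (ε = 1 ∨ ε = -1) ∧ ∀ x ∈ D, Ψ x = (ε * c) • Φ x := by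
  have h' : ∀ x, ∃ ε : ℂ, x ∈ D → (ε = 1 ∨ ε = -1) ∧ Ψ x = (ε * c) • Φ x := by
    intro x
    by_cases hx : x ∈ D
    · obtain ⟨ε, hε⟩ := h x hx
      exact ⟨ε, fun _ => hε⟩
    · exact ⟨1, fun hx' => (hx hx').elim⟩
  choose ε hε using h'
  have hcont : ContinuousOn ε D := by
    intro x hx
    obtain ⟨w, hw⟩ : ∃ w, Φ x w ≠ 0 := by
      by_contra hcon
      push Not at hcon
      exact hΦ0 x hx (ContinuousAlternatingMap.ext hcon)
    have h1 : ContinuousAt (fun y => Ψ y w / (c * Φ y w)) x :=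
      (hΨ x hx w).div (continuousAt_const.mul (hΦ x hx w)) (mul_ne_zero hc hw)
    have h3 : ∀ y ∈ D, Φ y w ≠ 0 → ε y = Ψ y w / (c * Φ y w) := by
      intro y hy hyw
      rw [(hε y hy).2, ContinuousAlternatingMap.smul_apply, smul_eq_mul]
      field_simp
    refine h1.continuousWithinAt.congr_of_eventuallyEq ?_ (h3 x hx hw)
    filter_upwards [self_mem_nhdsWithin, mem_nhdsWithin_of_mem_nhds
      ((hΦ x hx w).eventually_ne hw)] with y hy hyw
    exact h3 y hy hyw
  have hsq : EqOn (ε ^ 2) 1 D := by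
    intro x hx
    rcases (hε x hx).1 with h1 | h1 <;> simp [h1]
  rcases hD.eq_one_or_eq_neg_one_of_sq_eq hcont hsq with h1 | h1
  · exact ⟨1, Or.inl rfl, fun x hx => by rw [(hε x hx).2, h1 hx, Pi.one_apply]⟩
  · exact ⟨-1, Or.inr rfl, fun x hx => by rw [(hε x hx).2, h1 hx, Pi.neg_apply, Pi.one_apply]⟩

variable [FiniteDimensional ℝ E]

theorem continuousAt_dualFrame (hG : ContinuousAt G x) (hs : ∀ v w, G x v w = G x w v)
    (hn : ∀ v, (∀ w, G x v w = 0) → v = 0) (i : Fin (Module.finrank ℝ E)) :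
    ContinuousAt (fun x => dualFrame (G x) i) x := by
  have h1 : ContinuousAt (fun x => Matrix.of fun a b =>
      G x (Module.finBasis ℝ E a) (Module.finBasis ℝ E b)) x :=
    continuousAt_pi.2 fun a => continuousAt_pi.2 fun b =>
      (hG.clm_apply continuousAt_const).clm_apply continuousAt_const
  have h2 := (continuousAt_matrix_inv _ (by
    rw [Ring.inverse_eq_inv']
    exact continuousAt_inv₀ (det_gram_ne_zero hs hn (Module.finBasis ℝ E)))).comp h1
  exact tendsto_finsetSum _ fun j _ =>
    ((continuousAt_pi.1 (continuousAt_pi.1 h2 i) j).smul continuousAt_const)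

variable {F : Type*} [NormedAddCommGroup F] [NormedSpace ℝ F]

theorem continuousAt_hodgeStar {vol : X → E [⋀^Fin (k + l)]→L[ℝ] ℝ} {β : X → E [⋀^Fin k]→L[ℝ] F}
    (hG : ContinuousAt G x) (hs : ∀ v w, G x v w = G x w v)
    (hn : ∀ v, (∀ w, G x v w = 0) → v = 0) (hvol : ContinuousAt vol x) (hβ : ContinuousAt β x)
    (w : Fin l → E) : ContinuousAt (fun x => hodgeStar (G x) (vol x) (β x) w) x := by
  simp only [hodgeStar_apply]
  refine continuousAt_const.smul (tendsto_finsetSum _ fun i _ => ?_)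
  exact (hvol.eval continuousAt_const).smul
    (hβ.eval (continuousAt_pi.2 fun a => continuousAt_dualFrame hG hs hn (i a)))

theorem hodgeStar_compContinuousAlternatingMap {F' : Type*} [NormedAddCommGroup F']
    [NormedSpace ℝ F'] (g : E →L[ℝ] E →L[ℝ] ℝ) (vol : E [⋀^Fin (k + l)]→L[ℝ] ℝ)
    (L : F →L[ℝ] F') (β : E [⋀^Fin k]→L[ℝ] F) :
    hodgeStar g vol (L.compContinuousAlternatingMap β) =
      L.compContinuousAlternatingMap (hodgeStar g vol β) := by
  ext w
  simp only [hodgeStar_apply, ContinuousLinearMap.compContinuousAlternatingMap_coe,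
    Function.comp_apply, map_smul, map_sum]

end Continuity

/-! ### Metric and Hodge dual in a chart -/

section MetricInChart

variable {E : Type*} [NormedAddCommGroup E] [NormedSpace ℝ E]
  {M : Type*} [TopologicalSpace M] [ChartedSpace E M]

/-- The coordinate expression of a field of bilinear forms. -/
noncomputable def bilinearInChart (g : M → E →L[ℝ] E →L[ℝ] ℝ) (x₀ : M) (y : E) :
    E →L[ℝ] E →L[ℝ] ℝ :=
  (g ((chartAt E x₀).symm y)).bilinearComp (tangentMapAt (chartAt E x₀).symm y)
    (tangentMapAt (chartAt E x₀).symm y)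

theorem bilinearInChart_apply (g : M → E →L[ℝ] E →L[ℝ] ℝ) (x₀ : M) (y v w : E) :
    bilinearInChart g x₀ y v w = g ((chartAt E x₀).symm y)
      (tangentMapAt (chartAt E x₀).symm y v) (tangentMapAt (chartAt E x₀).symm y w) := rfl

theorem bilinearInChart_symm {g : M → E →L[ℝ] E →L[ℝ] ℝ} (hs : ∀ x v w, g x v w = g x w v)
    (x₀ : M) (y v w : E) : bilinearInChart g x₀ y v w = bilinearInChart g x₀ y w v :=
  hs _ _ _

variable [IsManifold 𝓘(ℝ, E) ∞ M]

/-- The coordinate vector fields are smooth. -/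
theorem contMDiffAt_chart_frame {x₀ : M} {y : E} (hy : y ∈ (chartAt E x₀).target) (u : E) :
    ContMDiffAt 𝓘(ℝ, E) 𝓘(ℝ, E).tangent ∞ (fun w => (⟨(chartAt E x₀).symm w,
      tangentMapAt (E := E) (E' := E) (chartAt E x₀).symm w u⟩ : TangentBundle 𝓘(ℝ, E) M)) y := by
  have : IsManifold 𝓘(ℝ, E) 1 M := IsManifold.of_le (n := ∞) (by simp)
  set e := trivializationAt E (TangentSpace 𝓘(ℝ, E)) x₀ with he
  have hb : ∀ w ∈ (chartAt E x₀).target, (chartAt E x₀).symm w ∈ e.baseSet := fun w hw =>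
    (chartAt E x₀).map_target hw
  rw [e.contMDiffAt_iff (e.mem_source.2 (hb y hy))]
  refine ⟨contMDiffAt_chart_symm hy, (contMDiffAt_const (c := u)).congr_of_eventuallyEq ?_⟩
  filter_upwards [(chartAt E x₀).open_target.mem_nhds hy] with w hw
  have h1 := TangentBundle.continuousLinearMapAt_trivializationAt (I := 𝓘(ℝ, E))
    ((chartAt E x₀).map_target hw)
  have h2 := e.continuousLinearMapAt_apply_of_mem ℝ (hb w hw)
    (tangentMapAt (E := E) (E' := E) (chartAt E x₀).symm w u)
  refine h2.symm.trans ?_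
  rw [h1]
  exact congrArg (fun L : E →L[ℝ] E => L u) (tangentMapAt_chart_comp_symm hw)

theorem bilinearInChart_nondegenerate {g : M → E →L[ℝ] E →L[ℝ] ℝ}
    (hn : ∀ x v, (∀ w, g x v w = 0) → v = 0) {x₀ : M} {y : E} (hy : y ∈ (chartAt E x₀).target)
    (v : E) (hv : ∀ w, bilinearInChart g x₀ y v w = 0) : v = 0 := by
  refine (chartSymmEquiv hy).injective ?_
  rw [map_zero]
  refine hn ((chartAt E x₀).symm y) _ fun w => ?_
  rw [← (chartSymmEquiv hy).apply_symm_apply w]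
  exact hv _

variable [FiniteDimensional ℝ E]

theorem contDiffAt_bilinearInChart {g : M → E →L[ℝ] E →L[ℝ] ℝ} (hg : SmoothBilinear g) {x₀ : M}
    {y : E} (hy : y ∈ (chartAt E x₀).target) : ContDiffAt ℝ ∞ (bilinearInChart g x₀) y := by
  have key : ∀ u v, ContDiffOn ℝ ∞ (fun w => bilinearInChart g x₀ w u v)
      (chartAt E x₀).target := by
    intro u v w hw
    have h1 := hg.contMDiffAt.comp w (contMDiffAt_chart_symm hw)
    have h2 := ContMDiffAt.clm_bundle_apply₂ (F₁ := E) (F₂ := E) (F₃ := ℝ)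
      (E₁ := fun x : M => TangentSpace 𝓘(ℝ, E) x) (E₂ := fun x : M => TangentSpace 𝓘(ℝ, E) x)
      (E₃ := fun _ : M => ℝ) h1
      (contMDiffAt_chart_frame hw u) (contMDiffAt_chart_frame hw v)
    rw [Bundle.contMDiffAt_totalSpace] at h2
    exact h2.2.contDiffAt.contDiffWithinAt
  exact (contDiffOn_clm_apply.2 fun u => contDiffOn_clm_apply.2 fun v => key u v).contDiffAt
    ((chartAt E x₀).open_target.mem_nhds hy)

theorem inChart_hodgeDual {F : Type*} [NormedAddCommGroup F] [NormedSpace ℝ F] {m : ℕ}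
    {g : M → E →L[ℝ] E →L[ℝ] ℝ} (hs : ∀ x v w, g x v w = g x w v)
    (hn : ∀ x v, (∀ w, g x v w = 0) → v = 0)
    (vol : M → E [⋀^Fin ((m + 1) + (m + 1))]→L[ℝ] ℝ) (Φ : M → E [⋀^Fin (m + 1)]→L[ℝ] F) {x₀ : M}
    {y : E} (hy : y ∈ (chartAt E x₀).target) :
    inChart (hodgeDual g vol Φ) x₀ y =
      hodgeStar (bilinearInChart g x₀ y) (inChart vol x₀ y) (inChart Φ x₀ y) :=
  (hodgeStar_comp (hs _) (hn _) (chartSymmEquiv hy) (bilinearInChart g x₀ y)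
    (fun _ _ => rfl) _ _).symm

end MetricInChart

/-! ### The volume form of a chart domain -/

section Volume

variable {E : Type*} [NormedAddCommGroup E] [NormedSpace ℝ E] [FiniteDimensional ℝ E] {n : ℕ}

/-- The determinant with respect to a basis, as a continuous alternating map. -/
noncomputable def basisDet (b : Module.Basis (Fin n) ℝ E) : E [⋀^Fin n]→L[ℝ] ℝ :=
  { b.det with
    cont := by
      change Continuous fun v => b.det v
      simp only [Module.Basis.det_apply]
      refine Continuous.matrix_det (continuous_matrix fun i j => ?_)
      exact (LinearMap.continuous_of_finiteDimensional (b.coord i)).comp (continuous_apply j) }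

theorem basisDet_apply (b : Module.Basis (Fin n) ℝ E) (v : Fin n → E) :
    basisDet b v = (b.toMatrix v).det := rfl

theorem basisDet_comp (b : Module.Basis (Fin n) ℝ E) (L : E →L[ℝ] E) :
    (basisDet b).compContinuousLinearMap L = basisDet b (fun i => L (b i)) • basisDet b := by
  ext v
  have h1 := congrArg (fun f : E [⋀^Fin n]→ₗ[ℝ] ℝ => f v)
    (AlternatingMap.eq_smul_basis_det b
      ((basisDet b).compContinuousLinearMap L).toAlternatingMap)
  exact h1

theorem det_gram (b : Module.Basis (Fin n) ℝ E) (g : E →L[ℝ] E →L[ℝ] ℝ) (v : Fin n → E) :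
    (Matrix.of fun i j => g (v i) (v j)).det =
      (Matrix.of fun i j => g (b i) (b j)).det * basisDet b v ^ 2 := by
  have h1 : (Matrix.of fun i j => g (v i) (v j)) =
      (b.toMatrix v).transpose * (Matrix.of fun i j => g (b i) (b j)) * b.toMatrix v := by
    ext i j
    simp only [Matrix.mul_apply, Matrix.transpose_apply, Matrix.of_apply,
      Module.Basis.toMatrix_apply]
    conv_lhs => rw [← b.sum_repr (v j), map_sum]
    refine Finset.sum_congr rfl fun c _ => ?_
    conv_lhs => rw [← b.sum_repr (v i)]
    rw [map_smul, map_sum, _root_.sum_apply, smul_eq_mul, mul_comm]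
    simp only [map_smul, _root_.smul_apply, smul_eq_mul]
  rw [h1, Matrix.det_mul, Matrix.det_mul, Matrix.det_transpose, basisDet_apply]
  ring

theorem contDiffAt_det {ι : Type*} [Fintype ι] [DecidableEq ι] {X : Type*} [NormedAddCommGroup X]
    [NormedSpace ℝ X] {k : WithTop ℕ∞} {A : X → Matrix ι ι ℝ} {x : X}
    (h : ∀ i j, ContDiffAt ℝ k (fun y => A y i j) x) : ContDiffAt ℝ k (fun y => (A y).det) x := by
  simp only [Matrix.det_apply]
  refine ContDiffAt.sum fun σ _ => ContDiffAt.const_smul _ ?_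
  exact contDiffAt_prod fun i _ => h _ _

variable {M : Type*} [TopologicalSpace M] [ChartedSpace E M] [IsManifold 𝓘(ℝ, E) ∞ M]

/-- A chart domain of a pseudo-Riemannian manifold carries a volume form, namely
`√|det (g_ij)| dx¹ ∧ ⋯ ∧ dxⁿ`. -/
theorem exists_isVolumeForm {g : M → E →L[ℝ] E →L[ℝ] ℝ} (hg : SmoothBilinear g)
    (hs : ∀ x v w, g x v w = g x w v) (hn : ∀ x v, (∀ w, g x v w = 0) → v = 0)
    (b : Module.Basis (Fin n) ℝ E) (x₀ : M) {U : Set M} (hU : U ⊆ (chartAt E x₀).source) :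
    ∃ vol : M → E [⋀^Fin n]→L[ℝ] ℝ, IsVolumeForm g vol U := by
  set c := chartAt E x₀ with hc
  set d : E → ℝ := fun y => (Matrix.of fun i j => bilinearInChart g x₀ y (b i) (b j)).det with hd
  have hd0 : ∀ y ∈ c.target, d y ≠ 0 := fun y hy =>
    det_gram_ne_zero (bilinearInChart_symm hs x₀ y) (bilinearInChart_nondegenerate hn hy) b
  have hds : ∀ y ∈ c.target, ContDiffAt ℝ ∞ d y := by
    intro y hy
    refine contDiffAt_det fun i j => ?_
    exact ((contDiffAt_bilinearInChart hg hy).clm_apply contDiffAt_const).clm_apply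
      contDiffAt_const
  refine ⟨fun x => √|d (c x)| • (basisDet b).compContinuousLinearMap
    (tangentMapAt (E := E) (E' := E) c x), ?_, ?_⟩
  · intro x₁ y hy
    have hyc : (chartAt E x₁).symm y ∈ c.source := hU hy.2
    set ψ : E → E := c ∘ (chartAt E x₁).symm with hψ
    have hψs : ContDiffAt ℝ ∞ ψ y :=
      ((contMDiffAt_chart hyc).comp y (contMDiffAt_chart_symm hy.1)).contDiffAt
    have hψy : ψ y ∈ c.target := c.map_source hyc
    -- in another chart, `ψ` being the transition map, the form is a multiple of `basisDet b`
    have h0 : ContDiffAt ℝ ∞ (fun w => √|d (ψ w)| * basisDet b fun i => fderiv ℝ ψ w (b i)) y := by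
      refine ContDiffAt.mul ?_ ?_
      · exact (((hds _ hψy).comp y hψs).abs (hd0 _ hψy)).sqrt (abs_ne_zero.2 (hd0 _ hψy))
      · refine ((basisDet b).toContinuousMultilinearMap.contDiff.contDiffAt).comp y
          (contDiffAt_pi.2 fun i => ?_)
        exact (hψs.fderiv_right (m := ∞) le_rfl).clm_apply contDiffAt_const
    have h1 : ContDiffAt ℝ ∞ (fun w => (√|d (ψ w)| * basisDet b fun i => fderiv ℝ ψ w (b i)) •
        basisDet b) y := h0.smul contDiffAt_const
    refine ContDiffAt.contDiffWithinAt (h1.congr_of_eventuallyEq ?_)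
    filter_upwards [(chartAt E x₁).open_target.mem_nhds hy.1,
      ((chartAt E x₁).continuousAt_symm hy.1).eventually (c.open_source.mem_nhds hyc)] with w hw hwc
    have h2 : (tangentMapAt (E := E) (E' := E) c ((chartAt E x₁).symm w)).comp
        (tangentMapAt (E := E) (E' := E) (chartAt E x₁).symm w) = fderiv ℝ ψ w := by
      rw [← tangentMapAt_vectorSpace, hψ]
      exact (tangentMapAt_comp (contMDiffAt_chart hwc) (contMDiffAt_chart_symm hw)).symm
    rw [mul_smul, ← basisDet_comp, ← h2]
    rfl
  · intro x hx v
    have hxc : x ∈ c.source := hU hx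
    have h1 : ∀ u, tangentMapAt (E := E) (E' := E) c.symm (c x)
        (tangentMapAt (E := E) (E' := E) c x u) = u := fun u =>
      congrArg (fun L : E →L[ℝ] E => L u) (tangentMapAt_chart_symm_comp hxc)
    have h2 : (Matrix.of fun i j => g x (v i) (v j)) = Matrix.of fun i j =>
        bilinearInChart g x₀ (c x) (tangentMapAt (E := E) (E' := E) c x (v i))
          (tangentMapAt (E := E) (E' := E) c x (v j)) := by
      ext i j
      simp only [Matrix.of_apply]
      rw [bilinearInChart_apply, h1, h1, c.left_inv hxc]
    rw [h2, det_gram b, abs_mul, abs_sq]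
    change (√|d (c x)| * basisDet b _) ^ 2 = |d (c x)| * _
    rw [mul_pow, Real.sq_sqrt (abs_nonneg _)]
    rfl

end Volume

/-! ### Constancy of the sign in the eigenvalue -/

section Local

variable {E : Type*} [NormedAddCommGroup E] [NormedSpace ℝ E]
  {M : Type*} [TopologicalSpace M] [ChartedSpace E M]

/-- Every point of a manifold has a chart neighbourhood inside a given neighbourhood which the
chart maps onto a connected set. -/
theorem exists_isPreconnected_chart_nhds {x₀ : M} {O : Set M} (hO : IsOpen O) (hx₀ : x₀ ∈ O) :
    ∃ D : Set E, IsOpen D ∧ IsPreconnected D ∧ D ⊆ (chartAt E x₀).target ∧ chartAt E x₀ x₀ ∈ D ∧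
      ∀ y ∈ D, (chartAt E x₀).symm y ∈ O := by
  have h1 : chartAt E x₀ x₀ ∈ (chartAt E x₀).target ∩ (chartAt E x₀).symm ⁻¹' O :=
    ⟨mem_chart_target E x₀, by
      rwa [mem_preimage, (chartAt E x₀).left_inv (mem_chart_source E x₀)]⟩
  obtain ⟨r, hr, hball⟩ := Metric.isOpen_iff.1
    ((chartAt E x₀).symm.isOpen_inter_preimage hO) _ h1
  exact ⟨Metric.ball (chartAt E x₀ x₀) r, Metric.isOpen_ball, (convex_ball _ _).isPreconnected,
    fun y hy => (hball hy).1, Metric.mem_ball_self hr, fun y hy => (hball hy).2⟩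

variable [FiniteDimensional ℝ E] [IsManifold 𝓘(ℝ, E) ∞ M]

/-- A nowhere vanishing smooth form which at each point of a connected chart domain is, up to a
sign, an eigenform of the Hodge star operator, has a constant sign. -/
theorem exists_constant_hodge_sign {m : ℕ} {g : M → E →L[ℝ] E →L[ℝ] ℝ} (hg : SmoothBilinear g)
    (hs : ∀ x v w, g x v w = g x w v) (hn : ∀ x v, (∀ w, g x v w = 0) → v = 0)
    {x₀ : M} {D : Set E} (hD : IsPreconnected D) (hDt : D ⊆ (chartAt E x₀).target)
    {U : Set M} (hU : IsOpen U) (hDU : U = (chartAt E x₀).source ∩ chartAt E x₀ ⁻¹' D)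
    {vol : M → E [⋀^Fin ((m + 1) + (m + 1))]→L[ℝ] ℝ} (hvol : SmoothFormOn vol U)
    {Φ : M → E [⋀^Fin (m + 1)]→L[ℝ] ℂ} (hΦ : SmoothFormOn Φ U) (hΦ0 : ∀ x ∈ U, Φ x ≠ 0)
    {c : ℂ} (hc : c ≠ 0)
    (h : ∀ x ∈ U, ∃ ε : ℂ, (ε = 1 ∨ ε = -1) ∧ hodgeDual g vol Φ x = (ε * c) • Φ x) :
    ∃ ε : ℂ, (ε = 1 ∨ ε = -1) ∧ ∀ x ∈ U, hodgeDual g vol Φ x = (ε * c) • Φ x := by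
  have hDU' : ∀ y ∈ D, (chartAt E x₀).symm y ∈ U := by
    intro y hy
    rw [hDU]
    refine ⟨(chartAt E x₀).map_target (hDt hy), ?_⟩
    rwa [mem_preimage, (chartAt E x₀).right_inv (hDt hy)]
  have hsmul : ∀ (a : ℂ) y, (hodgeDual g vol Φ ((chartAt E x₀).symm y) =
      a • Φ ((chartAt E x₀).symm y)) → inChart (hodgeDual g vol Φ) x₀ y = a • inChart Φ x₀ y := by
    intro a y hy
    rw [inChart, hy]
    rfl
  have hΨc : ∀ y ∈ D, ∀ w, ContinuousAt (fun y => inChart (hodgeDual g vol Φ) x₀ y w) y := by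
    intro y hy w
    have hyt := hDt hy
    have h1 : ContinuousAt (fun y => hodgeStar (bilinearInChart g x₀ y) (inChart vol x₀ y)
        (inChart Φ x₀ y) w) y :=
      continuousAt_hodgeStar (contDiffAt_bilinearInChart hg hyt).continuousAt
        (bilinearInChart_symm hs x₀ y) (bilinearInChart_nondegenerate hn hyt)
        (hvol.contDiffAt hU hyt (hDU' y hy)).continuousAt
        (hΦ.contDiffAt hU hyt (hDU' y hy)).continuousAt w
    refine h1.congr ?_
    filter_upwards [(chartAt E x₀).open_target.mem_nhds hyt] with v hv
    rw [inChart_hodgeDual hs hn vol Φ hv]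
  obtain ⟨ε, hε, hεD⟩ := exists_constant_sign hD hc hΨc
    (fun y hy w => (hΦ.contDiffAt hU (hDt hy) (hDU' y hy)).continuousAt.eval continuousAt_const)
    (fun y hy h0 => hΦ0 _ (hDU' y hy) ((inChart_eq_zero_iff (hDt hy)).1 h0)) fun y hy => by
      obtain ⟨ε, hε, hε'⟩ := h _ (hDU' y hy)
      exact ⟨ε, hε, hsmul _ _ hε'⟩
  refine ⟨ε, hε, fun x hx => ?_⟩
  have hx' := hx
  rw [hDU] at hx'
  have h1 := hεD _ hx'.2
  obtain ⟨ε', -, hε'⟩ := h x hx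
  have hxx := (chartAt E x₀).left_inv hx'.1
  have h2 := hsmul (ε' * c) (chartAt E x₀ x) (by rw [hxx, hε'])
  -- the sign at `x` is read off in the chart
  obtain ⟨w, hw⟩ : ∃ w, inChart Φ x₀ (chartAt E x₀ x) w ≠ 0 := by
    by_contra hcon
    push Not at hcon
    have h3 := (inChart_eq_zero_iff (hDt hx'.2)).1 (ContinuousAlternatingMap.ext hcon)
    exact hΦ0 x hx (by rwa [hxx] at h3)
  have h5 := congrArg (fun β : E [⋀^Fin (m + 1)]→L[ℝ] ℂ => β w) (h2.symm.trans h1)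
  have h6 : ε' * c = ε * c := mul_right_cancel₀ hw h5
  rw [hε', h6]

end Local

end KahlerSasaki

/-! ### Plane waves on Lorentzian manifolds of Kähler–Sasaki type -/

theorem mainTheorem2 (m : ℕ) (hm : 1 ≤ m)
    {M : Type*} [TopologicalSpace M] [T2Space M] [SecondCountableTopology M]
    [ChartedSpace (EuclideanSpace ℝ (Fin (2 * m + 2))) M]
    [IsManifold 𝓘(ℝ, EuclideanSpace ℝ (Fin (2 * m + 2))) ∞ M]
    {S : Type*} [TopologicalSpace S] [T2Space S] [SecondCountableTopology S]
    [ChartedSpace (EuclideanSpace ℝ (Fin (2 * m + 1))) S]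
    [IsManifold 𝓘(ℝ, EuclideanSpace ℝ (Fin (2 * m + 1))) ∞ S]
    {N : Type*} [TopologicalSpace N] [T2Space N] [SecondCountableTopology N]
    [ChartedSpace (EuclideanSpace ℂ (Fin m)) N]
    [IsManifold 𝓘(ℂ, EuclideanSpace ℂ (Fin m)) ω N]
    (g : M → EuclideanSpace ℝ (Fin (2 * m + 2)) →L[ℝ] EuclideanSpace ℝ (Fin (2 * m + 2)) →L[ℝ] ℝ)
    (hg : IsLorentzMetric g)
    (W : M → Submodule ℝ (EuclideanSpace ℝ (Fin (2 * m + 2))))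
    (T : ℝ) (φ : Flow ℝ M) (π : M → S)
    (θ : S → EuclideanSpace ℝ (Fin (2 * m + 1)) →L[ℝ] ℝ)
    (J : S → EuclideanSpace ℝ (Fin (2 * m + 1)) →L[ℝ] EuclideanSpace ℝ (Fin (2 * m + 1)))
    (T' : ℝ) (ψ : Flow ℝ S) (πS : S → N)
    (κ : N → EuclideanSpace ℂ (Fin m) [⋀^Fin 2]→L[ℝ] ℝ)
    (hKS : IsKahlerSasakiType W g T φ π θ J T' ψ πS κ)
    (x₀ : M) (z : OpenPartialHomeomorph N (EuclideanSpace ℂ (Fin m)))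
    (hz : z ∈ IsManifold.maximalAtlas 𝓘(ℂ, EuclideanSpace ℂ (Fin m)) ω N)
    (hx₀ : πS (π x₀) ∈ z.source)
    (ϑ : M → EuclideanSpace ℝ (Fin (2 * m + 2)) →L[ℝ] ℝ) (hϑ : ϑ = pullbackCovector π θ)
    (Φ : M → EuclideanSpace ℝ (Fin (2 * m + 2)) [⋀^Fin (m + 1)]→L[ℝ] ℂ)
    (hΦ : Φ = complexWave ϑ (πS ∘ π) z) :
    ∃ U : Set M, IsOpen U ∧ x₀ ∈ U ∧ (∀ x ∈ U, πS (π x) ∈ z.source) ∧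
      (∃ vol : M → EuclideanSpace ℝ (Fin (2 * m + 2)) [⋀^Fin ((m + 1) + (m + 1))]→L[ℝ] ℝ,
        IsVolumeForm g vol U) ∧
      ∀ vol : M → EuclideanSpace ℝ (Fin (2 * m + 2)) [⋀^Fin ((m + 1) + (m + 1))]→L[ℝ] ℝ,
        IsVolumeForm g vol U →
        (∀ x ∈ U, extDer Φ x = 0) ∧
        (∀ x ∈ U, extDer (hodgeDual g vol Φ) x = 0) ∧
        (∃ ε : ℂ, (ε = 1 ∨ ε = -1) ∧
          ∀ x ∈ U, hodgeDual g vol Φ x = (ε * Complex.I ^ m) • Φ x) ∧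
        (∀ x ∈ U, reForm (Φ x) ≠ 0) ∧
        IsPlaneWave g vol U (fun x => reForm (Φ x)) ϑ
          (fun x => reForm (dzForm (πS ∘ π) z x)) ∧
        IsFlagStructure g vol U (fun x => reForm (Φ x)) ϑ (fun x => radical (W x) (g x)) W := by
  subst hϑ hΦ
  have hπ := hKS.rtBundle.bundle.smooth_proj
  have hπS := hKS.sasaki.bundle.smooth_proj
  have hθ := hKS.sasaki.sasaki.smooth_form
  have hq : ContMDiff 𝓘(ℝ, EuclideanSpace ℝ (Fin (2 * m + 2))) 𝓘(ℝ, EuclideanSpace ℂ (Fin m)) ∞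
      (πS ∘ π) := hπS.comp hπ
  have hP := hKS.isHermitianQuotient hg
  have hfin : Module.finrank ℂ (EuclideanSpace ℂ (Fin m)) = m := by simp
  -- `U` corresponds to a ball in a chart, so that the sign `ε` is constant on it
  obtain ⟨D, hDo, hDp, hDt, hxD, hDO⟩ := exists_isPreconnected_chart_nhds
    (E := EuclideanSpace ℝ (Fin (2 * m + 2))) (z.open_source.preimage hq.continuous)
    (show x₀ ∈ (πS ∘ π) ⁻¹' z.source from hx₀)
  set c := chartAt (EuclideanSpace ℝ (Fin (2 * m + 2))) x₀
  set U : Set M := c.source ∩ c ⁻¹' D with hUdef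
  have hU : IsOpen U := c.isOpen_inter_preimage hDo
  have hUz : ∀ x ∈ U, πS (π x) ∈ z.source := by
    intro x hx
    have h1 := hDO _ hx.2
    rwa [c.left_inv hx.1] at h1
  have hqa : ∀ x ∈ U, ∀ a, ContMDiffAt 𝓘(ℝ, EuclideanSpace ℝ (Fin (2 * m + 2))) 𝓘(ℝ, ℂ) ∞
      (fun x => z ((πS ∘ π) x) a) x := fun x hx a =>
    (contMDiffAt_coordinate hz (hUz x hx) a).comp x hq.contMDiffAt
  set A : M → EuclideanSpace ℝ (Fin (2 * m + 2)) →L[ℝ] EuclideanSpace ℂ (Fin m) := fun x =>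
    (tangentMapAt πS (π x)).comp (tangentMapAt (E' := EuclideanSpace ℝ (Fin (2 * m + 1))) π x)
    with hA
  have hAq : ∀ x, tangentMapAt (πS ∘ π) x = A x := fun x =>
    tangentMapAt_comp hπS.contMDiffAt hπ.contMDiffAt
  set lam : N → Fin m → (EuclideanSpace ℂ (Fin m) →L[ℝ] ℂ) := fun y a =>
    differential (fun n => z n a) y
  have hl : ∀ x ∈ U, IsComplexCoframe (lam (πS (π x))) := fun x hx =>
    isComplexCoframe_differential hz (hUz x hx)
  have hlam : ∀ x ∈ U, ∀ a, differential (fun x => z ((πS ∘ π) x) a) x =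
      (lam (πS (π x)) a).comp (A x) := by
    intro x hx a
    rw [← hAq]
    exact tangentMapAt_comp (f := fun n => z n a) (g := πS ∘ π)
      (contMDiffAt_coordinate hz (hUz x hx) a) hq.contMDiffAt
  have hdz : ∀ x ∈ U, dzForm (πS ∘ π) z x = wedgeProd m fun a => (lam (πS (π x)) a).comp (A x) :=
    fun x hx => congrArg (wedgeProd m) (funext fun a => hlam x hx a)
  set ϑ : M → EuclideanSpace ℝ (Fin (2 * m + 2)) →L[ℝ] ℝ := pullbackCovector π θ
  set Φ := complexWave ϑ (πS ∘ π) z with hΦ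
  have hΦx : ∀ x ∈ U, Φ x = waveAt (ϑ x) (A x) (lam (πS (π x))) := fun x hx =>
    congrArg (wedgeOne (Complex.ofRealCLM.comp (ϑ x))) (hdz x hx)
  have hϑs : SmoothFormOn (oneForm ϑ) U := smoothFormOn_pullback hπ hθ
  have hdzs : SmoothFormOn (E := EuclideanSpace ℝ (Fin (2 * m + 2))) (dzForm (πS ∘ π) z) U :=
    smoothFormOn_dzForm hU hqa
  have hΦs : SmoothFormOn Φ U := smoothFormOn_complexWave hU hϑs hqa
  have hclosed : ∀ x ∈ U, extDer Φ x = 0 := fun x hx =>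
    extDer_complexWave hU hqa hπ hθ hx (hP x).invariant hfin (hl x hx) (hlam x hx)
      fun u v => hKS.sasaki.curvature _ _ _
  have hRe0 : ∀ x ∈ U, reForm (Φ x) ≠ 0 := by
    intro x hx
    rw [hΦx x hx]
    exact reForm_waveAt_ne_zero (hP x) hfin hm (hl x hx)
  have hΦ0 : ∀ x ∈ U, Φ x ≠ 0 := by
    intro x hx h0
    refine hRe0 x hx ?_
    rw [h0]
    rfl
  refine ⟨U, hU, ⟨mem_chart_source _ x₀, hxD⟩, hUz, ?_, fun vol hvol => ?_⟩
  · have hdim : Module.finrank ℝ (EuclideanSpace ℝ (Fin (2 * m + 2))) = (m + 1) + (m + 1) := by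
      rw [finrank_euclideanSpace_fin]
      ring
    exact exists_isVolumeForm hg.smooth hg.symm (fun x => (hP x).nondegenerate)
      (Module.finBasisOfFinrankEq ℝ _ hdim) x₀ inter_subset_left
  obtain ⟨ε, hε, hstar⟩ := exists_constant_hodge_sign hg.smooth hg.symm
    (fun x => (hP x).nondegenerate) hDp hDt hU hUdef hvol.1 hΦs hΦ0
    (pow_ne_zero m Complex.I_ne_zero) fun x hx => by
      obtain ⟨ε, hε, h1⟩ := hodgeStar_waveAt (hP x) hfin (hl x hx) (vol x) (hvol.2 x hx)
      rw [← hΦx x hx] at h1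
      exact ⟨ε, hε, h1⟩
  -- `∗Φ` is a constant multiple of the closed form `Φ`; this is needed for `∗Φ` and its real part
  have hcoclosed : ∀ {F : Type} [NormedAddCommGroup F] [NormedSpace ℝ F] (L : ℂ →L[ℝ] F),
      ∀ x ∈ U, extDer (fun x => L.compContinuousAlternatingMap (hodgeDual g vol Φ x)) x = 0 := by
    intro F _ _ L x hx
    have h1 : ∀ x ∈ U, L.compContinuousAlternatingMap (hodgeDual g vol Φ x) =
        (L.comp (ContinuousLinearMap.mul ℝ ℂ (ε * Complex.I ^ m))).compContinuousAlternatingMap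
          (Φ x) := by
      intro x hx
      rw [hstar x hx]
      rfl
    rw [extDer_congr hU h1 hx, extDer_compContinuousAlternatingMap hΦs hU hx, hclosed x hx]
    ext w
    exact map_zero (L.comp (ContinuousLinearMap.mul ℝ ℂ (ε * Complex.I ^ m)))
  have hRestar : ∀ x, hodgeDual g vol (fun x => reForm (Φ x)) x = reForm (hodgeDual g vol Φ x) :=
    fun x => hodgeStar_compContinuousAlternatingMap _ _ Complex.reCLM _
  refine ⟨hclosed, fun x hx => ?_, ⟨ε, hε, hstar⟩, hRe0, ?_, fun x hx => ⟨?_, ?_, ?_⟩⟩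
  · exact hcoclosed (ContinuousLinearMap.id ℝ ℂ) x hx
  · exact
    { smooth := hΦs.compContinuousAlternatingMap Complex.reCLM
      smooth_one := hϑs
      smooth_factor := hdzs.compContinuousAlternatingMap Complex.reCLM
      closed := by
        intro x hx
        refine (extDer_compContinuousAlternatingMap hΦs hU hx Complex.reCLM).trans ?_
        rw [hclosed x hx]
        rfl
      coclosed := by
        intro x hx
        rw [funext hRestar]
        exact hcoclosed Complex.reCLM x hx
      decomposition := fun x _ => reForm_wedgeOne _ _
      null := fun x _ => (hP x).exists_null_dual
      kernel := by
        intro x hx v hv hv0 w i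
        rw [reForm_apply, hdz x hx, wedgeProd_update_of_eq_zero, Complex.zero_re]
        intro a
        rw [ContinuousLinearMap.comp_apply, (hP x).eq_zero_of_null hv hv0, map_zero] }
  · ext v
    change v ∈ radical (W x) (g x) ↔ v ∈ formKernel (reForm (Φ x)) ⊓
      formKernel (hodgeDual g vol (fun x => reForm (Φ x)) x)
    rw [hKS.distribution_eq_ker, (hP x).mem_radical_iff, hRestar, hstar x hx, hΦx x hx,
      mem_formKernel_reForm_iff (hP x) hfin hm (hl x hx) hε]
  · rfl
  · exact hKS.distribution_eq_ker x
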